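/- Let $\Bbbk$ be a field and let $P$ be a simplicial poset, that is, a finite poset with a least element $\hat 0$ in which every interval $[\hat 0,y]$ is a Boolean lattice. The rank of $y\in P$ is the maximal length of a chain from $\hat 0$ to $y$, and the elements of rank $1$ (the vertices of $P$) are labelled $x_1,\dots,x_n$. For $w,y\in P$ let $\mathcal M(w,y)$ be the set of minimal upper bounds of $w$ and $y$, let $\operatorname{supp}(y)=\{i: x_i\preceq y\}$, and for $S\subseteq\operatorname{supp}(y)$ let $y_S$ be the unique element below $y$ with support $S$. Put $\operatorname{lk}_P(z)=\{w\in P: z\preceq w\}$ and, for $C\subseteq\{1,\dots,n\}$, $\operatorname{lk}_P(z)_{V\smallsetminus C}=\{w\in \operatorname{lk}_P(z): \operatorname{supp}(w)\cap C=\emptyset\}$. Let $A=\Bbbk[x_1,\dots,x_n]$ with its $\mathbb Z^n$-grading $\deg x_i=\mathbf e_i$, and let $A_P=\Bbbk[y: y\in P]/I_P$ be the face ring of $P$, where $I_P$ is generated by $\hat 0-1$, by $wy$ whenever $\mathcal M(w,y)=\emptyset$, and by $wy-(w\wedge y)\sum_{z\in\mathcal M(w,y)}z$ whenever $\mathcal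 M(w,y)\neq\emptyset$. With $\deg y=\sum_{i\in\operatorname{supp}(y)}\mathbf e_i$, $A_P$ is a $\mathbb Z^n$-graded $A$-module. For $\ell\ge 1$, $\operatorname{Ext}^i_A(A/(x_1^\ell,\dots,x_n^\ell),A_P)$ is $\mathbb Z^n$-graded through $\mathbb Z^n$-graded projective resolutions, a homomorphism being homogeneous of degree $\alpha$ if it maps degree $\beta$ to degree $\beta+\alpha$ for all $\beta$. For a simplicial poset $Q$, let $\widetilde H^{j}(Q)$ ($j\in\mathbb Z$) be the cohomology of the complex $\widetilde C^\bullet(Q)$ in which $\widetilde C^{j}(Q)$ is the $\Bbbk$-vector space with basis the elements of $Q$ of rank $j+1$ and $$\delta(y)=\sum_{a\not\preceq y}(-1)^{u_a}\sum_{z\in\mathcal M(a,y)}z,\qquad u_a=\#\{\text{vertices } b\preceq y: a<b\},$$ the outer sum running over the vertices $a$ of $Q$ with $a\not\preceq y$; here $<$ is an orientation of $Q$, i.e. any fixed partial order on the vertices of $Q$ that is total on the set of vertices below each element. Let $\ell\ge 1$, $i\ge 0$ and $\alpha\in\mathbb Z^n$, and set $B=\{j:-\ell<\alpha_j<0\}$,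 $C=\{j:\alpha_j=-\ell\}$, $D=\{j:\alpha_j>0\}$. If $\alpha_j\ge-\ell$ for all $j$, then, for any choice of orientations, there is an isomorphism of $\Bbbk$-vector spaces $$\operatorname{Ext}^i_A\bigl(A/(x_1^\ell,\dots,x_n^\ell),A_P\bigr)_\alpha\;\cong\bigoplus_{z\in P,\ \operatorname{supp}(z)=B\cup D}\widetilde H^{\,i-|B|-|C|-1}\bigl([\hat 0,z_D]\times \operatorname{lk}_P(z)_{V\smallsetminus C}\bigr),$$ where the product carries the componentwise order. If $\alpha_j<-\ell$ for some $j$, then $\operatorname{Ext}^i_A(A/(x_1^\ell,\dots,x_n^\ell),A_P)_\alpha=0$. Moreover, if $D\neq\emptyset$, then $\operatorname{Ext}^i_A(A/(x_1^\ell,\dots,x_n^\ell),A_P)_\alpha=0$. -/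

import Mathlib

universe u

noncomputable section

open CategoryTheory

namespace SimplicialPosets

/-! ### Combinatorics of simplicial posets -/

/-- A finite poset with least element all of whose lower intervals `[0̂, y]` are
(finite) Boolean lattices. -/
structure IsSimplicialPoset (P : Type u) [Finite P] [PartialOrder P] [OrderBot P] : Prop where
  boolean : ∀ y : P, ∃ r : ℕ, Nonempty (Set.Iic y ≃o Finset (Fin r))

/-- The rank of `y`: the maximal length of a chain ending in `y`. -/
def rank {Q : Type u} [PartialOrder Q] (y : Q) : ℕ := (Order.height y).toNat

/-- The atoms (vertices) of a poset: its elements of rank one. -/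
abbrev Atoms (Q : Type u) [PartialOrder Q] : Type u := {a : Q // rank a = 1}

/-- The set `M(w, y)` of minimal upper bounds of `w` and `y`. -/
def minUpper {Q : Type u} [PartialOrder Q] (w y : Q) : Set Q :=
  {z | Minimal (fun v => w ≤ v ∧ y ≤ v) z}

section Labelled

variable {P : Type u} [PartialOrder P] {n : ℕ}

open Classical in
/-- The support of a face, with respect to a labelling `x` of the vertices. -/
def supp (x : Fin n ≃ Atoms P) (y : P) : Finset (Fin n) :=
  Finset.univ.filter fun i => (x i : P) ≤ y

/-- The link of `y`. -/
def link (y : P) : Set P := {w | y ≤ w}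

/-- The faces with support contained in `W`. -/
def inducedOn (x : Fin n ≃ Atoms P) (W : Finset (Fin n)) : Set P := {y | supp x y ⊆ W}

open Classical in
/-- The face `y_B`: the unique face below `y` with support `B`, for `B ⊆ supp y`; see
`IsSimplicialPoset.existsUnique_face` and `IsSimplicialPoset.restrictFace_spec`. -/
def restrictFace (x : Fin n ≃ Atoms P) (y : P) (B : Finset (Fin n)) : P :=
  if h : ∃ w, w ≤ y ∧ supp x w = B then h.choose else y

end Labelled

theorem rank_eq_one_iff {P : Type u} [PartialOrder P] [OrderBot P] [Finite P] (a : P) :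
    rank a = 1 ↔ IsAtom a := by
  have key : Order.height a = 1 ↔ IsAtom a := by
    constructor
    · intro h
      refine ⟨?_, fun b hb => ?_⟩
      · rintro rfl
        simp at h
      · have h1 := Order.height_add_one_le hb
        rw [h] at h1
        have h0 : Order.height b = 0 := by
          have : Order.height b + 1 ≤ 0 + 1 := by simpa using h1
          simpa using (ENat.add_le_add_iff_right ENat.one_ne_top).1 this
        exact (Order.height_eq_zero.1 h0).eq_bot
    · intro h
      apply le_antisymm
      · refine Order.height_le_coe_iff.2 fun b hb => ?_
        rw [h.2 b hb]
        simp
      · exact Order.one_le_iff_ne_zero.2 fun h0 => h.1 (Order.height_eq_zero.1 h0).eq_bot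
  rw [← key, rank]
  constructor
  · intro h
    have := ENat.natCast_toNat (n := Order.height a) (by rintro h'; simp [h'] at h)
    rw [← this, h]; rfl
  · intro h
    rw [h]; rfl

theorem IsSimplicialPoset.existsUnique_face {P : Type u} [Finite P] [PartialOrder P]
    [OrderBot P] {n : ℕ} (hP : IsSimplicialPoset P) (x : Fin n ≃ Atoms P) (y : P)
    (B : Finset (Fin n)) (hB : B ⊆ supp x y) : ∃! w, w ≤ y ∧ supp x w = B := by
  classical
  obtain ⟨r, ⟨e⟩⟩ := hP.boolean y
  have atom_sing : ∀ i, ∀ h : (x i : P) ≤ y, ∃ t, e ⟨x i, h⟩ = {t} := by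
    intro i h
    have ha : IsAtom (x i : P) := (rank_eq_one_iff _).1 (x i).2
    have h2 : IsAtom (e ⟨x i, h⟩) := by
      rw [OrderIso.isAtom_iff]
      refine ⟨fun h0 => ha.1 (congrArg Subtype.val h0), fun b hb => ?_⟩
      exact Subtype.ext (ha.2 b.1 hb)
    exact Finset.isAtom_iff.1 h2
  have sing_atom : ∀ t : Fin r, ∃ i, ∃ h : (x i : P) ≤ y, e ⟨x i, h⟩ = {t} := by
    intro t
    have h1 : IsAtom (e.symm {t}) := by
      rw [OrderIso.isAtom_iff]
      exact Finset.isAtom_singleton t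
    have h2 : IsAtom (e.symm {t} : P) := by
      refine ⟨fun h0 => h1.1 (Subtype.ext h0), fun b hb => ?_⟩
      have := h1.2 ⟨b, hb.le.trans (e.symm {t}).2⟩ hb
      exact congrArg Subtype.val this
    have h3 : ((x (x.symm ⟨_, (rank_eq_one_iff _).2 h2⟩) : Atoms P) : P) = e.symm {t} := by simp
    refine ⟨x.symm ⟨_, (rank_eq_one_iff _).2 h2⟩, h3.le.trans (e.symm {t}).2, ?_⟩
    rw [show (⟨_, h3.le.trans (e.symm {t}).2⟩ : Set.Iic y) = e.symm {t} from Subtype.ext h3]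
    simp
  have mem_supp : ∀ (w : P) (i : Fin n), i ∈ supp x w ↔ (x i : P) ≤ w := by
    intro w i; simp [supp]
  have mem_e : ∀ (w : Set.Iic y) (i : Fin n) (h : (x i : P) ≤ y) (t : Fin r),
      e ⟨x i, h⟩ = {t} → (i ∈ supp x w ↔ t ∈ e w) := by
    intro w i h t ht
    rw [mem_supp, ← Finset.singleton_subset_iff, ← ht, e.le_iff_le]
    rfl
  refine ⟨e.symm (Finset.univ.filter fun t => ∃ i ∈ B, ∃ h : (x i : P) ≤ y, e ⟨x i, h⟩ = {t}),
    ⟨(e.symm _).2, ?_⟩, ?_⟩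
  · ext i
    constructor
    · intro hi
      have h : (x i : P) ≤ y := ((mem_supp _ _).1 hi).trans (e.symm _).2
      obtain ⟨t, ht⟩ := atom_sing i h
      rw [mem_e _ i h t ht] at hi
      simp only [OrderIso.apply_symm_apply, Finset.mem_filter, Finset.mem_univ, true_and] at hi
      obtain ⟨j, hj, h', hjt⟩ := hi
      have := e.injective (hjt.trans ht.symm)
      have h4 : x j = x i := Subtype.ext (Subtype.mk.inj this)
      exact x.injective h4 ▸ hj
    · intro hi
      have h : (x i : P) ≤ y := (mem_supp _ _).1 (hB hi)
      obtain ⟨t, ht⟩ := atom_sing i h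
      rw [mem_e _ i h t ht]
      simp only [OrderIso.apply_symm_apply, Finset.mem_filter, Finset.mem_univ, true_and]
      exact ⟨i, hi, h, ht⟩
  · rintro w ⟨hw, hwB⟩
    suffices h : (⟨w, hw⟩ : Set.Iic y) = e.symm (Finset.univ.filter fun t =>
        ∃ i ∈ B, ∃ h : (x i : P) ≤ y, e ⟨x i, h⟩ = {t}) from congrArg Subtype.val h
    rw [← e.apply_eq_iff_eq, OrderIso.apply_symm_apply]
    ext t
    obtain ⟨i, h, ht⟩ := sing_atom t
    rw [← mem_e ⟨w, hw⟩ i h t ht]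
    simp only [hwB, Finset.mem_filter, Finset.mem_univ, true_and]
    constructor
    · intro hi; exact ⟨i, hi, h, ht⟩
    · rintro ⟨j, hj, h', hjt⟩
      have := e.injective (hjt.trans ht.symm)
      have h4 : x j = x i := Subtype.ext (Subtype.mk.inj this)
      exact x.injective h4 ▸ hj

theorem IsSimplicialPoset.restrictFace_spec {P : Type u} [Finite P] [PartialOrder P]
    [OrderBot P] {n : ℕ} (hP : IsSimplicialPoset P) (x : Fin n ≃ Atoms P) (y : P)
    (B : Finset (Fin n)) (hB : B ⊆ supp x y) : restrictFace x y B ≤ y ∧ supp x (restrictFace x y B) = B := by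
  have h : ∃ w, w ≤ y ∧ supp x w = B := (hP.existsUnique_face x y B hB).exists
  rw [restrictFace, dif_pos h]
  exact h.choose_spec

/-! ### Reduced cohomology -/

/-- An orientation: a partial order on the vertices that is total on the vertices of each face. -/
structure Orientation (Q : Type u) [PartialOrder Q] where
  order : PartialOrder (Atoms Q)
  total : ∀ (y : Q) (a b : Atoms Q), (a : Q) ≤ y → (b : Q) ≤ y → order.le a b ∨ order.le b a

section Cohomology

variable (k : Type u) [Field k] {Q : Type u} [Finite Q] [PartialOrder Q]

open Classical in
/-- `δ(y) = ∑ (-1) ^ #{vertices b of y with a < b} ∑_{z ∈ M(a, y)} z`, the outer sum running over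
the vertices `a` that do not belong to `y`. A face `z` is identified with the basis vector
`Pi.single z 1` of the space `Q → k`. -/
def coboundaryFace (O : Orientation Q) (y : Q) : Q → k :=
  ∑ᶠ a ∈ {a : Atoms Q | ¬ (a : Q) ≤ y},
    (-1 : k) ^ (Set.ncard {b : Atoms Q | (b : Q) ≤ y ∧ O.order.lt a b}) •
      ∑ᶠ z ∈ minUpper (a : Q) y, (Pi.single z 1 : Q → k)

/-- The coboundary operator: the linear extension of `coboundaryFace`. -/
def coboundary (O : Orientation Q) : (Q → k) →ₗ[k] (Q → k) :=
  letI := Fintype.ofFinite Q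
  Fintype.linearCombination k (coboundaryFace k O)

/-- The reduced cochains of degree `j`: the space with basis the faces of rank `j + 1`. -/
def cochains (Q : Type u) [PartialOrder Q] (j : ℤ) : Submodule k (Q → k) where
  carrier := {c | ∀ y, (rank y : ℤ) ≠ j + 1 → c y = 0}
  add_mem' ha hb y hy := by simp [ha y hy, hb y hy]
  zero_mem' _ _ := rfl
  smul_mem' r c hc y hy := by simp [hc y hy]

/-- Reduced cocycles of degree `j`. -/
def cocycles (O : Orientation Q) (j : ℤ) : Submodule k (Q → k) :=
  cochains k Q j ⊓ LinearMap.ker (coboundary k O)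

/-- Reduced coboundaries of degree `j`. -/
def coboundaries (O : Orientation Q) (j : ℤ) : Submodule k (Q → k) :=
  (cochains k Q (j - 1)).map (coboundary k O)

/-- The reduced cohomology group of degree `j`, with coefficients in `k`. -/
abbrev ReducedCohomology (O : Orientation Q) (j : ℤ) : Type u :=
  cocycles k O j ⧸ (coboundaries k O j).comap (cocycles k O j).subtype

end Cohomology

/-! ### The face ring -/

section FaceRing

variable (k : Type u) [Field k]

/-- The defining ideal of the face ring. If `w` and `y` have an upper bound in a simplicial
poset, then they have a unique greatest lower bound `g = w ∧ y`. -/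
def faceIdeal (P : Type u) [PartialOrder P] [OrderBot P] : Ideal (MvPolynomial P k) :=
  Ideal.span
    ({p | ∃ w y : P, minUpper w y = ∅ ∧ p = MvPolynomial.X w * MvPolynomial.X y} ∪
     {p | ∃ w y g : P, (minUpper w y).Nonempty ∧ IsGLB {w, y} g ∧
        p = MvPolynomial.X w * MvPolynomial.X y -
          MvPolynomial.X g * ∑ᶠ z ∈ minUpper w y, MvPolynomial.X z} ∪
     {MvPolynomial.X ⊥ - 1})

/-- The face ring of a simplicial poset. -/
abbrev FaceRing (P : Type u) [PartialOrder P] [OrderBot P] : Type u :=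
  MvPolynomial P k ⧸ faceIdeal k P

variable {P : Type u} [PartialOrder P] [OrderBot P] {n : ℕ}

/-- The ring map `k[x₁, …, xₙ] → A_P` sending each variable to the corresponding vertex. -/
def toFaceRing (x : Fin n ≃ Atoms P) : MvPolynomial (Fin n) k →+* FaceRing k P :=
  (Ideal.Quotient.mk (faceIdeal k P)).comp
    (MvPolynomial.rename fun i => (x i : P)).toRingHom

/-- The face ring regarded as a module over `k[x₁, …, xₙ]`. -/
def FaceModule (_x : Fin n ≃ Atoms P) : Type u := FaceRing k P

instance (x : Fin n ≃ Atoms P) : AddCommGroup (FaceModule k x) :=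
  inferInstanceAs (AddCommGroup (FaceRing k P))

instance (x : Fin n ≃ Atoms P) : Module (MvPolynomial (Fin n) k) (FaceModule k x) :=
  Module.compHom (FaceRing k P) (toFaceRing k x)

/-- The `ℤⁿ`-degree of a face, the indicator vector of its support. -/
def faceDegree (x : Fin n ≃ Atoms P) (y : P) : Fin n → ℤ :=
  fun i => if i ∈ supp x y then 1 else 0

/-- The homogeneous part of degree `β` of the face ring: the image of the homogeneous part of
`k[P]`, where a variable `y` has degree `∑_{i ∈ supp y} eᵢ`. -/
def faceModuleDegree (x : Fin n ≃ Atoms P) (β : Fin n → ℤ) : AddSubgroup (FaceModule k x) :=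
  (MvPolynomial.weightedHomogeneousSubmodule k (faceDegree x) β).toAddSubgroup.map
    (Ideal.Quotient.mk (faceIdeal k P)).toAddMonoidHom

end FaceRing

/-! ### `ℤⁿ`-graded modules over the polynomial ring and the grading of `Ext` -/

section GradedExt

variable (k : Type u) [Field k] {n : ℕ}

/-- The homogeneous part of degree `β` of `k[x₁, …, xₙ]`, where `deg xᵢ = eᵢ`. -/
def polyDegree (β : Fin n → ℤ) : Submodule k (MvPolynomial (Fin n) k) :=
  MvPolynomial.weightedHomogeneousSubmodule k (fun i : Fin n => (Pi.single i 1 : Fin n → ℤ)) β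

/-- The ideal `(x₁^ℓ, …, xₙ^ℓ)`. -/
def powIdeal (n ℓ : ℕ) : Ideal (MvPolynomial (Fin n) k) :=
  Ideal.span (Set.range fun i : Fin n => MvPolynomial.X i ^ ℓ)

/-- The homogeneous part of degree `β` of `k[x₁, …, xₙ] / (x₁^ℓ, …, xₙ^ℓ)`. -/
def powQuotientDegree (n ℓ : ℕ) (β : Fin n → ℤ) :
    AddSubgroup (MvPolynomial (Fin n) k ⧸ powIdeal k n ℓ) :=
  (polyDegree k β).toAddSubgroup.map (Ideal.Quotient.mk (powIdeal k n ℓ)).toAddMonoidHom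

/-- The family `𝓜` makes `M` a `ℤⁿ`-graded module over `k[x₁, …, xₙ]`. -/
structure IsGradedModule {M : Type u} [AddCommGroup M] [Module (MvPolynomial (Fin n) k) M]
    (𝓜 : (Fin n → ℤ) → AddSubgroup M) : Prop where
  isInternal : DirectSum.IsInternal 𝓜
  smul_mem : ∀ (β γ : Fin n → ℤ) (a : MvPolynomial (Fin n) k) (m : M),
    a ∈ polyDegree k β → m ∈ 𝓜 γ → a • m ∈ 𝓜 (β + γ)

variable {M : Type u} [AddCommGroup M] [Module (MvPolynomial (Fin n) k) M]
variable {N : Type u} [AddCommGroup N] [Module (MvPolynomial (Fin n) k) N]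

/-- A projective resolution of the graded module `(M, 𝓜)` by graded modules, with differentials
and augmentation homogeneous of degree zero. -/
structure GradedResolution (𝓜 : (Fin n → ℤ) → AddSubgroup M) where
  res : ProjectiveResolution (ModuleCat.of (MvPolynomial (Fin n) k) M)
  degree : ∀ j : ℕ, (Fin n → ℤ) → AddSubgroup (res.complex.X j)
  isGraded : ∀ j, IsGradedModule k (degree j)
  d_mem : ∀ (j : ℕ) (β : Fin n → ℤ) (m : res.complex.X (j + 1)),
    m ∈ degree (j + 1) β → (res.complex.d (j + 1) j).hom m ∈ degree j β
  π_mem : ∀ (β : Fin n → ℤ) (m : res.complex.X 0), m ∈ degree 0 β →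
    (res.π.f 0 ≫ (HomologicalComplex.singleObjXSelf (ComplexShape.down ℕ) 0
      (ModuleCat.of (MvPolynomial (Fin n) k) M)).hom).hom m ∈ 𝓜 β

/-- The homogeneous part of degree `α` of the module `Ext^i(M, N)`, for graded modules `(M, 𝓜)`
and `(N, 𝓝)`: the `k`-subspace of the classes of those cocycles `f : F_i ⟶ N`, with `F` a graded
projective resolution of `M`, that are homogeneous of degree `α`, i.e. map the part of degree `β`
of `F_i` to the part of degree `β + α` of `N` for all `β`. -/
def extDegree (𝓜 : (Fin n → ℤ) → AddSubgroup M) (𝓝 : (Fin n → ℤ) → AddSubgroup N)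
    (i : ℕ) (α : Fin n → ℤ) :
    Submodule k (Abelian.Ext (ModuleCat.of (MvPolynomial (Fin n) k) M)
      (ModuleCat.of (MvPolynomial (Fin n) k) N) i) :=
  Submodule.span k
    {e | ∃ (F : GradedResolution k 𝓜)
        (f : F.res.complex.X i ⟶ ModuleCat.of (MvPolynomial (Fin n) k) N)
        (hf : F.res.complex.d (i + 1) i ≫ f = 0),
        (∀ (β : Fin n → ℤ) (m : F.res.complex.X i), m ∈ F.degree i β → f.hom m ∈ 𝓝 (β + α)) ∧
        e = F.res.extMk f (i + 1) rfl hf}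

end GradedExt

end SimplicialPosets

end

/-! `Ext` is computed from the Koszul complex on `x₁^ℓ, …, xₙ^ℓ`, which is a graded free resolution
of `A/(x₁^ℓ, …, xₙ^ℓ)` with one basis element `e_F` of degree `ℓ·1_F` for each subset `F` of the
variables. A cochain of degree `α` assigns to each `F` an element of `A_P` of degree `ℓ·1_F + α`.

The ring `A_P` has a basis of standard monomials `y·x^γ` with `supp γ ⊆ supp y`. They span by the
straightening relations (`span_stdMonomial`), and restriction to single faces reads off their
coefficients (`exists_eq_sum_stdMonomial`). So for `β ≥ 0` the part of degree `β` has one basis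
vector for each face `t` whose support is that of `β`, and it vanishes if some `β_j < 0`. In these
coordinates multiplication by `x_j^ℓ` is mere restriction of faces (`coord_X_pow_smul`,
`coord_subface`).

Hence the cochains of degree `α` have a basis of pairs `(F, t)` with `B ∪ C ⊆ F` and `supp t = (F ∖
C) ∪ D`. Each such `t` lies above exactly one of its own faces `z` with support `B ∪ D`. For fixed
`z` the pairs correspond to the faces of `[0̂, z_D] × lk(z)_{V∖C}`: the first component is the face
of `z_D` with support `F ∩ D`, the second is `t`. The rank of the face is `|F| - |B| - |C|`, whence
the degree shift. Under this correspondence the Koszul coboundary becomes the simplicial one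
(`linkCoord_koszulCoboundary`), up to signs that a diagonal change of basis removes
(`exists_sign_coboundary`). The complex therefore splits as a sum over `z`.

Since the graded pieces of `Ext` are spanned by classes coming from all graded resolutions, a
homogeneous comparison map from the Koszul resolution is also needed (`exists_comparison`); with it,
`range_koszulClass` and `ker_koszulClass` identify the piece of degree `α` with the cohomology of
homogeneous Koszul cochains.

If `α_j < -ℓ`, every `ℓ·1_F + α` has a negative coordinate and all cochains vanish. If `α_j > 0`,
multiplication by `x_j^ℓ` is bijective between the degrees involved, so the Koszul complex is
contractible in the direction `j`. -/

noncomputable section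

open CategoryTheory

namespace SimplicialPosets

/-! ### Koszul signs -/

section Sign

variable {ι : Type*} [LinearOrder ι]

/-- The sign `(-1) ^ #{b ∈ S | j < b}`. -/
def koszulSign (j : ι) (S : Finset ι) : ℤ := ∏ b ∈ S, if j < b then -1 else 1

theorem koszulSign_mul_self (j : ι) (S : Finset ι) : koszulSign j S * koszulSign j S = 1 := by
  rw [koszulSign, ← Finset.prod_mul_distrib]
  exact Finset.prod_eq_one fun b _ => by split_ifs <;> rfl

theorem koszulSign_union (j : ι) {S T : Finset ι} (h : Disjoint S T) :
    koszulSign j (S ∪ T) = koszulSign j S * koszulSign j T :=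
  Finset.prod_union h

theorem koszulSign_insert {j b : ι} {S : Finset ι} (hb : b ∉ S) :
    koszulSign j (insert b S) = (if j < b then -1 else 1) * koszulSign j S :=
  Finset.prod_insert hb

theorem koszulSign_eq_one {j : ι} {S : Finset ι} (h : ∀ b ∈ S, b ≤ j) : koszulSign j S = 1 :=
  Finset.prod_eq_one fun b hb => if_neg (h b hb).not_gt

/-- The two ways of adding `a ≠ b` to `S` have opposite signs. -/
theorem koszulSign_swap {a b : ι} (hab : a ≠ b) {S : Finset ι} (ha : a ∉ S) (hb : b ∉ S) :
    koszulSign a (insert b S) * koszulSign b S = -(koszulSign b (insert a S) * koszulSign a S) := by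
  rw [koszulSign_insert hb, koszulSign_insert ha]
  rcases lt_or_gt_of_ne hab with h | h
  · rw [if_pos h, if_neg h.not_gt]; ring
  · rw [if_pos h, if_neg h.not_gt]; ring

end Sign

/-! ### Posets whose lower intervals are labelled Boolean lattices -/

/-- The map `G` identifies every lower interval `[0̂, q]` with the lattice of subsets of `G q`. -/
structure IsLabelling {Q : Type*} [PartialOrder Q] {ι : Type*} (G : Q → Finset ι) : Prop where
  mono : Monotone G
  le_of_subset : ∀ {q p p' : Q}, p ≤ q → p' ≤ q → G p ⊆ G p' → p ≤ p'
  exists_face : ∀ (q : Q) (S : Finset ι), S ⊆ G q → ∃ p, p ≤ q ∧ G p = S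

open Classical in
/-- The face below `q` with label set `S`, for `S ⊆ G q`. -/
def subface {Q : Type*} [PartialOrder Q] {ι : Type*} (G : Q → Finset ι) (q : Q) (S : Finset ι) :
    Q :=
  if h : ∃ p, p ≤ q ∧ G p = S then h.choose else q

namespace IsLabelling

section Basic

variable {Q : Type*} [PartialOrder Q] {ι : Type*} {G : Q → Finset ι} (hG : IsLabelling G)

include hG

theorem subface_le {q : Q} {S : Finset ι} (hS : S ⊆ G q) : subface G q S ≤ q := by
  have h := hG.exists_face q S hS
  rw [subface, dif_pos h]
  exact h.choose_spec.1

theorem map_subface {q : Q} {S : Finset ι} (hS : S ⊆ G q) : G (subface G q S) = S := by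
  have h := hG.exists_face q S hS
  rw [subface, dif_pos h]
  exact h.choose_spec.2

theorem eq_of_le {q p p' : Q} (h : p ≤ q) (h' : p' ≤ q) (e : G p = G p') : p = p' :=
  le_antisymm (hG.le_of_subset h h' e.le) (hG.le_of_subset h' h e.ge)

theorem eq_subface {q p : Q} {S : Finset ι} (h : p ≤ q) (e : G p = S) : p = subface G q S := by
  have hS : S ⊆ G q := e ▸ hG.mono h
  exact hG.eq_of_le h (hG.subface_le hS) (e.trans (hG.map_subface hS).symm)

theorem card_lt {p q : Q} (h : p < q) : (G p).card < (G q).card := by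
  refine Finset.card_lt_card (lt_of_le_of_ne (hG.mono h.le) fun e => h.ne ?_)
  exact hG.eq_of_le h.le le_rfl e

/-- Going up strictly enlarges the label set, and erasing one label produces a face exactly one step
lower; induction on the number of labels gives both bounds. -/
theorem height_eq [DecidableEq ι] (q : Q) : Order.height q = (G q).card := by
  induction hm : (G q).card using Nat.strong_induction_on generalizing q with
  | _ m ih =>
    apply le_antisymm
    · refine Order.height_le_coe_iff.2 fun p hp => ?_
      rw [ih _ (hm ▸ hG.card_lt hp) p rfl]
      exact_mod_cast hm ▸ hG.card_lt hp
    · rcases (G q).eq_empty_or_nonempty with h0 | ⟨j, hj⟩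
      · simp [← hm, h0]
      · have hs : (G q).erase j ⊆ G q := Finset.erase_subset _ _
        have hle := hG.subface_le hs
        have hmap := hG.map_subface hs
        have hlt : subface G q ((G q).erase j) < q := by
          refine lt_of_le_of_ne hle fun e => ?_
          rw [e] at hmap
          exact Finset.notMem_erase j (G q) (hmap ▸ hj)
        have hc : (G (subface G q ((G q).erase j))).card + 1 = m := by
          rw [hmap, ← hm, Finset.card_erase_add_one hj]
        have := Order.height_add_one_le hlt
        rw [ih _ (by omega) _ rfl] at this
        rw [← hc]
        exact_mod_cast this

end Basic

/-! ### Rank, vertices and minimal upper bounds in terms of labels -/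

section Cohomology

variable {Q : Type u} [PartialOrder Q] {ι : Type*} {G : Q → Finset ι} (hG : IsLabelling G)

include hG

theorem rank_eq [DecidableEq ι] (q : Q) : rank q = (G q).card := by
  rw [rank, hG.height_eq]; rfl

theorem exists_label [DecidableEq ι] (a : Atoms Q) : ∃ j, G a = {j} :=
  Finset.card_eq_one.1 (hG.rank_eq (a : Q) ▸ a.2)

theorem exists_atom [DecidableEq ι] {q : Q} {j : ι} (hj : j ∈ G q) :
    ∃ a : Atoms Q, (a : Q) ≤ q ∧ G a = {j} := by
  have hs := Finset.singleton_subset_iff.2 hj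
  refine ⟨⟨subface G q {j}, ?_⟩, hG.subface_le hs, hG.map_subface hs⟩
  rw [hG.rank_eq, hG.map_subface hs, Finset.card_singleton]

theorem atom_le_iff {q p : Q} {a : Q} {j : ι} (ha : G a = {j}) (haq : a ≤ q) (hp : p ≤ q) :
    a ≤ p ↔ j ∈ G p := by
  refine ⟨fun h => hG.mono h (by simp [ha]), fun h => hG.le_of_subset haq hp ?_⟩
  simpa [ha] using h

/-- This inverts the sum in the coboundary: seen from `q`, the vertex `a` determines `y`, which must
be the facet of `q` opposite to `a`. -/
theorem mem_minUpper_iff [DecidableEq ι] {a y q : Q} {j : ι} (ha : G a = {j}) :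
    (¬ a ≤ y ∧ q ∈ minUpper a y) ↔
      a ≤ q ∧ j ∈ G q ∧ y = subface G q ((G q).erase j) := by
  constructor
  · rintro ⟨hay, hq⟩
    have haq := hq.1.1
    have hyq := hq.1.2
    have hjy : j ∉ G y := fun h => hay ((hG.atom_le_iff ha haq hyq).2 h)
    have hjq : j ∈ G q := hG.mono haq (by simp [ha])
    have hs : insert j (G y) ⊆ G q := Finset.insert_subset hjq (hG.mono hyq)
    -- The face of `q` with labels `G y ∪ {j}` is already an upper bound, so by minimality `q` has
    -- no further labels.
    have h1 : a ≤ subface G q (insert j (G y)) :=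
      hG.le_of_subset haq (hG.subface_le hs) (by simp [ha, hG.map_subface hs])
    have h2 : y ≤ subface G q (insert j (G y)) :=
      hG.le_of_subset hyq (hG.subface_le hs) (by simp [hG.map_subface hs])
    have h3 := hG.mono (hq.2 ⟨h1, h2⟩ (hG.subface_le hs))
    rw [hG.map_subface hs] at h3
    refine ⟨haq, hjq, hG.eq_subface hyq ?_⟩
    rw [← hs.antisymm h3, Finset.erase_insert hjy]
  · rintro ⟨haq, hjq, rfl⟩
    have hs : (G q).erase j ⊆ G q := Finset.erase_subset _ _
    refine ⟨fun h => ?_, ⟨haq, hG.subface_le hs⟩, fun v hv hvq => ?_⟩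
    · have := (hG.atom_le_iff ha haq (hG.subface_le hs)).1 h
      rw [hG.map_subface hs] at this
      exact Finset.notMem_erase _ _ this
    · refine hG.le_of_subset le_rfl hvq ?_
      have h1 := hG.mono hv.2
      rw [hG.map_subface hs] at h1
      have h2 : j ∈ G v := hG.mono hv.1 (by simp [ha])
      intro t ht
      by_cases htj : t = j
      · exact htj ▸ h2
      · exact h1 (Finset.mem_erase.2 ⟨htj, ht⟩)

omit hG in
/-- The order that an orientation induces on the labels of a face. -/
def labelRel (G : Q → Finset ι) (O : Orientation Q) (q : Q) (j b : ι) : Prop :=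
  ∃ a a' : Atoms Q, (a : Q) ≤ q ∧ (a' : Q) ≤ q ∧ G a = {j} ∧ G a' = {b} ∧ O.order.lt a a'

theorem labelRel_iff (O : Orientation Q) {q : Q} {a a' : Atoms Q} {j b : ι} (ha : (a : Q) ≤ q)
    (ha' : (a' : Q) ≤ q) (hj : G a = {j}) (hb : G a' = {b}) :
    labelRel G O q j b ↔ O.order.lt a a' := by
  refine ⟨?_, fun h => ⟨a, a', ha, ha', hj, hb, h⟩⟩
  rintro ⟨c, c', hc, hc', hcj, hcb, h⟩
  have h1 : c = a := Subtype.ext (hG.eq_of_le hc ha (hcj.trans hj.symm))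
  have h2 : c' = a' := Subtype.ext (hG.eq_of_le hc' ha' (hcb.trans hb.symm))
  rwa [h1, h2] at h

theorem labelRel_of_le [DecidableEq ι] (O : Orientation Q) {p q : Q} (hp : p ≤ q) {j b : ι}
    (hj : j ∈ G p) (hb : b ∈ G p) : labelRel G O p j b ↔ labelRel G O q j b := by
  obtain ⟨a, ha, haj⟩ := hG.exists_atom hj
  obtain ⟨a', ha', haj'⟩ := hG.exists_atom hb
  rw [hG.labelRel_iff O ha ha' haj haj', hG.labelRel_iff O (ha.trans hp) (ha'.trans hp) haj haj']

/-- An orientation is total on the vertices of `q`, and distinct labels belong to distinct vertices.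
-/
theorem labelRel_swap [DecidableEq ι] (O : Orientation Q) {q : Q} {j b : ι} (hj : j ∈ G q)
    (hb : b ∈ G q) (hjb : j ≠ b) : labelRel G O q b j ↔ ¬ labelRel G O q j b := by
  obtain ⟨a, ha, haj⟩ := hG.exists_atom hj
  obtain ⟨a', ha', haj'⟩ := hG.exists_atom hb
  rw [hG.labelRel_iff O ha ha' haj haj', hG.labelRel_iff O ha' ha haj' haj]
  have hne : a ≠ a' := by
    rintro rfl
    exact hjb (Finset.singleton_injective (haj.symm.trans haj'))
  constructor
  · intro h h'
    exact @lt_asymm _ O.order.toPreorder _ _ h h'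
  · intro h
    rcases O.total q a a' ha ha' with h1 | h1
    · exact absurd (@lt_of_le_of_ne _ O.order _ _ h1 hne) h
    · exact @lt_of_le_of_ne _ O.order _ _ h1 hne.symm

open Classical in
-- Labels put the vertices of a facet in bijection with its label set, so the exponent counts labels
-- and the sign becomes a product over them.
theorem neg_one_pow_ncard [DecidableEq ι] (k : Type*) [CommRing k] (O : Orientation Q)
    {q : Q} {a : Atoms Q} {j : ι}
    (ha : (a : Q) ≤ q) (haj : G a = {j}) :
    (-1 : k) ^ (Set.ncard {b : Atoms Q | (b : Q) ≤ subface G q ((G q).erase j) ∧ O.order.lt a b}) =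
      ∏ b ∈ (G q).erase j, if labelRel G O q j b then -1 else 1 := by
  choose label hlabel using hG.exists_label
  have hs : (G q).erase j ⊆ G q := Finset.erase_subset _ _
  have hle := hG.subface_le hs
  rw [Finset.prod_ite, Finset.prod_const_one, mul_one, Finset.prod_const]
  congr 1
  rw [← Set.ncard_coe_finset, ← Set.InjOn.ncard_image (f := label)]
  · congr 1
    ext t
    simp only [Set.mem_image, Set.mem_ofPred_eq, Finset.coe_filter]
    constructor
    · rintro ⟨b, ⟨hb, hab⟩, rfl⟩
      have h1 := hG.mono hb
      rw [hG.map_subface hs, hlabel, Finset.singleton_subset_iff] at h1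
      exact ⟨h1, (hG.labelRel_iff O ha (hb.trans hle) haj (hlabel b)).2 hab⟩
    · rintro ⟨ht, h⟩
      obtain ⟨b, hb, hbt⟩ := hG.exists_atom ((hG.map_subface hs).symm ▸ ht)
      refine ⟨b, ⟨hb, (hG.labelRel_iff O ha (hb.trans hle) haj hbt).1 h⟩, ?_⟩
      exact Finset.singleton_injective ((hlabel b).symm.trans hbt)
  · rintro b ⟨hb, -⟩ b' ⟨hb', -⟩ e
    refine Subtype.ext (hG.eq_of_le hb hb' ?_)
    rw [hlabel, hlabel, e]

end Cohomology

/-! ### The coboundary operator in terms of labels -/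

section Twist

variable {Q : Type u} [PartialOrder Q] [Finite Q] {ι : Type*} {G : Q → Finset ι}
variable (k : Type u) [Field k]

open Classical in
theorem _root_.SimplicialPosets.coboundaryFace_apply [Fintype (Atoms Q)]
    (O : Orientation Q) (y q : Q) :
    coboundaryFace k O y q = ∑ a : Atoms Q, if ¬ (a : Q) ≤ y ∧ q ∈ minUpper (a : Q) y then
      (-1 : k) ^ (Set.ncard {b : Atoms Q | (b : Q) ≤ y ∧ O.order.lt a b}) else 0 := by
  have h1 : ∀ a : Atoms Q, (∑ᶠ z ∈ minUpper (a : Q) y, (Pi.single z 1 : Q → k)) q =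
      if q ∈ minUpper (a : Q) y then 1 else 0 := by
    intro a
    rw [finsum_mem_eq_finite_toFinset_sum _ (Set.toFinite _), Finset.sum_apply]
    simp [Pi.single_apply]
  rw [coboundaryFace, finsum_mem_eq_finite_toFinset_sum _ (Set.toFinite _), Finset.sum_apply]
  simp only [Pi.smul_apply, h1, smul_eq_mul, mul_ite, mul_one, mul_zero]
  rw [← Finset.sum_subset
    (Finset.subset_univ (Set.toFinite {a : Atoms Q | ¬ (a : Q) ≤ y}).toFinset)]
  · refine Finset.sum_congr rfl fun a ha => ?_
    have : ¬ (a : Q) ≤ y := by simpa using ha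
    simp [this]
  · intro a _ ha
    have : (a : Q) ≤ y := by simpa using ha
    simp [this]

open Classical in
-- The operator is defined by its effect on basis faces; its transposed form is a sum over the
-- facets of `q`, because the pairs `(y, a)` contributing at `q` correspond to the labels of `q`.
theorem coboundary_apply [DecidableEq ι] (hG : IsLabelling G) (O : Orientation Q) (c : Q → k)
    (q : Q) :
    coboundary k O c q = ∑ j ∈ G q,
      (∏ b ∈ (G q).erase j, if labelRel G O q j b then -1 else 1) *
        c (subface G q ((G q).erase j)) := by
  have : Fintype Q := Fintype.ofFinite Q
  have : Fintype (Atoms Q) := Fintype.ofFinite _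
  have h0 : coboundary k O c q = ∑ y : Q, c y * coboundaryFace k O y q := by
    rw [coboundary, Fintype.linearCombination_apply, Finset.sum_apply]
    exact Finset.sum_congr (by ext; simp) fun y _ => rfl
  rw [h0]
  simp only [coboundaryFace_apply, Finset.mul_sum, mul_ite, mul_zero]
  rw [← Finset.sum_product', ← Finset.sum_filter]
  symm
  choose at_ hle hat using fun (j : ι) (hj : j ∈ G q) => hG.exists_atom hj
  refine Finset.sum_bij (fun j hj => (subface G q ((G q).erase j), at_ j hj)) ?_ ?_ ?_ ?_
  · intro j hj
    simp only [Finset.mem_filter, Finset.mem_product, Finset.mem_univ, true_and]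
    exact (hG.mem_minUpper_iff (hat j hj)).2 ⟨hle j hj, hj, rfl⟩
  · intro j hj j' hj' e
    have h2 := hat j hj
    rw [(Prod.mk.inj e).2, hat j' hj'] at h2
    exact (Finset.singleton_injective h2).symm
  · rintro ⟨y, a⟩ hya
    simp only [Finset.mem_filter, Finset.mem_product, Finset.mem_univ, true_and] at hya
    obtain ⟨j, hj⟩ := hG.exists_label a
    obtain ⟨h1, h2, h3⟩ := (hG.mem_minUpper_iff hj).1 hya
    refine ⟨j, h2, Prod.ext h3.symm (Subtype.ext ?_)⟩
    exact hG.eq_of_le (hle j h2) h1 ((hat j h2).trans hj.symm)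
  · intro j hj
    rw [hG.neg_one_pow_ncard k O (hle j hj) (hat j hj), mul_comm]

end Twist

/-! ### Independence of the orientation -/

section InversionSign

variable {Q : Type u} [PartialOrder Q] {ι : Type*} [LinearOrder ι] {G : Q → Finset ι}

open Classical in
/-- The sign of the permutation relating the order of the labels of `q` to the orientation. -/
def inversionSign (G : Q → Finset ι) (O : Orientation Q) (q : Q) : ℤ :=
  ∏ a ∈ G q, ∏ b ∈ G q, if labelRel G O q a b ∧ b < a then -1 else 1

open Classical in
-- Erasing `j` removes the pairs `{j, b}` from the double product. Such a pair contributes `-1`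
-- exactly when the orientation and the order of the labels disagree on it, which is the product of
-- the two signs on the right.
theorem inversionSign_eq (hG : IsLabelling G) (O : Orientation Q) {q : Q} {j : ι} (hj : j ∈ G q) :
    inversionSign G O q = inversionSign G O (subface G q ((G q).erase j)) *
      ((∏ b ∈ (G q).erase j, if labelRel G O q j b then -1 else 1) *
        koszulSign j ((G q).erase j)) := by
  have hs : (G q).erase j ⊆ G q := Finset.erase_subset _ _
  have h1 : inversionSign G O (subface G q ((G q).erase j)) =
      ∏ a ∈ (G q).erase j, ∏ b ∈ (G q).erase j,
        if labelRel G O q a b ∧ b < a then -1 else 1 := by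
    rw [inversionSign]
    simp only [hG.map_subface hs]
    refine Finset.prod_congr rfl fun a ha => Finset.prod_congr rfl fun b hb => ?_
    rw [hG.labelRel_of_le O (hG.subface_le hs) (by rwa [hG.map_subface hs])
      (by rwa [hG.map_subface hs])]
  have h2 : ∀ f : ι → ι → ℤ, f j j = 1 → ∏ a ∈ G q, ∏ b ∈ G q, f a b =
      (∏ a ∈ (G q).erase j, ∏ b ∈ (G q).erase j, f a b) *
        ∏ b ∈ (G q).erase j, (f j b * f b j) := by
    intro f hf
    simp only [← Finset.mul_prod_erase (G q) _ hj, hf, Finset.prod_mul_distrib]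
    ring
  rw [h1, inversionSign, h2 _ (if_neg fun h => lt_irrefl _ h.2), koszulSign]
  refine congrArg₂ _ rfl (Eq.trans (Finset.prod_congr rfl fun b hb => ?_) Finset.prod_mul_distrib)
  have hjb : j ≠ b := (Finset.ne_of_mem_erase hb).symm
  rw [hG.labelRel_swap O hj (Finset.mem_of_mem_erase hb) hjb]
  rcases lt_or_gt_of_ne hjb with h | h <;> by_cases h' : labelRel G O q j b <;>
    simp [h, h', h.not_gt]

open Classical in
theorem inversionSign_mul_self (O : Orientation Q) (q : Q) :
    inversionSign G O q * inversionSign G O q = 1 := by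
  rw [inversionSign, ← Finset.prod_mul_distrib]
  refine Finset.prod_eq_one fun a _ => ?_
  rw [← Finset.prod_mul_distrib]
  exact Finset.prod_eq_one fun b _ => by split_ifs <;> rfl

/-- Up to a diagonal change of signs, the coboundary operator does not depend on the orientation:
it is given by Koszul signs, possibly shifted by a set `T` of further labels. -/
theorem exists_sign_coboundary (hG : IsLabelling G) [Finite Q] (k : Type u) [Field k]
    (O : Orientation Q) (T : Finset ι) (hT : ∀ q, Disjoint (G q) T) :
    ∃ ε : Q → ℤ, (∀ q, ε q * ε q = 1) ∧ ∀ (c : Q → k) (q : Q),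
      coboundary k O (fun p => (ε p : k) * c p) q = (ε q : k) * ∑ j ∈ G q,
        (koszulSign j ((G q).erase j ∪ T) : k) * c (subface G q ((G q).erase j)) := by
  classical
  -- The first factor exchanges the orientation for the order on the labels; the second absorbs the
  -- sign of moving each label past `T`.
  refine ⟨fun q => inversionSign G O q * ∏ j ∈ G q, koszulSign j T, fun q => ?_, fun c q => ?_⟩
  · rw [mul_mul_mul_comm, inversionSign_mul_self, ← Finset.prod_mul_distrib, one_mul]
    exact Finset.prod_eq_one fun j _ => koszulSign_mul_self j T
  · rw [coboundary_apply k hG, Finset.mul_sum]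
    refine Finset.sum_congr rfl fun j hj => ?_
    rw [← mul_assoc, ← mul_assoc]
    congr 1
    have hs : (G q).erase j ⊆ G q := Finset.erase_subset _ _
    have e1 := hG.inversionSign_eq O hj
    have e2 := koszulSign_union j (S := (G q).erase j) ((hT q).mono_left hs)
    have e3 := Finset.mul_prod_erase (G q) (fun j => koszulSign j T) hj
    have e4 : (∏ b ∈ (G q).erase j, if labelRel G O q j b then (-1 : k) else 1) =
        ((∏ b ∈ (G q).erase j, if labelRel G O q j b then (-1 : ℤ) else 1 : ℤ) : k) := by
      push_cast
      rfl
    have e5 := koszulSign_mul_self j ((G q).erase j)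
    have e6 := koszulSign_mul_self j T
    dsimp only
    rw [e4, hG.map_subface hs, ← Int.cast_mul, ← Int.cast_mul]
    congr 1
    rw [e1, e2, ← e3]
    linear_combination (-(inversionSign G O (subface G q ((G q).erase j)) *
      (∏ b ∈ (G q).erase j, if labelRel G O q j b then (-1 : ℤ) else 1) *
      ∏ b ∈ (G q).erase j, koszulSign b T)) * (e5 * koszulSign j T ^ 2 + e6)

end InversionSign

end IsLabelling

/-! ### The labellings of a simplicial poset and of the products in the formula -/

section Labellings

variable {P : Type u} [PartialOrder P] {n : ℕ}

theorem mem_supp (x : Fin n ≃ Atoms P) (y : P) (i : Fin n) : i ∈ supp x y ↔ (x i : P) ≤ y := by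
  simp [supp]

theorem IsSimplicialPoset.isLabelling_supp [Finite P] [OrderBot P] (hP : IsSimplicialPoset P)
    (x : Fin n ≃ Atoms P) : IsLabelling (supp x) where
  mono := fun p q h i hi => (mem_supp x q i).2 (((mem_supp x p i).1 hi).trans h)
  le_of_subset := by
    intro q p p' hp hp' h
    obtain ⟨w, hw, hws⟩ := (hP.existsUnique_face x p' (supp x p) h).exists
    have hmono : supp x p ⊆ supp x q :=
      fun i hi => (mem_supp x q i).2 (((mem_supp x p i).1 hi).trans hp)
    have := (hP.existsUnique_face x q (supp x p) hmono).unique ⟨hp, rfl⟩ ⟨hw.trans hp', hws⟩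
    exact this ▸ hw
  exists_face := fun q S hS => (hP.existsUnique_face x q S hS).exists

/-- The labels of a face of `[0̂, e] × lk z`. -/
def productLabel (x : Fin n ≃ Atoms P) (z e : P) (W : Finset (Fin n))
    (q : Set.Iic e × ↥(link z ∩ inducedOn x W)) : Finset (Fin n) :=
  supp x q.1.1 ∪ (supp x q.2.1 \ supp x z)

/-- The labels of the first component lie inside `supp z`, those retained from the second lie
outside. Intersecting with `supp z` and with its complement thus separates the two factors, and in
the link `[z, y]` is the lattice of subsets of `supp y ∖ supp z`. -/
theorem isLabelling_productLabel {x : Fin n ≃ Atoms P} (hx : IsLabelling (supp x)) {z e : P}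
    (hez : e ≤ z) (W : Finset (Fin n)) : IsLabelling (productLabel x z e W) where
  mono := fun p q h => Finset.union_subset_union (hx.mono h.1)
    (Finset.sdiff_subset_sdiff (hx.mono h.2) le_rfl)
  le_of_subset := by
    rintro ⟨⟨E, hE⟩, ⟨y, hzy, hy⟩⟩ ⟨⟨E₁, hE₁⟩, ⟨y₁, hzy₁, hy₁⟩⟩ ⟨⟨E₂, hE₂⟩, ⟨y₂, hzy₂, hy₂⟩⟩ h₁ h₂ h
    have sub₁ : supp x E₁ ⊆ supp x z := hx.mono (le_trans hE₁ hez)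
    have sub₂ : supp x E₂ ⊆ supp x z := hx.mono (le_trans hE₂ hez)
    have hz : supp x z ⊆ supp x y₂ := hx.mono hzy₂
    simp only [productLabel] at h
    refine ⟨hx.le_of_subset h₁.1 h₂.1 fun i hi => ?_, hx.le_of_subset h₁.2 h₂.2 fun i hi => ?_⟩
    · have := h (Finset.mem_union_left _ hi)
      simp only [Finset.mem_union, Finset.mem_sdiff, sub₁ hi, not_true, and_false, or_false] at this
      exact this
    · by_cases hiz : i ∈ supp x z
      · exact hz hiz
      · have := h (Finset.mem_union_right _ (Finset.mem_sdiff.2 ⟨hi, hiz⟩))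
        rcases Finset.mem_union.1 this with h' | h'
        · exact absurd (sub₂ h') hiz
        · exact (Finset.mem_sdiff.1 h').1
  exists_face := by
    rintro ⟨⟨E, hE⟩, ⟨y, hzy, hy⟩⟩ S hS
    have sub : supp x E ⊆ supp x z := hx.mono (le_trans hE hez)
    have hz : supp x z ⊆ supp x y := hx.mono hzy
    simp only [productLabel] at hS
    have h1 : S ∩ supp x z ⊆ supp x E := by
      intro i hi
      obtain ⟨hi, hiz⟩ := Finset.mem_inter.1 hi
      rcases Finset.mem_union.1 (hS hi) with h' | h'
      · exact h'
      · exact absurd hiz (Finset.mem_sdiff.1 h').2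
    have h2 : S ∪ supp x z ⊆ supp x y := by
      refine Finset.union_subset (fun i hi => ?_) hz
      rcases Finset.mem_union.1 (hS hi) with h' | h'
      · exact hz (sub h')
      · exact (Finset.mem_sdiff.1 h').1
    have h3 := hx.subface_le h2
    -- The part of `S` inside `supp z` cuts down `E`; the rest, together with all of `supp z`, cuts
    -- down `y` to a face still above `z`.
    refine ⟨⟨⟨subface (supp x) E (S ∩ supp x z), (hx.subface_le h1).trans hE⟩,
      ⟨subface (supp x) y (S ∪ supp x z), ?_, ?_⟩⟩, ⟨hx.subface_le h1, h3⟩, ?_⟩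
    · exact hx.le_of_subset hzy h3 (by rw [hx.map_subface h2]; exact Finset.subset_union_right)
    · exact (hx.mono h3).trans hy
    · simp only [productLabel, hx.map_subface h1, hx.map_subface h2]
      ext i
      simp only [Finset.mem_union, Finset.mem_inter, Finset.mem_sdiff]
      tauto

end Labellings

/-! ### A basis of the face ring -/

namespace IsLabelling

variable {Q : Type u} [PartialOrder Q] {ι : Type*} [DecidableEq ι] {G : Q → Finset ι}
  (hG : IsLabelling G)

include hG

theorem mem_minUpper {w y z : Q} :
    z ∈ minUpper w y ↔ w ≤ z ∧ y ≤ z ∧ G z = G w ∪ G y := by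
  constructor
  · rintro ⟨⟨hw, hy⟩, hmin⟩
    have hs : G w ∪ G y ⊆ G z := Finset.union_subset (hG.mono hw) (hG.mono hy)
    have hle := hG.subface_le hs
    have hmap := hG.map_subface hs
    have h1 : w ≤ subface G z (G w ∪ G y) :=
      hG.le_of_subset hw hle (by rw [hmap]; exact Finset.subset_union_left)
    have h2 : y ≤ subface G z (G w ∪ G y) :=
      hG.le_of_subset hy hle (by rw [hmap]; exact Finset.subset_union_right)
    exact ⟨hw, hy, (hmap ▸ hG.mono (hmin ⟨h1, h2⟩ hle)).antisymm hs⟩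
  · rintro ⟨hw, hy, e⟩
    refine ⟨⟨hw, hy⟩, fun v hv hvz => hG.le_of_subset le_rfl hvz ?_⟩
    rw [e]
    exact Finset.union_subset (hG.mono hv.1) (hG.mono hv.2)

theorem isGLB {w y t g : Q} (hw : w ≤ t) (hy : y ≤ t) (hg : g ≤ t) (e : G g = G w ∩ G y) :
    IsGLB {w, y} g := by
  constructor
  · rintro v (rfl | rfl)
    · exact hG.le_of_subset hg hw (by rw [e]; exact Finset.inter_subset_left)
    · exact hG.le_of_subset hg hy (by rw [e]; exact Finset.inter_subset_right)
  · intro v hv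
    have h1 : v ≤ w := hv (by simp)
    have h2 : v ≤ y := hv (by simp)
    refine hG.le_of_subset (h1.trans hw) hg ?_
    rw [e]
    exact Finset.subset_inter (hG.mono h1) (hG.mono h2)

theorem map_isGLB {w y t g : Q} (hw : w ≤ t) (hy : y ≤ t) (h : IsGLB {w, y} g) :
    G g = G w ∩ G y := by
  have hs : G w ∩ G y ⊆ G t := Finset.inter_subset_left.trans (hG.mono hw)
  have h' := hG.isGLB hw hy (hG.subface_le hs) (hG.map_subface hs)
  rw [h.unique h', hG.map_subface hs]

end IsLabelling

section FaceRingBasis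

variable (k : Type u) [Field k] {P : Type u} [PartialOrder P] [OrderBot P] {n : ℕ}

/-- The class of a face in the face ring. -/
def faceClass (y : P) : FaceRing k P := Ideal.Quotient.mk (faceIdeal k P) (MvPolynomial.X y)

theorem faceClass_bot : faceClass k (⊥ : P) = 1 := by
  rw [faceClass, ← map_one (Ideal.Quotient.mk (faceIdeal k P)), Ideal.Quotient.eq]
  exact Ideal.subset_span (Or.inr rfl)

theorem faceClass_mul_of_empty {w y : P} (h : minUpper w y = ∅) :
    faceClass k w * faceClass k y = 0 := by
  rw [faceClass, faceClass, ← map_mul, Ideal.Quotient.eq_zero_iff_mem]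
  exact Ideal.subset_span (Or.inl (Or.inl ⟨w, y, h, rfl⟩))

theorem faceClass_mul_of_nonempty [Finite P] {w y g : P} (h : (minUpper w y).Nonempty)
    (hg : IsGLB {w, y} g) : faceClass k w * faceClass k y =
      faceClass k g * ∑ z ∈ (Set.toFinite (minUpper w y)).toFinset, faceClass k z := by
  simp only [faceClass]
  rw [← map_mul, ← map_sum, ← map_mul, Ideal.Quotient.eq, ← finsum_mem_eq_finite_toFinset_sum]
  exact Ideal.subset_span (Or.inl (Or.inr ⟨w, y, g, h, hg, rfl⟩))

theorem toFaceRing_X (x : Fin n ≃ Atoms P) (i : Fin n) :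
    toFaceRing k x (MvPolynomial.X i) = faceClass k (x i : P) := by
  simp [toFaceRing, faceClass]

variable {k}

theorem supp_bot [Finite P] (x : Fin n ≃ Atoms P) : supp x (⊥ : P) = ∅ := by
  refine Finset.eq_empty_of_forall_notMem fun i hi => ?_
  exact ((rank_eq_one_iff _).1 (x i).2).1 (le_bot_iff.1 ((mem_supp x _ i).1 hi))

omit [OrderBot P] in
theorem supp_atom {x : Fin n ≃ Atoms P} (hx : IsLabelling (supp x)) (i : Fin n) :
    supp x (x i : P) = {i} := by
  obtain ⟨j, hj⟩ := hx.exists_label (x i)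
  have : i ∈ supp x (x i : P) := (mem_supp x _ i).2 le_rfl
  rw [hj, Finset.mem_singleton] at this
  rw [hj, this]

/-- The exponent vector of the square-free monomial with support `S`. -/
def indicatorExp (S : Finset (Fin n)) : Fin n →₀ ℕ := ∑ i ∈ S, Finsupp.single i 1

theorem indicatorExp_apply (S : Finset (Fin n)) (i : Fin n) :
    indicatorExp S i = if i ∈ S then 1 else 0 := by
  simp [indicatorExp, Finsupp.finsetSum_apply, Finsupp.single_apply]

theorem monomial_indicatorExp (S : Finset (Fin n)) :
    MvPolynomial.monomial (indicatorExp S) (1 : k) = ∏ i ∈ S, MvPolynomial.X i := by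
  rw [indicatorExp, MvPolynomial.monomial_sum_one]
  rfl

variable (k)

/-- The element `y · x^γ` of the face ring. -/
def stdMonomial (x : Fin n ≃ Atoms P) (y : P) (γ : Fin n →₀ ℕ) : FaceRing k P :=
  faceClass k y * toFaceRing k x (MvPolynomial.monomial γ 1)

/-- Vertices of `g` are peeled off one at a time. The product of `x_i` and the opposite facet `g'`
is the sum of all their minimal upper bounds; those other than `g` are killed by `z`, because two
distinct faces with the same support have no common upper bound. -/
theorem faceClass_mul_of_le [Finite P] {x : Fin n ≃ Atoms P} (hx : IsLabelling (supp x)) {g z : P}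
    (hgz : g ≤ z) : faceClass k g * faceClass k z =
      toFaceRing k x (MvPolynomial.monomial (indicatorExp (supp x g)) 1) * faceClass k z := by
  induction hm : (supp x g).card generalizing g with
  | zero =>
    rw [Finset.card_eq_zero] at hm
    have : g = ⊥ := hx.eq_of_le hgz bot_le (by rw [hm, supp_bot])
    rw [hm, this, faceClass_bot]
    simp [indicatorExp]
  | succ m ih =>
    obtain ⟨i, hi⟩ : (supp x g).Nonempty := Finset.card_pos.1 (by omega)
    have hs : (supp x g).erase i ⊆ supp x g := Finset.erase_subset _ _
    set g' := subface (supp x) g ((supp x g).erase i) with hg'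
    have hle : g' ≤ g := hx.subface_le hs
    have hmap : supp x g' = (supp x g).erase i := hx.map_subface hs
    have hig : (x i : P) ≤ g := (mem_supp x g i).1 hi
    have hgM : g ∈ minUpper (x i : P) g' := by
      refine hx.mem_minUpper.2 ⟨hig, hle, ?_⟩
      rw [supp_atom hx, hmap, ← Finset.insert_eq, Finset.insert_erase hi]
    have hbot : IsGLB {(x i : P), g'} ⊥ := by
      refine hx.isGLB hig hle bot_le ?_
      rw [supp_atom hx, hmap, supp_bot]
      simp
    have h1 := faceClass_mul_of_nonempty k ⟨g, hgM⟩ hbot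
    rw [faceClass_bot, one_mul] at h1
    have h2 : faceClass k (x i : P) * faceClass k g' * faceClass k z =
        faceClass k g * faceClass k z := by
      rw [h1, Finset.sum_mul]
      refine Finset.sum_eq_single_of_mem g (by simpa using hgM) fun z' hz' hne => ?_
      refine faceClass_mul_of_empty k (Set.eq_empty_iff_forall_notMem.2 fun v hv => hne ?_)
      rw [Set.Finite.mem_toFinset] at hz'
      refine hx.eq_of_le hv.1.1 (hgz.trans hv.1.2) ?_
      rw [(hx.mem_minUpper.1 hz').2.2, (hx.mem_minUpper.1 hgM).2.2]
    have h3 := ih (hle.trans hgz) (by rw [hmap, Finset.card_erase_of_mem hi, hm]; rfl)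
    rw [← h2, mul_assoc, h3, hmap, monomial_indicatorExp, monomial_indicatorExp,
      ← Finset.mul_prod_erase _ _ hi, map_mul, toFaceRing_X, mul_assoc]

/-- The span contains `1` and is stable under multiplication by every face `w`: the product `w·y` is
`(w ∧ y)·∑ z`, and next to `z ≥ w ∧ y` the factor `w ∧ y` may be replaced by the monomial of its
vertices. -/
theorem span_stdMonomial [Finite P] {x : Fin n ≃ Atoms P} (hx : IsLabelling (supp x)) :
    Submodule.span k {a | ∃ y γ, γ.support ⊆ supp x y ∧ a = stdMonomial k x y γ} = ⊤ := by
  set S := Submodule.span k {a | ∃ y γ, γ.support ⊆ supp x y ∧ a = stdMonomial k x y γ} with hS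
  have hmul : ∀ (w : P) (a : FaceRing k P), a ∈ S → faceClass k w * a ∈ S := by
    intro w a ha
    induction ha using Submodule.span_induction with
    | zero => simp
    | add a b _ _ ha hb => rw [mul_add]; exact S.add_mem ha hb
    | smul r a _ ha => rw [mul_smul_comm]; exact S.smul_mem r ha
    | mem a ha =>
      obtain ⟨y, γ, hγ, rfl⟩ := ha
      rcases (minUpper w y).eq_empty_or_nonempty with h0 | ⟨z₀, hz₀⟩
      · rw [stdMonomial, ← mul_assoc, faceClass_mul_of_empty k h0, zero_mul]
        exact S.zero_mem
      · have hs : supp x w ∩ supp x y ⊆ supp x z₀ :=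
          Finset.inter_subset_left.trans (hx.mono hz₀.1.1)
        set g := subface (supp x) z₀ (supp x w ∩ supp x y)
        have hmap : supp x g = supp x w ∩ supp x y := hx.map_subface hs
        have hg : IsGLB {w, y} g := hx.isGLB hz₀.1.1 hz₀.1.2 (hx.subface_le hs) hmap
        rw [stdMonomial, ← mul_assoc, faceClass_mul_of_nonempty k ⟨z₀, hz₀⟩ hg, Finset.mul_sum,
          Finset.sum_mul]
        refine S.sum_mem fun z hz => ?_
        rw [Set.Finite.mem_toFinset] at hz
        have hgz : g ≤ z := (hg.1 (by simp : w ∈ ({w, y} : Set P))).trans hz.1.1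
        refine Submodule.subset_span ⟨z, indicatorExp (supp x g) + γ, ?_, ?_⟩
        · refine Finsupp.support_add.trans (Finset.union_subset (fun i hi => ?_)
            (hγ.trans (hx.mono hz.1.2)))
          rw [Finsupp.mem_support_iff, indicatorExp_apply, ne_eq, ite_eq_right_iff] at hi
          exact hx.mono hgz (by_contra fun h => hi fun h' => absurd h' h)
        · have e : MvPolynomial.monomial (indicatorExp (supp x g) + γ) (1 : k) =
              MvPolynomial.monomial (indicatorExp (supp x g)) 1 * MvPolynomial.monomial γ 1 := by
            rw [MvPolynomial.monomial_mul, one_mul]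
          rw [faceClass_mul_of_le k hx hgz, stdMonomial, e, map_mul]
          ring
  rw [eq_top_iff]
  rintro a -
  obtain ⟨p, rfl⟩ := Ideal.Quotient.mk_surjective a
  induction p using MvPolynomial.induction_on with
  | C r =>
    have h : (1 : FaceRing k P) ∈ S :=
      Submodule.subset_span ⟨⊥, 0, by simp, by simp [stdMonomial, faceClass_bot]⟩
    have e : Ideal.Quotient.mk (faceIdeal k P) (MvPolynomial.C r) = r • 1 :=
      Algebra.algebraMap_eq_smul_one (A := FaceRing k P) r
    rw [e]
    exact S.smul_mem r h
  | add p q hp hq => rw [map_add]; exact S.add_mem hp hq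
  | mul_X p w hp =>
    rw [map_mul, mul_comm]
    exact hmul w _ hp

/-! ### Restriction to a face, and the coordinates it provides -/

open Classical in
/-- The map of polynomial rings inducing `faceEval`. -/
def polyEval (x : Fin n ≃ Atoms P) (t : P) : MvPolynomial P k →ₐ[k] MvPolynomial (Fin n) k :=
  MvPolynomial.aeval fun w => if w ≤ t then ∏ i ∈ supp x w, MvPolynomial.X i else 0

omit [OrderBot P] in
theorem polyEval_X_of_le (x : Fin n ≃ Atoms P) {t w : P} (h : w ≤ t) :
    polyEval k x t (MvPolynomial.X w) = ∏ i ∈ supp x w, MvPolynomial.X i := by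
  simp [polyEval, h]

omit [OrderBot P] in
theorem polyEval_X_of_not_le (x : Fin n ≃ Atoms P) {t w : P} (h : ¬ w ≤ t) :
    polyEval k x t (MvPolynomial.X w) = 0 := by
  simp [polyEval, h]

/-- If `w, y ≤ t`, exactly one minimal upper bound lies below `t`, namely the join in the Boolean
lattice `[0̂, t]`, and the relation becomes the identity between the products over `supp w`, `supp
y` and those over their union and intersection. Otherwise every term vanishes. -/
theorem polyEval_eq_zero [Finite P] {x : Fin n ≃ Atoms P} (hx : IsLabelling (supp x)) (t : P)
    (p : MvPolynomial P k) (hp : p ∈ faceIdeal k P) : polyEval k x t p = 0 := by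
  suffices h : faceIdeal k P ≤ RingHom.ker (polyEval k x t) from h hp
  rw [faceIdeal, Ideal.span_le]
  have key : ∀ w y, w ≤ t → y ≤ t → subface (supp x) t (supp x w ∪ supp x y) ∈ minUpper w y ∧
      subface (supp x) t (supp x w ∪ supp x y) ≤ t := by
    intro w y hw hy
    have hs : supp x w ∪ supp x y ⊆ supp x t := Finset.union_subset (hx.mono hw) (hx.mono hy)
    have hle := hx.subface_le hs
    have hmap := hx.map_subface hs
    refine ⟨hx.mem_minUpper.2 ⟨hx.le_of_subset hw hle ?_, hx.le_of_subset hy hle ?_, hmap⟩, hle⟩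
    · rw [hmap]; exact Finset.subset_union_left
    · rw [hmap]; exact Finset.subset_union_right
  rintro p ((⟨w, y, h, rfl⟩ | ⟨w, y, g, -, hg, rfl⟩) | rfl)
  · simp only [SetLike.mem_coe, RingHom.mem_ker, map_mul]
    by_cases hw : w ≤ t
    · by_cases hy : y ≤ t
      · exact absurd (key w y hw hy).1 (by simp [h])
      · rw [polyEval_X_of_not_le k x hy, mul_zero]
    · rw [polyEval_X_of_not_le k x hw, zero_mul]
  · rw [finsum_mem_eq_finite_toFinset_sum _ (Set.toFinite _)]
    simp only [SetLike.mem_coe, RingHom.mem_ker, map_mul, map_sub, map_sum, sub_eq_zero]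
    by_cases h : w ≤ t ∧ y ≤ t
    · obtain ⟨hw, hy⟩ := h
      obtain ⟨h1, h2⟩ := key w y hw hy
      have hgw : g ≤ w := hg.1 (by simp)
      rw [Finset.sum_eq_single_of_mem (subface (supp x) t (supp x w ∪ supp x y))
          (by simpa using h1),
        polyEval_X_of_le k x hw, polyEval_X_of_le k x hy, polyEval_X_of_le k x (hgw.trans hw),
        polyEval_X_of_le k x h2, (hx.mem_minUpper.1 h1).2.2, hx.map_isGLB hw hy hg, mul_comm,
        mul_comm (∏ i ∈ _ ∩ _, _), Finset.prod_union_inter, mul_comm]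
      intro z hz hne
      rw [Set.Finite.mem_toFinset] at hz
      refine polyEval_X_of_not_le k x fun hzt => hne (hx.eq_of_le hzt h2 ?_)
      rw [(hx.mem_minUpper.1 h1).2.2, (hx.mem_minUpper.1 hz).2.2]
    · rw [Finset.sum_eq_zero, mul_zero]
      · by_cases hw : w ≤ t
        · rw [polyEval_X_of_not_le k x fun hy => h ⟨hw, hy⟩, mul_zero]
        · rw [polyEval_X_of_not_le k x hw, zero_mul]
      · intro z hz
        rw [Set.Finite.mem_toFinset] at hz
        exact polyEval_X_of_not_le k x fun hzt => h ⟨hz.1.1.trans hzt, hz.1.2.trans hzt⟩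
  · simp only [SetLike.mem_coe, RingHom.mem_ker, map_sub, map_one]
    rw [polyEval_X_of_le k x bot_le, supp_bot, Finset.prod_empty, sub_self]

variable {k}
variable [Finite P] {x : Fin n ≃ Atoms P} (hx : IsLabelling (supp x))

/-- The restriction of the face ring to the face `t`. -/
def faceEval (t : P) : FaceRing k P →ₐ[k] MvPolynomial (Fin n) k :=
  Ideal.Quotient.liftₐ (faceIdeal k P) (polyEval k x t) (polyEval_eq_zero k hx t)

theorem faceEval_mk (t : P) (p : MvPolynomial P k) :
    faceEval hx t (Ideal.Quotient.mk (faceIdeal k P) p) = polyEval k x t p := rfl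

theorem faceEval_toFaceRing_X {t : P} {i : Fin n} (h : i ∈ supp x t) :
    faceEval hx t (toFaceRing k x (MvPolynomial.X i)) = MvPolynomial.X i := by
  rw [toFaceRing_X, faceClass, faceEval_mk, polyEval_X_of_le k x ((mem_supp x t i).1 h),
    supp_atom hx, Finset.prod_singleton]

theorem faceEval_stdMonomial_of_le {y t : P} (hyt : y ≤ t) {γ : Fin n →₀ ℕ}
    (hγ : γ.support ⊆ supp x y) : faceEval hx t (stdMonomial k x y γ) =
      MvPolynomial.monomial (indicatorExp (supp x y) + γ) 1 := by
  have h1 : faceEval hx t (toFaceRing k x (MvPolynomial.monomial γ 1)) =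
      MvPolynomial.monomial γ 1 := by
    rw [MvPolynomial.monomial_eq, Finsupp.prod]
    simp only [map_mul, map_prod, map_pow, map_one]
    congr 1
    refine Finset.prod_congr rfl fun i hi => ?_
    rw [faceEval_toFaceRing_X hx (hx.mono hyt (hγ hi))]
  rw [stdMonomial, map_mul, h1, faceClass, faceEval_mk, polyEval_X_of_le k x hyt,
    ← monomial_indicatorExp, MvPolynomial.monomial_mul, one_mul]

theorem faceEval_stdMonomial_of_not_le {y t : P} (hyt : ¬ y ≤ t) (γ : Fin n →₀ ℕ) :
    faceEval hx t (stdMonomial k x y γ) = 0 := by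
  rw [stdMonomial, map_mul, faceClass, faceEval_mk, polyEval_X_of_not_le k x hyt, zero_mul]

theorem support_indicatorExp_add {S : Finset (Fin n)} {γ : Fin n →₀ ℕ} (h : γ.support ⊆ S) :
    (indicatorExp S + γ).support = S := by
  ext i
  rw [Finsupp.mem_support_iff, Finsupp.add_apply, indicatorExp_apply]
  by_cases hi : i ∈ S
  · simp [hi]
  · have : i ∉ γ.support := fun h' => hi (h h')
    simpa [hi] using this

theorem coeff_faceEval_of_not_subset {t : P} {b : Fin n →₀ ℕ} (hb : ¬ b.support ⊆ supp x t)
    (a : FaceRing k P) : (faceEval hx t a).coeff b = 0 := by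
  have ha : a ∈ (⊤ : Submodule k (FaceRing k P)) := trivial
  rw [← span_stdMonomial k hx] at ha
  induction ha using Submodule.span_induction with
  | zero => simp
  | add a c _ _ ha hc => simp [ha, hc]
  | smul r a _ ha => simp [ha]
  | mem a ha =>
    obtain ⟨y, γ, hγ, rfl⟩ := ha
    by_cases hyt : y ≤ t
    · rw [faceEval_stdMonomial_of_le hx hyt hγ, MvPolynomial.coeff_monomial, if_neg]
      rintro rfl
      rw [support_indicatorExp_add hγ] at hb
      exact hb (hx.mono hyt)
    · rw [faceEval_stdMonomial_of_not_le hx hyt, MvPolynomial.coeff_zero]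

/-- Only standard monomials `y·x^γ` with `supp y = supp b` contribute to the coefficient of `x^b`,
and below `t` there is only one such `y`. -/
theorem coeff_faceEval_subface {t : P} {b : Fin n →₀ ℕ} (hb : b.support ⊆ supp x t)
    (a : FaceRing k P) :
    (faceEval hx (subface (supp x) t b.support) a).coeff b = (faceEval hx t a).coeff b := by
  have ha : a ∈ (⊤ : Submodule k (FaceRing k P)) := trivial
  rw [← span_stdMonomial k hx] at ha
  have hle := hx.subface_le hb
  induction ha using Submodule.span_induction with
  | zero => simp
  | add a c _ _ ha hc => simp [ha, hc]
  | smul r a _ ha => simp [ha]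
  | mem a ha =>
    obtain ⟨y, γ, hγ, rfl⟩ := ha
    by_cases hys : y ≤ subface (supp x) t b.support
    · rw [faceEval_stdMonomial_of_le hx hys hγ, faceEval_stdMonomial_of_le hx (hys.trans hle) hγ]
    · rw [faceEval_stdMonomial_of_not_le hx hys]
      by_cases hyt : y ≤ t
      · rw [faceEval_stdMonomial_of_le hx hyt hγ, MvPolynomial.coeff_monomial, if_neg,
          MvPolynomial.coeff_zero]
        rintro rfl
        refine hys (hx.le_of_subset hyt hle ?_)
        rw [hx.map_subface hb, support_indicatorExp_add hγ]
      · rw [faceEval_stdMonomial_of_not_le hx hyt]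

/-- The coefficients of the monomials `x^b` in the restrictions to the faces with the same support
are the coordinates with respect to the basis of standard monomials. -/
theorem exists_eq_sum_stdMonomial (a : FaceRing k P) :
    ∃ s : Finset (P × (Fin n →₀ ℕ)), (∀ i ∈ s, i.2.support ⊆ supp x i.1) ∧
      a = ∑ i ∈ s, (faceEval hx i.1 a).coeff (indicatorExp (supp x i.1) + i.2) •
        stdMonomial k x i.1 i.2 := by
  classical
  have ha : a ∈ (⊤ : Submodule k (FaceRing k P)) := trivial
  have hset : {a | ∃ y γ, γ.support ⊆ supp x y ∧ a = stdMonomial k x y γ} =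
      (fun i : P × (Fin n →₀ ℕ) => stdMonomial k x i.1 i.2) ''
        {i | i.2.support ⊆ supp x i.1} := by
    ext a
    constructor
    · rintro ⟨y, γ, h, rfl⟩
      exact ⟨(y, γ), h, rfl⟩
    · rintro ⟨i, h, rfl⟩
      exact ⟨i.1, i.2, h, rfl⟩
  rw [← span_stdMonomial k hx, hset, Finsupp.mem_span_image_iff_linearCombination] at ha
  obtain ⟨l, hl, rfl⟩ := ha
  rw [Finsupp.mem_supported] at hl
  refine ⟨l.support, fun i hi => hl hi, ?_⟩
  rw [Finsupp.linearCombination_apply, Finsupp.sum]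
  refine Finset.sum_congr rfl fun i hi => ?_
  congr 1
  -- The evaluation is diagonal: another standard monomial with the same exponent would belong to a
  -- different face with the same support, hence not below `i.1`.
  rw [map_sum, MvPolynomial.coeff_sum, Finset.sum_eq_single_of_mem i hi]
  · rw [map_smul, faceEval_stdMonomial_of_le hx le_rfl (hl hi), MvPolynomial.coeff_smul,
      MvPolynomial.coeff_monomial, if_pos rfl, smul_eq_mul, mul_one]
  · intro j hj hne
    rw [map_smul, MvPolynomial.coeff_smul]
    by_cases hle : j.1 ≤ i.1
    · rw [faceEval_stdMonomial_of_le hx hle (hl hj), MvPolynomial.coeff_monomial, if_neg, smul_zero]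
      intro e
      have h1 := congrArg Finsupp.support e
      rw [support_indicatorExp_add (hl hj), support_indicatorExp_add (hl hi)] at h1
      have h2 : j.1 = i.1 := hx.eq_of_le hle le_rfl h1
      rw [h1] at e
      exact hne (Prod.ext h2 (add_left_cancel e))
    · rw [faceEval_stdMonomial_of_not_le hx hle, MvPolynomial.coeff_zero, smul_zero]

end FaceRingBasis

/-! ### Criteria for gradings -/

section Gradings

/-- Each `f j` sees only the component of degree `deg j`, so a vanishing sum of components has all
its components annihilated by every functional. -/
theorem isInternal_of_functionals {M R ι J : Type*} [DecidableEq ι] [AddCommGroup M]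
    [AddCommGroup R] (𝓜 : ι → AddSubgroup M) (f : J → M →+ R) (deg : J → ι)
    (hmem : ∀ β m, m ∈ 𝓜 β ↔ ∀ j, deg j ≠ β → f j m = 0)
    (hsep : ∀ m, (∀ j, f j m = 0) → m = 0) (hspan : ∀ m, m ∈ ⨆ β, 𝓜 β) :
    DirectSum.IsInternal 𝓜 := by
  classical
  constructor
  · rw [injective_iff_map_eq_zero]
    intro v hv
    have key : ∀ (w : DirectSum ι fun β => 𝓜 β) (j : J),
        f j (DirectSum.coeAddMonoidHom 𝓜 w) = f j (w (deg j)) := by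
      intro w j
      induction w using DirectSum.induction_on with
      | zero => simp
      | add a b ha hb => rw [map_add, map_add, ha, hb, DirectSum.add_apply, AddSubgroup.coe_add,
          map_add]
      | of β m =>
        rw [DirectSum.coeAddMonoidHom_of]
        by_cases h : deg j = β
        · subst h
          rw [DirectSum.of_eq_same]
        · rw [(hmem β m).1 m.2 j h, DirectSum.of_eq_of_ne _ _ _ h]
          simp
    ext β
    refine hsep _ fun j => ?_
    by_cases h : deg j = β
    · subst h
      rw [← key, hv, map_zero]
    · exact (hmem β _).1 (v β).2 j h
  · intro m
    have := hspan m
    induction this using AddSubgroup.iSup_induction' with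
    | hp β m hm => exact ⟨DirectSum.of (fun β => 𝓜 β) β ⟨m, hm⟩, by simp⟩
    | h1 => exact ⟨0, map_zero _⟩
    | hadd a b _ _ ha hb =>
      obtain ⟨v, rfl⟩ := ha
      obtain ⟨w, rfl⟩ := hb
      exact ⟨v + w, map_add _ _ _⟩

/-- The homogeneous components with respect to an internal grading. -/
theorem exists_components {M ι : Type*} [DecidableEq ι] [AddCommGroup M]
    {𝓜 : ι → AddSubgroup M} (h : DirectSum.IsInternal 𝓜) :
    ∃ c : ι → M →+ M, (∀ β m, c β m ∈ 𝓜 β) ∧ (∀ β m, m ∈ 𝓜 β → c β m = m) ∧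
      (∀ β γ m, β ≠ γ → m ∈ 𝓜 γ → c β m = 0) ∧ (∀ m, m ∈ ⨆ β, 𝓜 β) := by
  classical
  let e : (DirectSum ι fun β => 𝓜 β) ≃+ M := AddEquiv.ofBijective _ h
  have he : ∀ β (m : 𝓜 β), e.symm (m : M) = DirectSum.of (fun β => 𝓜 β) β m := by
    intro β m
    rw [AddEquiv.symm_apply_eq]
    exact (DirectSum.coeAddMonoidHom_of 𝓜 β m).symm
  refine ⟨fun β => (𝓜 β).subtype.comp ((DFinsupp.evalAddMonoidHom β).comp e.symm.toAddMonoidHom),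
    fun β m => (e.symm m β).2, fun β m hm => ?_, fun β γ m hne hm => ?_, fun m => ?_⟩
  · change ((e.symm m) β : M) = m
    rw [he β ⟨m, hm⟩, DirectSum.of_eq_same]
  · change ((e.symm m) β : M) = 0
    rw [he γ ⟨m, hm⟩, DirectSum.of_eq_of_ne _ _ _ hne]
    rfl
  · obtain ⟨v, rfl⟩ := h.2 m
    induction v using DirectSum.induction_on with
    | zero => simp
    | add a b ha hb => rw [map_add]; exact add_mem ha hb
    | of β m =>
      rw [DirectSum.coeAddMonoidHom_of]
      exact AddSubgroup.mem_iSup_of_mem β m.2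

open MvPolynomial in
theorem IsWeightedHomogeneous.aeval {σ τ R M : Type*} [CommRing R] [AddCommMonoid M] {w : σ → M}
    {w' : τ → M} {f : σ → MvPolynomial τ R} (hf : ∀ i, IsWeightedHomogeneous w' (f i) (w i))
    {p : MvPolynomial σ R} {m : M} (hp : IsWeightedHomogeneous w p m) :
    IsWeightedHomogeneous w' (MvPolynomial.aeval f p) m := by
  rw [p.as_sum, map_sum]
  refine IsWeightedHomogeneous.sum _ _ _ fun d hd => ?_
  rw [aeval_monomial, ← hp (mem_support_iff.1 hd), algebraMap_eq]
  refine IsWeightedHomogeneous.C_mul ?_ _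
  rw [Finsupp.weight_apply]
  exact IsWeightedHomogeneous.prod _ _ _ fun i _ => (hf i).pow _

end Gradings

/-! ### Exponent vectors and degrees -/

section Degrees

variable {n : ℕ}

/-- An exponent vector as a degree. -/
def degOf (b : Fin n →₀ ℕ) : Fin n → ℤ := fun i => (b i : ℤ)

theorem degOf_add (b c : Fin n →₀ ℕ) : degOf (b + c) = degOf b + degOf c := by
  ext i; simp [degOf]

theorem degOf_injective : Function.Injective (degOf (n := n)) := by
  intro b c h
  ext i
  have := congrFun h i
  simpa [degOf] using this

theorem weight_single (b : Fin n →₀ ℕ) :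
    Finsupp.weight (fun i : Fin n => (Pi.single i 1 : Fin n → ℤ)) b = degOf b := by
  ext j
  rw [Finsupp.weight_apply, Finsupp.sum_fintype _ _ (by simp), Finset.sum_apply]
  simp [Pi.single_apply, degOf]

/-- The exponent vector with the given degree. -/
def expOf (β : Fin n → ℤ) : Fin n →₀ ℕ := Finsupp.equivFunOnFinite.symm fun i => (β i).toNat

theorem degOf_expOf {β : Fin n → ℤ} (hβ : ∀ i, 0 ≤ β i) : degOf (expOf β) = β := by
  ext i; simp [degOf, expOf, hβ i]

theorem expOf_degOf (b : Fin n →₀ ℕ) : expOf (degOf b) = b := by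
  ext i; simp [degOf, expOf]

/-- The support of a degree. -/
def degSupport (β : Fin n → ℤ) : Finset (Fin n) := Finset.univ.filter fun i => β i ≠ 0

theorem mem_degSupport {β : Fin n → ℤ} {i : Fin n} : i ∈ degSupport β ↔ β i ≠ 0 := by
  simp [degSupport]

theorem support_expOf {β : Fin n → ℤ} (hβ : ∀ i, 0 ≤ β i) :
    (expOf β).support = degSupport β := by
  ext i
  have := hβ i
  simp [mem_degSupport, expOf]
  omega

theorem mem_polyDegree_iff (k : Type u) [Field k] {β : Fin n → ℤ} {p : MvPolynomial (Fin n) k} :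
    p ∈ polyDegree k β ↔ ∀ b, p.coeff b ≠ 0 → degOf b = β := by
  simp only [← weight_single]
  rfl

theorem monomial_mem_polyDegree (k : Type u) [Field k] (b : Fin n →₀ ℕ) (r : k) :
    MvPolynomial.monomial b r ∈ polyDegree k (degOf b) :=
  MvPolynomial.isWeightedHomogeneous_monomial _ _ _ (weight_single b)

end Degrees

/-! ### The grading of the face ring -/

section FaceGrading

variable (k : Type u) [Field k] {P : Type u} [PartialOrder P] [OrderBot P] {n : ℕ}

instance (x : Fin n ≃ Atoms P) : Module k (FaceModule k x) :=
  Module.restrictScalars k (MvPolynomial (Fin n) k) (FaceModule k x)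

instance (x : Fin n ≃ Atoms P) : IsScalarTower k (MvPolynomial (Fin n) k) (FaceModule k x) :=
  IsScalarTower.restrictScalars k (MvPolynomial (Fin n) k) (FaceModule k x)

/-- The identity map from the module `A_P` to the ring `A_P`. -/
def faceModuleEquiv (x : Fin n ≃ Atoms P) : FaceModule k x ≃+ FaceRing k P :=
  AddEquiv.refl (FaceRing k P)

theorem faceModuleEquiv_smul (x : Fin n ≃ Atoms P) (p : MvPolynomial (Fin n) k)
    (a : FaceModule k x) :
    faceModuleEquiv k x (p • a) = toFaceRing k x p * faceModuleEquiv k x a := rfl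

theorem toFaceRing_C (x : Fin n ≃ Atoms P) (r : k) :
    toFaceRing k x (MvPolynomial.C r) = algebraMap k (FaceRing k P) r := by
  change Ideal.Quotient.mk _ (MvPolynomial.rename _ (MvPolynomial.C r)) = _
  rw [MvPolynomial.rename_C]
  rfl

theorem faceModuleEquiv_scalar_smul (x : Fin n ≃ Atoms P) (r : k) (a : FaceModule k x) :
    faceModuleEquiv k x (r • a) = algebraMap k (FaceRing k P) r * faceModuleEquiv k x a := by
  rw [← algebraMap_smul (MvPolynomial (Fin n) k) r a, faceModuleEquiv_smul,
    MvPolynomial.algebraMap_eq, toFaceRing_C]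

variable {k} [Finite P] {x : Fin n ≃ Atoms P} (hx : IsLabelling (supp x))

open Classical in
/-- The coefficient of the monomial of degree `β` in the restriction to the face `t`. -/
def coord (t : P) (β : Fin n → ℤ) : FaceModule k x →ₗ[k] k where
  toFun a := if ∀ i, 0 ≤ β i then (faceEval hx t (faceModuleEquiv k x a)).coeff (expOf β) else 0
  map_add' a b := by
    split_ifs
    · rw [map_add, map_add, MvPolynomial.coeff_add]
    · simp
  map_smul' r a := by
    split_ifs
    · rw [faceModuleEquiv_scalar_smul, map_mul, AlgHom.commutes, MvPolynomial.algebraMap_eq,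
        MvPolynomial.coeff_C_mul, RingHom.id_apply, smul_eq_mul]
    · simp

theorem coord_of_nonneg (t : P) {β : Fin n → ℤ} (hβ : ∀ i, 0 ≤ β i) (a : FaceModule k x) :
    coord hx t β a = (faceEval hx t (faceModuleEquiv k x a)).coeff (expOf β) := if_pos hβ

theorem coord_of_not_nonneg (t : P) {β : Fin n → ℤ} (hβ : ¬ ∀ i, 0 ≤ β i) (a : FaceModule k x) :
    coord hx t β a = 0 := if_neg hβ

theorem coord_degOf (t : P) (b : Fin n →₀ ℕ) (a : FaceModule k x) :
    coord hx t (degOf b) a = (faceEval hx t (faceModuleEquiv k x a)).coeff b := by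
  have h : ∀ i, 0 ≤ degOf b i := fun i => Int.natCast_nonneg _
  rw [coord_of_nonneg hx t h, expOf_degOf]

theorem coord_of_not_subset {t : P} {β : Fin n → ℤ} (h : ¬ degSupport β ⊆ supp x t)
    (a : FaceModule k x) : coord hx t β a = 0 := by
  by_cases hβ : ∀ i, 0 ≤ β i
  · rw [coord_of_nonneg hx t hβ]
    exact coeff_faceEval_of_not_subset hx (by rwa [support_expOf hβ]) _
  · exact coord_of_not_nonneg hx t hβ a

theorem coord_subface {t : P} {β : Fin n → ℤ} (h : degSupport β ⊆ supp x t)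
    (a : FaceModule k x) : coord hx (subface (supp x) t (degSupport β)) β a = coord hx t β a := by
  by_cases hβ : ∀ i, 0 ≤ β i
  · rw [coord_of_nonneg hx t hβ, coord_of_nonneg hx _ hβ]
    rw [← support_expOf hβ] at h ⊢
    exact coeff_faceEval_subface hx h _
  · rw [coord_of_not_nonneg hx t hβ, coord_of_not_nonneg hx _ hβ]

omit [OrderBot P] [Finite P] in
theorem isWeightedHomogeneous_polyEval (t : P) {p : MvPolynomial P k} {β : Fin n → ℤ}
    (hp : p.IsWeightedHomogeneous (faceDegree x) β) :
    (polyEval k x t p).IsWeightedHomogeneous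
      (fun i : Fin n => (Pi.single i 1 : Fin n → ℤ)) β := by
  refine IsWeightedHomogeneous.aeval (fun w => ?_) hp
  split_ifs
  · have : faceDegree x w = ∑ i ∈ supp x w, (Pi.single i 1 : Fin n → ℤ) := by
      ext j
      simp [faceDegree, Finset.sum_apply, Pi.single_apply]
    rw [this]
    exact MvPolynomial.IsWeightedHomogeneous.prod _ _ _ fun i _ =>
      MvPolynomial.isWeightedHomogeneous_X k _ i
  · exact MvPolynomial.isWeightedHomogeneous_zero _ _ _

omit [OrderBot P] [Finite P] in
include hx in
theorem faceDegree_atom (i : Fin n) : faceDegree x (x i : P) = Pi.single i 1 := by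
  ext j
  simp [faceDegree, supp_atom hx, Pi.single_apply]

omit [OrderBot P] [Finite P] in
include hx in
theorem isWeightedHomogeneous_rename {p : MvPolynomial (Fin n) k} {β : Fin n → ℤ}
    (hp : p ∈ polyDegree k β) :
    (MvPolynomial.rename (fun i => (x i : P)) p).IsWeightedHomogeneous (faceDegree x) β := by
  have e : MvPolynomial.rename (R := k) (fun i => (x i : P)) =
      MvPolynomial.aeval fun i => MvPolynomial.X (x i : P) :=
    MvPolynomial.algHom_ext fun i => by simp
  rw [e]
  refine IsWeightedHomogeneous.aeval (fun i => ?_) hp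
  rw [← faceDegree_atom hx]
  exact MvPolynomial.isWeightedHomogeneous_X k _ _

omit [Finite P] in
include hx in
theorem smul_mem_faceModuleDegree {β γ : Fin n → ℤ} {p : MvPolynomial (Fin n) k}
    {a : FaceModule k x} (hp : p ∈ polyDegree k β) (ha : a ∈ faceModuleDegree k x γ) :
    p • a ∈ faceModuleDegree k x (β + γ) := by
  obtain ⟨q, hq, rfl⟩ := ha
  exact ⟨_, (isWeightedHomogeneous_rename hx hp).mul hq,
    map_mul (Ideal.Quotient.mk (faceIdeal k P)) _ _⟩

omit [Finite P] in
include hx in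
theorem stdMonomial_mem (y : P) (γ : Fin n →₀ ℕ) :
    (faceModuleEquiv k x).symm (stdMonomial k x y γ) ∈
      faceModuleDegree k x (degOf (indicatorExp (supp x y) + γ)) := by
  have h : faceDegree x y = degOf (indicatorExp (supp x y)) := by
    ext i
    simp [faceDegree, degOf, indicatorExp_apply]
  have h2 := smul_mem_faceModuleDegree hx (monomial_mem_polyDegree k γ 1)
    (⟨MvPolynomial.X y, MvPolynomial.isWeightedHomogeneous_X k _ y, rfl⟩ :
      (faceModuleEquiv k x).symm (faceClass k y) ∈ faceModuleDegree k x (faceDegree x y))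
  rw [h, add_comm, ← degOf_add] at h2
  have h3 : (faceModuleEquiv k x).symm (stdMonomial k x y γ) = MvPolynomial.monomial γ (1 : k) •
      (faceModuleEquiv k x).symm (faceClass k y) := by
    apply (faceModuleEquiv k x).injective
    rw [faceModuleEquiv_smul, AddEquiv.apply_symm_apply, AddEquiv.apply_symm_apply, stdMonomial,
      mul_comm]
  rwa [h3]

omit [Finite P] in
include hx in
theorem scalar_smul_mem_faceModuleDegree {β : Fin n → ℤ} (r : k) {a : FaceModule k x}
    (ha : a ∈ faceModuleDegree k x β) : r • a ∈ faceModuleDegree k x β := by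
  have := smul_mem_faceModuleDegree hx (monomial_mem_polyDegree k 0 r) ha
  have h0 : degOf (0 : Fin n →₀ ℕ) = 0 := by ext; simp [degOf]
  rw [h0, zero_add] at this
  rwa [← algebraMap_smul (MvPolynomial (Fin n) k) r a]

/-- The expansion of an element of the face ring in standard monomials. -/
theorem exists_eq_sum_coord (a : FaceModule k x) :
    ∃ s : Finset (P × (Fin n →₀ ℕ)), a = ∑ i ∈ s,
      coord hx i.1 (degOf (indicatorExp (supp x i.1) + i.2)) a •
        (faceModuleEquiv k x).symm (stdMonomial k x i.1 i.2) := by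
  obtain ⟨s, -, hs⟩ := exists_eq_sum_stdMonomial hx (faceModuleEquiv k x a)
  refine ⟨s, (faceModuleEquiv k x).injective ?_⟩
  rw [map_sum]
  refine hs.trans (Finset.sum_congr rfl fun i _ => ?_)
  rw [faceModuleEquiv_scalar_smul, coord_degOf, AddEquiv.apply_symm_apply]
  exact Algebra.smul_def (A := FaceRing k P) _ _

theorem coord_ext {a b : FaceModule k x} (h : ∀ t β, coord hx t β a = coord hx t β b) : a = b := by
  rw [← sub_eq_zero]
  obtain ⟨s, hs⟩ := exists_eq_sum_coord hx (a - b)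
  rw [hs]
  refine Finset.sum_eq_zero fun i _ => ?_
  rw [map_sub, h, sub_self, zero_smul]

/-- Restriction to a face preserves degrees, which gives one direction; for the other, the
coefficients in the standard expansion are themselves coordinates. -/
theorem mem_faceModuleDegree_iff {β : Fin n → ℤ} {a : FaceModule k x} :
    a ∈ faceModuleDegree k x β ↔ ∀ t γ, γ ≠ β → coord hx t γ a = 0 := by
  constructor
  · rintro ⟨p, hp, rfl⟩ t γ hne
    by_contra hc
    by_cases hγ : ∀ i, 0 ≤ γ i
    · rw [coord_of_nonneg hx t hγ] at hc
      have := isWeightedHomogeneous_polyEval t hp hc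
      rw [weight_single, degOf_expOf hγ] at this
      exact hne this
    · exact hc (coord_of_not_nonneg hx t hγ _)
  · intro h
    obtain ⟨s, hs⟩ := exists_eq_sum_coord hx a
    rw [hs]
    refine AddSubgroup.sum_mem _ fun i _ => ?_
    by_cases hi : degOf (indicatorExp (supp x i.1) + i.2) = β
    · exact scalar_smul_mem_faceModuleDegree hx _ (hi ▸ stdMonomial_mem hx i.1 i.2)
    · rw [h _ _ hi, zero_smul]
      exact zero_mem _

include hx in
theorem isGradedModule_faceModuleDegree : IsGradedModule k (faceModuleDegree k x) where
  isInternal := by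
    refine isInternal_of_functionals (J := P × (Fin n → ℤ)) _
      (fun j => (coord hx j.1 j.2).toAddMonoidHom) (fun j => j.2) (fun β m => ?_) (fun m h => ?_)
      fun m => ?_
    · rw [mem_faceModuleDegree_iff hx]
      exact ⟨fun h j => h j.1 j.2, fun h t γ => h (t, γ)⟩
    · refine coord_ext hx fun t β => ?_
      rw [map_zero]
      exact h (t, β)
    · obtain ⟨s, hs⟩ := exists_eq_sum_coord hx m
      rw [hs]
      exact AddSubgroup.sum_mem _ fun i _ => AddSubgroup.mem_iSup_of_mem _
        (scalar_smul_mem_faceModuleDegree hx _ (stdMonomial_mem hx i.1 i.2))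
  smul_mem _ _ _ _ := smul_mem_faceModuleDegree hx

/-- Homogeneous elements with prescribed coordinates. -/
theorem exists_mem_faceModuleDegree {β : Fin n → ℤ} (hβ : ∀ i, 0 ≤ β i) (c : P → k) :
    ∃ a ∈ faceModuleDegree k x β, ∀ t, supp x t = degSupport β → coord hx t β a = c t := by
  classical
  have : Fintype P := Fintype.ofFinite P
  -- Since `β ≥ 1` on its support, `x^β` is divisible by the square-free monomial of `y`; the
  -- quotient is the exponent of the standard monomial.
  have key : ∀ y : P, supp x y = degSupport β → ∃ γ : Fin n →₀ ℕ, γ.support ⊆ supp x y ∧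
      indicatorExp (supp x y) + γ = expOf β := by
    intro y hy
    refine ⟨expOf β - indicatorExp (supp x y), ?_, ?_⟩
    · refine Finsupp.support_tsub.trans ?_
      rw [support_expOf hβ, hy]
    · refine add_tsub_cancel_of_le fun i => ?_
      rw [indicatorExp_apply]
      split_ifs with h
      · rw [hy, ← support_expOf hβ, Finsupp.mem_support_iff] at h
        omega
      · exact Nat.zero_le _
  choose! γ hγ hadd using key
  refine ⟨∑ y ∈ Finset.univ.filter (fun y => supp x y = degSupport β),
    c y • (faceModuleEquiv k x).symm (stdMonomial k x y (γ y)), ?_, fun t ht => ?_⟩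
  · refine AddSubgroup.sum_mem _ fun y hy => scalar_smul_mem_faceModuleDegree hx _ ?_
    have hy' := (Finset.mem_filter.1 hy).2
    have := stdMonomial_mem (k := k) hx y (γ y)
    rwa [hadd y hy', degOf_expOf hβ] at this
  · rw [map_sum, Finset.sum_eq_single_of_mem t (by simpa using ht)]
    · rw [map_smul, coord_of_nonneg hx t hβ, AddEquiv.apply_symm_apply,
        faceEval_stdMonomial_of_le hx le_rfl (hγ t ht),
        hadd t ht, MvPolynomial.coeff_monomial, if_pos rfl, smul_eq_mul, mul_one]
    · intro y hy hne
      have hy' := (Finset.mem_filter.1 hy).2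
      rw [map_smul, coord_of_nonneg hx t hβ, AddEquiv.apply_symm_apply,
        faceEval_stdMonomial_of_not_le hx,
        MvPolynomial.coeff_zero, smul_zero]
      exact fun hle => hne (hx.eq_of_le hle le_rfl (hy'.trans ht.symm))

/-- A coordinate at any `t` either vanishes or equals the one at the face of `t` whose support is
that of `β`, so faces with exactly this support suffice. -/
theorem eq_zero_of_coord {β : Fin n → ℤ} {a : FaceModule k x} (ha : a ∈ faceModuleDegree k x β)
    (h : (∀ i, 0 ≤ β i) → ∀ t, supp x t = degSupport β → coord hx t β a = 0) : a = 0 := by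
  refine coord_ext hx fun t γ => ?_
  rw [map_zero]
  by_cases hγ : γ = β
  · subst hγ
    by_cases hpos : ∀ i, 0 ≤ γ i
    · by_cases hs : degSupport γ ⊆ supp x t
      · rw [← coord_subface hx hs]
        exact h hpos _ (hx.map_subface hs)
      · exact coord_of_not_subset hx hs a
    · exact coord_of_not_nonneg hx t hpos a
  · exact (mem_faceModuleDegree_iff hx).1 ha t γ hγ

/-- Multiplication by a power of a variable shifts the coordinates. -/
theorem coord_X_pow_smul {t : P} {j : Fin n} (hj : j ∈ supp x t) (ℓ : ℕ) (β : Fin n → ℤ)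
    (a : FaceModule k x) :
    coord hx t (β + Pi.single j (ℓ : ℤ)) ((MvPolynomial.X j ^ ℓ : MvPolynomial (Fin n) k) • a) =
      coord hx t β a := by
  have h1 : faceEval hx t (faceModuleEquiv k x
      ((MvPolynomial.X j ^ ℓ : MvPolynomial (Fin n) k) • a)) =
      MvPolynomial.monomial (Finsupp.single j ℓ) 1 * faceEval hx t (faceModuleEquiv k x a) := by
    rw [faceModuleEquiv_smul, map_mul, map_pow, map_pow, faceEval_toFaceRing_X hx hj,
      MvPolynomial.X_pow_eq_monomial]
  by_cases hβ : ∀ i, 0 ≤ β i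
  · have hβ' : ∀ i, 0 ≤ (β + Pi.single j (ℓ : ℤ) : Fin n → ℤ) i := fun i => by
      have := hβ i
      by_cases hij : i = j
      · subst hij; simp; omega
      · simpa [hij] using this
    have h2 : expOf (β + Pi.single j (ℓ : ℤ)) = Finsupp.single j ℓ + expOf β := by
      apply degOf_injective
      rw [degOf_expOf hβ', degOf_add, degOf_expOf hβ, add_comm]
      congr 1
      ext i
      by_cases hij : i = j
      · subst hij; simp [degOf]
      · simp [degOf, hij]
    rw [coord_of_nonneg hx t hβ, coord_of_nonneg hx t hβ', h1, h2,
      MvPolynomial.coeff_monomial_mul, one_mul]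
  · rw [coord_of_not_nonneg hx t hβ]
    -- If the shift repairs the negativity, then the exponent of `x_j` in the shifted degree is less
    -- than `ℓ`, so a multiple of `x_j^ℓ` has coefficient zero there.
    by_cases hβ' : ∀ i, 0 ≤ (β + Pi.single j (ℓ : ℤ) : Fin n → ℤ) i
    · rw [coord_of_nonneg hx t hβ', h1, MvPolynomial.coeff_monomial_mul', if_neg]
      intro hle
      refine hβ fun i => ?_
      have h3 := hβ' i
      by_cases hij : i = j
      · subst hij
        have h4 := hle i
        simp only [expOf, Finsupp.single_eq_same, Pi.add_apply, Pi.single_eq_same,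
          Finsupp.equivFunOnFinite_symm_apply_apply] at h4
        simp only [Pi.add_apply, Pi.single_eq_same] at h3
        omega
      · simpa [hij] using h3
    · exact coord_of_not_nonneg hx t hβ' _

end FaceGrading

/-! ### The Koszul complex of `x₁^ℓ, …, xₙ^ℓ` -/

section Koszul

variable {k : Type u} [Field k] {n : ℕ} (ℓ : ℕ)

section Coboundary

variable {N : Type*} [AddCommGroup N] [Module (MvPolynomial (Fin n) k) N]

/-- The Koszul coboundary of a cochain `g` with values in a module. -/
def koszulCoboundary :
    (Finset (Fin n) → N) →ₗ[MvPolynomial (Fin n) k] (Finset (Fin n) → N) where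
  toFun g F := ∑ j ∈ F, koszulSign j (F.erase j) •
    ((MvPolynomial.X j ^ ℓ : MvPolynomial (Fin n) k) • g (F.erase j))
  map_add' g h := by
    ext F
    simp only [Pi.add_apply, smul_add, Finset.sum_add_distrib]
  map_smul' r g := by
    ext F
    simp only [Pi.smul_apply, RingHom.id_apply, Finset.smul_sum]
    refine Finset.sum_congr rfl fun j _ => ?_
    rw [smul_comm _ r, smul_comm _ r]

theorem koszulCoboundary_apply (g : Finset (Fin n) → N) (F : Finset (Fin n)) :
    koszulCoboundary (k := k) ℓ g F = ∑ j ∈ F, koszulSign j (F.erase j) •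
      ((MvPolynomial.X j ^ ℓ : MvPolynomial (Fin n) k) • g (F.erase j)) := rfl

/-- Terms cancel in pairs: the two orders of removing `j` and `t` from `F` carry opposite signs. -/
theorem koszulCoboundary_koszulCoboundary (g : Finset (Fin n) → N) :
    koszulCoboundary (k := k) ℓ (koszulCoboundary (k := k) ℓ g) = 0 := by
  ext F
  simp only [koszulCoboundary_apply, Finset.smul_sum, Pi.zero_apply]
  rw [Finset.sum_sigma']
  refine Finset.sum_involution (fun a _ => ⟨a.2, a.1⟩) ?_ ?_ ?_ ?_
  · rintro ⟨j, t⟩ h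
    simp only [Finset.mem_sigma, Finset.mem_erase] at h
    obtain ⟨hj, htj, ht⟩ := h
    dsimp only
    rw [Finset.erase_right_comm (a := t) (b := j)]
    set S := (F.erase j).erase t with hS
    have h1 : F.erase j = insert t S := (Finset.insert_erase (Finset.mem_erase.2 ⟨htj, ht⟩)).symm
    have h2 : F.erase t = insert j S := by
      rw [hS, Finset.erase_right_comm, Finset.insert_erase (Finset.mem_erase.2 ⟨htj.symm, hj⟩)]
    have hjS : j ∉ S := fun h => by simp [hS] at h
    have htS : t ∉ S := Finset.notMem_erase _ _
    rw [h1, h2, smul_comm (MvPolynomial.X j ^ ℓ), smul_comm (MvPolynomial.X t ^ ℓ), smul_smul,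
      smul_smul (koszulSign t (insert j S)), koszulSign_swap htj.symm hjS htS,
      smul_comm (MvPolynomial.X j ^ ℓ : MvPolynomial (Fin n) k), neg_smul, neg_add_cancel]
  · rintro ⟨j, t⟩ h _ e
    simp only [Finset.mem_sigma, Finset.mem_erase] at h
    exact h.2.1 (congrArg Sigma.fst e)
  · rintro ⟨j, t⟩ h
    simp only [Finset.mem_sigma, Finset.mem_erase] at h ⊢
    exact ⟨h.2.2, h.2.1.symm, h.1⟩
  · rintro ⟨j, t⟩ _
    rfl

end Coboundary

variable (k n)

/-- The differential of the Koszul complex, on the sum of all its terms. -/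
def koszulD : (Finset (Fin n) → MvPolynomial (Fin n) k) →ₗ[MvPolynomial (Fin n) k]
    (Finset (Fin n) → MvPolynomial (Fin n) k) :=
  Fintype.linearCombination (MvPolynomial (Fin n) k)
    (koszulCoboundary (k := k) ℓ fun F => Pi.single F 1)

/-- The term of degree `i` of the Koszul complex. -/
def koszulTerm (i : ℕ) :
    Submodule (MvPolynomial (Fin n) k) (Finset (Fin n) → MvPolynomial (Fin n) k) where
  carrier := {c | ∀ F, F.card ≠ i → c F = 0}
  add_mem' ha hb F hF := by simp [ha F hF, hb F hF]
  zero_mem' _ _ := rfl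
  smul_mem' r c hc F hF := by simp [hc F hF]

variable {k n}

theorem single_mem_koszulTerm (F : Finset (Fin n)) (a : MvPolynomial (Fin n) k) :
    Pi.single F a ∈ koszulTerm k n F.card := by
  intro F' hF'
  rw [Pi.single_eq_of_ne]
  rintro rfl
  exact hF' rfl

/-- Differential and coboundary are adjoint, because `koszulD` is the linear extension of the
coboundary of the universal cochain `F ↦ e_F`. This transfers `δ² = 0` to the differential. -/
theorem linearCombination_koszulD {N : Type*} [AddCommGroup N]
    [Module (MvPolynomial (Fin n) k) N] (g : Finset (Fin n) → N)
    (c : Finset (Fin n) → MvPolynomial (Fin n) k) :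
    Fintype.linearCombination (MvPolynomial (Fin n) k) g (koszulD k n ℓ c) =
      Fintype.linearCombination (MvPolynomial (Fin n) k) (koszulCoboundary (k := k) ℓ g) c := by
  rw [koszulD, Fintype.linearCombination_apply _ _ c, Fintype.linearCombination_apply _ _ c,
    map_sum]
  refine Finset.sum_congr rfl fun F _ => ?_
  simp only [map_smul, koszulCoboundary_apply, map_sum, map_zsmul,
    Fintype.linearCombination_apply_single, one_smul]

theorem koszulD_koszulD (c : Finset (Fin n) → MvPolynomial (Fin n) k) :
    koszulD k n ℓ (koszulD k n ℓ c) = 0 := by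
  refine (linearCombination_koszulD ℓ _ c).trans ?_
  rw [koszulCoboundary_koszulCoboundary]
  simp [Fintype.linearCombination_apply]

theorem koszulD_single (F : Finset (Fin n)) (a : MvPolynomial (Fin n) k) :
    koszulD k n ℓ (Pi.single F a) = ∑ j ∈ F, koszulSign j (F.erase j) •
      Pi.single (F.erase j) (MvPolynomial.X j ^ ℓ * a) := by
  rw [koszulD, Fintype.linearCombination_apply_single, koszulCoboundary_apply, Finset.smul_sum]
  refine Finset.sum_congr rfl fun j _ => ?_
  rw [smul_comm a, smul_smul, ← Pi.single_smul, smul_eq_mul, mul_one, mul_comm]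

theorem koszulCoboundary_single_mem {i : ℕ} {F : Finset (Fin n)} (hF : F.card = i + 1) :
    koszulCoboundary (k := k) ℓ (fun F => (Pi.single F 1 : Finset (Fin n) → _)) F ∈
      koszulTerm k n i := by
  rw [koszulCoboundary_apply]
  refine Submodule.sum_mem _ fun j hj => ?_
  refine zsmul_mem (Submodule.smul_mem _ _ ?_) _
  have h : (F.erase j).card = i := by rw [Finset.card_erase_of_mem hj, hF]; rfl
  exact h ▸ single_mem_koszulTerm (F.erase j) 1

theorem koszulD_mem {i : ℕ} {c : Finset (Fin n) → MvPolynomial (Fin n) k}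
    (hc : c ∈ koszulTerm k n (i + 1)) : koszulD k n ℓ c ∈ koszulTerm k n i := by
  rw [koszulD, Fintype.linearCombination_apply]
  refine Submodule.sum_mem _ fun F _ => ?_
  by_cases hF : F.card = i + 1
  · exact Submodule.smul_mem _ _ (koszulCoboundary_single_mem ℓ hF)
  · rw [hc F hF, zero_smul]
    exact Submodule.zero_mem _

/-! #### Exactness -/

/-- The indices at which the monomial `x^m e_F` can be divided by `x^ℓ`. -/
def koszulIndices (F : Finset (Fin n)) (m : Fin n →₀ ℕ) : Finset (Fin n) :=
  Finset.univ.filter fun t => t ∈ F ∨ ℓ ≤ m t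

/-- The contracting homotopy on basis elements. -/
def homotopyBasis (F : Finset (Fin n)) (m : Fin n →₀ ℕ) :
    Finset (Fin n) → MvPolynomial (Fin n) k :=
  if h : (koszulIndices ℓ F m).Nonempty then
    if (koszulIndices ℓ F m).max' h ∈ F then 0
    else Pi.single (insert ((koszulIndices ℓ F m).max' h) F)
      (MvPolynomial.monomial (m - Finsupp.single ((koszulIndices ℓ F m).max' h) ℓ) 1)
  else 0

variable (k n) in
/-- The contracting homotopy of the Koszul complex in positive degrees. -/
def koszulHomotopy : (Finset (Fin n) → MvPolynomial (Fin n) k) →ₗ[k]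
    (Finset (Fin n) → MvPolynomial (Fin n) k) :=
  ∑ F, ((MvPolynomial.basisMonomials (Fin n) k).constr k (homotopyBasis (k := k) ℓ F)).comp
    (LinearMap.proj F)

theorem koszulHomotopy_single (F : Finset (Fin n)) (m : Fin n →₀ ℕ) :
    koszulHomotopy k n ℓ (Pi.single F (MvPolynomial.monomial m 1)) = homotopyBasis ℓ F m := by
  rw [koszulHomotopy, LinearMap.sum_apply, Finset.sum_eq_single_of_mem F (Finset.mem_univ _)]
  · have e : MvPolynomial.monomial m (1 : k) = MvPolynomial.basisMonomials (Fin n) k m := by simp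
    rw [LinearMap.comp_apply, LinearMap.proj_apply, Pi.single_eq_same, e,
      Module.Basis.constr_basis]
  · intro F' _ hne
    rw [LinearMap.comp_apply, LinearMap.proj_apply, Pi.single_eq_of_ne hne, map_zero]

/-- The differential moves `x_t^ℓ` from `e_F` to the coefficient and leaves the index set unchanged.
The homotopy therefore picks the same largest index before and after it. -/
theorem koszulIndices_erase {F : Finset (Fin n)} {t : Fin n} (ht : t ∈ F) (m : Fin n →₀ ℕ) :
    koszulIndices ℓ (F.erase t) (Finsupp.single t ℓ + m) = koszulIndices ℓ F m := by
  ext s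
  simp only [koszulIndices, Finset.mem_filter, Finset.mem_univ, true_and, Finset.mem_erase,
    Finsupp.add_apply]
  by_cases h : s = t
  · subst h; simp [ht]
  · simp [h]

theorem koszulD_single_monomial (F : Finset (Fin n)) (m : Fin n →₀ ℕ) :
    koszulD k n ℓ (Pi.single F (MvPolynomial.monomial m 1)) = ∑ t ∈ F, koszulSign t (F.erase t) •
      Pi.single (F.erase t) (MvPolynomial.monomial (Finsupp.single t ℓ + m) 1) := by
  rw [koszulD_single]
  refine Finset.sum_congr rfl fun t _ => ?_
  rw [MvPolynomial.X_pow_eq_monomial, MvPolynomial.monomial_mul, one_mul]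

/-- Let `j` be the largest index. If `j ∈ F`, the homotopy kills the element and also every term of
its boundary except the one with `t = j`, which it sends back to the element. If `j ∉ F`, the term
with `t = j` of the boundary of the homotopy returns the element; the remaining terms cancel, since
passing `j`, which is larger, costs one sign. -/
theorem koszulHomotopy_identity_single {F : Finset (Fin n)} (hF : F.Nonempty) (m : Fin n →₀ ℕ) :
    koszulD k n ℓ (koszulHomotopy k n ℓ (Pi.single F (MvPolynomial.monomial m 1))) +
      koszulHomotopy k n ℓ (koszulD k n ℓ (Pi.single F (MvPolynomial.monomial m 1))) =
      Pi.single F (MvPolynomial.monomial m 1) := by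
  have hne : (koszulIndices ℓ F m).Nonempty := by
    obtain ⟨t, ht⟩ := hF
    exact ⟨t, by simp [koszulIndices, ht]⟩
  have hsub : F ⊆ koszulIndices ℓ F m := fun t ht => by simp [koszulIndices, ht]
  obtain ⟨j, hj⟩ : ∃ j, j = (koszulIndices ℓ F m).max' hne := ⟨_, rfl⟩
  have hle : ∀ t ∈ F, t ≤ j := fun t ht => hj ▸ Finset.le_max' _ t (hsub ht)
  have hH : ∀ t ∈ F, homotopyBasis (k := k) ℓ (F.erase t) (Finsupp.single t ℓ + m) =
      if j ∈ F.erase t then 0 else Pi.single (insert j (F.erase t))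
        (MvPolynomial.monomial (Finsupp.single t ℓ + m - Finsupp.single j ℓ) 1) := by
    intro t ht
    have e := koszulIndices_erase ℓ ht m
    rw [homotopyBasis, dif_pos (e ▸ hne)]
    simp only [e, ← hj]
  rw [koszulHomotopy_single, koszulD_single_monomial, map_sum]
  simp only [map_zsmul, koszulHomotopy_single]
  rw [homotopyBasis, dif_pos hne, ← hj]
  by_cases hjF : j ∈ F
  · rw [if_pos hjF, map_zero, zero_add, Finset.sum_eq_single_of_mem j hjF]
    · rw [hH j hjF, if_neg (Finset.notMem_erase _ _), Finset.insert_erase hjF,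
        add_tsub_cancel_left, koszulSign_eq_one fun b hb => hle b (Finset.mem_of_mem_erase hb),
        one_smul]
    · intro t ht htj
      rw [hH t ht, if_pos (Finset.mem_erase.2 ⟨htj.symm, hjF⟩), smul_zero]
  · have hmj : Finsupp.single j ℓ ≤ m := by
      have : j ∈ koszulIndices ℓ F m := hj ▸ Finset.max'_mem _ _
      simp only [koszulIndices, Finset.mem_filter, Finset.mem_univ, true_and, hjF,
        false_or] at this
      rwa [Finsupp.single_le_iff]
    rw [if_neg hjF, koszulD_single_monomial, Finset.sum_insert hjF, Finset.erase_insert hjF,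
      add_tsub_cancel_of_le hmj, koszulSign_eq_one hle, one_smul, add_assoc,
      ← Finset.sum_add_distrib, Finset.sum_eq_zero, add_zero]
    intro t ht
    have htj : t ≠ j := fun e => hjF (e ▸ ht)
    have hjt : j ∉ F.erase t := fun h => hjF (Finset.mem_of_mem_erase h)
    rw [hH t ht, if_neg hjt, Finset.erase_insert_of_ne htj.symm, koszulSign_insert hjt,
      if_pos (lt_of_le_of_ne (hle t ht) htj), add_tsub_assoc_of_le hmj, neg_one_mul, neg_smul,
      neg_add_cancel]

theorem koszulHomotopy_identity {c : Finset (Fin n) → MvPolynomial (Fin n) k} (hc : c ∅ = 0) :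
    koszulD k n ℓ (koszulHomotopy k n ℓ c) + koszulHomotopy k n ℓ (koszulD k n ℓ c) = c := by
  have key : ∀ F : Finset (Fin n), F.Nonempty → ∀ a : MvPolynomial (Fin n) k,
      koszulD k n ℓ (koszulHomotopy k n ℓ (Pi.single F a)) +
        koszulHomotopy k n ℓ (koszulD k n ℓ (Pi.single F a)) = Pi.single F a := by
    intro F hF a
    induction a using MvPolynomial.induction_on' with
    | monomial m r =>
      have e : (Pi.single F (MvPolynomial.monomial m r) :
          Finset (Fin n) → MvPolynomial (Fin n) k) =
          r • Pi.single F (MvPolynomial.monomial m 1) := by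
        rw [← Pi.single_smul, MvPolynomial.smul_monomial, smul_eq_mul, mul_one]
      have h1 := koszulHomotopy_identity_single (k := k) ℓ hF m
      rw [e, map_smul, LinearMap.map_smul_of_tower, LinearMap.map_smul_of_tower, map_smul,
        ← smul_add, h1]
    | add p q hp hq =>
      rw [Pi.single_add, map_add, map_add, map_add, map_add, add_add_add_comm, hp, hq]
  have hsum : c = ∑ F, Pi.single F (c F) := (Finset.univ_sum_single c).symm
  rw [hsum]
  simp only [map_sum]
  rw [← Finset.sum_add_distrib]
  refine Finset.sum_congr rfl fun F _ => ?_
  -- The identity fails at `F = ∅`, where the augmentation lives; `hc` removes this component.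
  rcases F.eq_empty_or_nonempty with rfl | hF
  · simp [hc]
  · exact key F hF _

theorem koszulHomotopy_mem {i : ℕ} {c : Finset (Fin n) → MvPolynomial (Fin n) k}
    (hc : c ∈ koszulTerm k n i) : koszulHomotopy k n ℓ c ∈ koszulTerm k n (i + 1) := by
  have h1 : ∀ (F : Finset (Fin n)) (m : Fin n →₀ ℕ),
      homotopyBasis (k := k) ℓ F m ∈ koszulTerm k n (F.card + 1) := by
    intro F m
    rw [homotopyBasis]
    split_ifs with h h'
    · exact Submodule.zero_mem _
    · rw [← Finset.card_insert_of_notMem h']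
      exact single_mem_koszulTerm _ _
    · exact Submodule.zero_mem _
  have key : ∀ (F : Finset (Fin n)) (a : MvPolynomial (Fin n) k),
      koszulHomotopy k n ℓ (Pi.single F a) ∈ koszulTerm k n (F.card + 1) := by
    intro F a
    induction a using MvPolynomial.induction_on' with
    | monomial m r =>
      have e : (Pi.single F (MvPolynomial.monomial m r) :
          Finset (Fin n) → MvPolynomial (Fin n) k) =
          r • Pi.single F (MvPolynomial.monomial m 1) := by
        rw [← Pi.single_smul, MvPolynomial.smul_monomial, smul_eq_mul, mul_one]
      rw [e, map_smul, koszulHomotopy_single]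
      exact Submodule.smul_of_tower_mem _ r (h1 F m)
    | add p q hp hq =>
      rw [Pi.single_add, map_add]
      exact Submodule.add_mem _ hp hq
  rw [← Finset.univ_sum_single c, map_sum]
  refine Submodule.sum_mem _ fun F _ => ?_
  by_cases hF : F.card = i
  · exact hF ▸ key F _
  · rw [hc F hF, Pi.single_zero, map_zero]
    exact Submodule.zero_mem _

theorem koszul_exact {i : ℕ} {c : Finset (Fin n) → MvPolynomial (Fin n) k}
    (hc : c ∈ koszulTerm k n (i + 1)) (h : koszulD k n ℓ c = 0) :
    ∃ b ∈ koszulTerm k n (i + 2), koszulD k n ℓ b = c := by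
  refine ⟨_, koszulHomotopy_mem ℓ hc, ?_⟩
  have := koszulHomotopy_identity (k := k) ℓ (hc ∅ (by simp))
  rwa [h, map_zero, add_zero] at this

theorem koszul_exact_zero {a : MvPolynomial (Fin n) k} (ha : a ∈ powIdeal k n ℓ) :
    ∃ b ∈ koszulTerm k n 1, koszulD k n ℓ b = Pi.single ∅ a := by
  rw [powIdeal, Ideal.mem_span_range_iff_exists_fun] at ha
  obtain ⟨c, rfl⟩ := ha
  refine ⟨∑ i, Pi.single {i} (c i), Submodule.sum_mem _ fun i _ => ?_, ?_⟩
  · exact single_mem_koszulTerm {i} (c i)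
  · rw [map_sum]
    have : ∀ i : Fin n, koszulD k n ℓ (Pi.single {i} (c i)) =
        Pi.single ∅ (c i * MvPolynomial.X i ^ ℓ) := by
      intro i
      rw [koszulD_single, Finset.sum_singleton, Finset.erase_singleton, koszulSign_eq_one (by simp),
        one_smul, mul_comm]
    simp only [this]
    exact (map_sum (AddMonoidHom.single (fun _ : Finset (Fin n) => MvPolynomial (Fin n) k) ∅)
      _ _).symm

theorem koszulD_apply_empty_mem (c : Finset (Fin n) → MvPolynomial (Fin n) k) :
    koszulD k n ℓ c ∅ ∈ powIdeal k n ℓ := by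
  rw [← Finset.univ_sum_single c, map_sum, Finset.sum_apply]
  refine Ideal.sum_mem _ fun F _ => ?_
  rw [koszulD_single, Finset.sum_apply]
  refine Ideal.sum_mem _ fun j _ => ?_
  rw [Pi.smul_apply]
  refine zsmul_mem ?_ _
  by_cases h : F.erase j = ∅
  · rw [h, Pi.single_eq_same]
    exact Ideal.mul_mem_right _ _ (Ideal.subset_span ⟨j, rfl⟩)
  · rw [Pi.single_eq_of_ne (Ne.symm h)]
    exact Ideal.zero_mem _

end Koszul

/-! ### The Koszul complex as a graded projective resolution -/

section KoszulResolution

variable (k : Type u) [Field k] (n ℓ : ℕ)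

/-- The differential of the Koszul complex. -/
def koszulDiff (i : ℕ) :
    koszulTerm k n (i + 1) →ₗ[MvPolynomial (Fin n) k] koszulTerm k n i :=
  (koszulD k n ℓ).restrict fun _ => koszulD_mem ℓ

theorem koszulDiff_koszulDiff (i : ℕ) (c : koszulTerm k n (i + 2)) :
    koszulDiff k n ℓ i (koszulDiff k n ℓ (i + 1) c) = 0 :=
  Subtype.ext (koszulD_koszulD ℓ c.1)

/-- The Koszul complex. -/
def koszulComplex : ChainComplex (ModuleCat.{u} (MvPolynomial (Fin n) k)) ℕ :=
  ChainComplex.of (fun i => ModuleCat.of (MvPolynomial (Fin n) k) (koszulTerm k n i))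
    (fun i => ModuleCat.ofHom (koszulDiff k n ℓ i)) fun i => by
      refine ModuleCat.hom_ext (LinearMap.ext fun c => ?_)
      exact koszulDiff_koszulDiff k n ℓ i c

theorem koszulComplex_d (i : ℕ) :
    (koszulComplex k n ℓ).d (i + 1) i = ModuleCat.ofHom (koszulDiff k n ℓ i) := by
  simp [koszulComplex]

theorem projective_koszulTerm (i : ℕ) :
    Module.Projective (MvPolynomial (Fin n) k) (koszulTerm k n i) := by
  classical
  let s : (Finset (Fin n) → MvPolynomial (Fin n) k) →ₗ[MvPolynomial (Fin n) k] koszulTerm k n i :=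
    { toFun := fun c => ⟨fun F => if F.card = i then c F else 0, fun F hF => if_neg hF⟩
      map_add' := fun c c' => Subtype.ext <| funext fun F => by
        by_cases h : F.card = i <;> simp [h]
      map_smul' := fun r c => Subtype.ext <| funext fun F => by
        by_cases h : F.card = i <;> simp [h] }
  refine Module.Projective.of_split (koszulTerm k n i).subtype s ?_
  ext c F
  by_cases h : F.card = i
  · simp [s, h]
  · simp [s, h, c.2 F h]

/-- The augmentation of the Koszul complex. -/
def koszulAug : koszulTerm k n 0 →ₗ[MvPolynomial (Fin n) k]
    (MvPolynomial (Fin n) k ⧸ powIdeal k n ℓ) :=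
  (Submodule.mkQ (powIdeal k n ℓ)).comp
    ((LinearMap.proj ∅).comp (koszulTerm k n 0).subtype)

theorem koszulAug_apply (c : koszulTerm k n 0) :
    koszulAug k n ℓ c = Ideal.Quotient.mk (powIdeal k n ℓ) (c.1 ∅) := rfl

theorem eq_single_of_mem_koszulTerm_zero (c : koszulTerm k n 0) : c.1 = Pi.single ∅ (c.1 ∅) := by
  ext F : 1
  by_cases h : F = ∅
  · subst h; simp
  · rw [Pi.single_eq_of_ne h]
    exact c.2 F (by simpa using h)

theorem koszulAug_surjective : Function.Surjective (koszulAug k n ℓ) := by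
  intro a
  obtain ⟨p, rfl⟩ := Ideal.Quotient.mk_surjective a
  exact ⟨⟨Pi.single ∅ p, single_mem_koszulTerm ∅ p⟩, by simp [koszulAug_apply]⟩

theorem koszulAug_koszulDiff (c : koszulTerm k n 1) :
    koszulAug k n ℓ (koszulDiff k n ℓ 0 c) = 0 := by
  rw [koszulAug_apply, Ideal.Quotient.eq_zero_iff_mem]
  exact koszulD_apply_empty_mem ℓ c.1

theorem koszulAug_exact (c : koszulTerm k n 0) (hc : koszulAug k n ℓ c = 0) :
    ∃ b, koszulDiff k n ℓ 0 b = c := by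
  rw [koszulAug_apply, Ideal.Quotient.eq_zero_iff_mem] at hc
  obtain ⟨b, hb, h⟩ := koszul_exact_zero ℓ hc
  exact ⟨⟨b, hb⟩, Subtype.ext (h.trans (eq_single_of_mem_koszulTerm_zero k n c).symm)⟩

/-- The augmentation of the Koszul complex as a morphism of complexes. -/
def koszulπ : koszulComplex k n ℓ ⟶ (ChainComplex.single₀ _).obj
    (ModuleCat.of (MvPolynomial (Fin n) k) (MvPolynomial (Fin n) k ⧸ powIdeal k n ℓ)) :=
  (ChainComplex.toSingle₀Equiv _ _).symm ⟨ModuleCat.ofHom (koszulAug k n ℓ), by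
    rw [koszulComplex_d]
    exact ModuleCat.hom_ext (LinearMap.ext fun c => koszulAug_koszulDiff k n ℓ c)⟩

theorem koszulπ_f_zero : (koszulπ k n ℓ).f 0 = ModuleCat.ofHom (koszulAug k n ℓ) :=
  ChainComplex.toSingle₀Equiv_symm_apply_f_zero _ _

theorem quasiIso_koszulπ : QuasiIso (koszulπ k n ℓ) := ⟨fun i => by
  cases i with
  | zero =>
    rw [ChainComplex.quasiIsoAt₀_iff, ShortComplex.quasiIso_iff_of_zeros']
    · constructor
      · rw [ShortComplex.moduleCat_exact_iff]
        intro c hc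
        change ((koszulπ k n ℓ).f 0).hom c = 0 at hc
        rw [koszulπ_f_zero] at hc
        obtain ⟨b, hb⟩ := koszulAug_exact k n ℓ c hc
        refine ⟨b, ?_⟩
        change ((koszulComplex k n ℓ).d 1 0).hom b = c
        rw [koszulComplex_d]
        exact hb
      · rw [ModuleCat.epi_iff_surjective]
        change Function.Surjective ((koszulπ k n ℓ).f 0).hom
        rw [koszulπ_f_zero]
        exact koszulAug_surjective k n ℓ
    all_goals rfl
  | succ i =>
    rw [quasiIsoAt_iff_exactAt']
    · rw [HomologicalComplex.exactAt_iff' _ (i + 2) (i + 1) i (by simp) (by simp),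
        ShortComplex.moduleCat_exact_iff]
      intro c hc
      change ((koszulComplex k n ℓ).d (i + 1) i).hom c = 0 at hc
      rw [koszulComplex_d] at hc
      obtain ⟨b, hb, h⟩ := koszul_exact ℓ c.2 (congrArg Subtype.val hc)
      refine ⟨(⟨b, hb⟩ : koszulTerm k n (i + 2)), ?_⟩
      change ((koszulComplex k n ℓ).d (i + 2) (i + 1)).hom _ = c
      rw [koszulComplex_d]
      exact Subtype.ext h
    · apply ChainComplex.exactAt_succ_single_obj⟩

/-- The Koszul resolution. -/
def koszulResolution : ProjectiveResolution
    (ModuleCat.of (MvPolynomial (Fin n) k) (MvPolynomial (Fin n) k ⧸ powIdeal k n ℓ)) where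
  complex := koszulComplex k n ℓ
  projective i := by
    have := projective_koszulTerm k n i
    exact ModuleCat.projective_of_categoryTheory_projective
      (ModuleCat.of (MvPolynomial (Fin n) k) (koszulTerm k n i))
  π := koszulπ k n ℓ
  quasiIso := quasiIso_koszulπ k n ℓ

/-! #### The grading -/

variable {k n} in
/-- The degree of the basis element `e_F`. -/
def koszulShift (F : Finset (Fin n)) : Fin n → ℤ := fun i => if i ∈ F then (ℓ : ℤ) else 0

variable {n} in
theorem koszulShift_erase {F : Finset (Fin n)} {j : Fin n} (hj : j ∈ F) :
    koszulShift ℓ (F.erase j) + Pi.single j (ℓ : ℤ) = koszulShift ℓ F := by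
  ext i
  by_cases h : i = j
  · subst h; simp [koszulShift, hj]
  · simp [koszulShift, h]

/-- The homogeneous part of degree `β` of the sum of all terms of the Koszul complex. -/
def koszulTotalDegree (β : Fin n → ℤ) :
    AddSubgroup (Finset (Fin n) → MvPolynomial (Fin n) k) where
  carrier := {c | ∀ F, c F ∈ polyDegree k (β - koszulShift ℓ F)}
  add_mem' ha hb F := Submodule.add_mem _ (ha F) (hb F)
  zero_mem' _ := Submodule.zero_mem _
  neg_mem' ha F := Submodule.neg_mem _ (ha F)

/-- The homogeneous part of degree `β` of a term of the Koszul complex. -/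
def koszulDegree (i : ℕ) (β : Fin n → ℤ) : AddSubgroup (koszulTerm k n i) :=
  (koszulTotalDegree k n ℓ β).comap (koszulTerm k n i).toAddSubgroup.subtype

theorem mem_koszulDegree {i : ℕ} {β : Fin n → ℤ} {c : koszulTerm k n i} :
    c ∈ koszulDegree k n ℓ i β ↔ ∀ F, c.1 F ∈ polyDegree k (β - koszulShift ℓ F) := Iff.rfl

theorem single_mem_koszulTotalDegree {β : Fin n → ℤ} {F : Finset (Fin n)}
    {a : MvPolynomial (Fin n) k} (ha : a ∈ polyDegree k (β - koszulShift ℓ F)) :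
    Pi.single F a ∈ koszulTotalDegree k n ℓ β := by
  intro F'
  by_cases h : F' = F
  · subst h; rwa [Pi.single_eq_same]
  · rw [Pi.single_eq_of_ne h]; exact Submodule.zero_mem _

theorem mul_mem_polyDegree {β γ : Fin n → ℤ} {p q : MvPolynomial (Fin n) k}
    (hp : p ∈ polyDegree k β) (hq : q ∈ polyDegree k γ) : p * q ∈ polyDegree k (β + γ) :=
  MvPolynomial.IsWeightedHomogeneous.mul hp hq

theorem X_pow_mem_polyDegree (j : Fin n) :
    (MvPolynomial.X j ^ ℓ : MvPolynomial (Fin n) k) ∈ polyDegree k (Pi.single j (ℓ : ℤ)) := by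
  have := monomial_mem_polyDegree k (Finsupp.single j ℓ) 1
  rw [← MvPolynomial.X_pow_eq_monomial] at this
  convert this using 2
  ext i
  by_cases h : i = j
  · subst h; simp [degOf]
  · simp [degOf, h]

theorem koszulD_mem_degree {β : Fin n → ℤ} {c : Finset (Fin n) → MvPolynomial (Fin n) k}
    (hc : c ∈ koszulTotalDegree k n ℓ β) : koszulD k n ℓ c ∈ koszulTotalDegree k n ℓ β := by
  rw [← Finset.univ_sum_single c, map_sum]
  refine AddSubgroup.sum_mem _ fun F _ => ?_
  rw [koszulD_single]
  refine AddSubgroup.sum_mem _ fun j hj => zsmul_mem (single_mem_koszulTotalDegree k n ℓ ?_) _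
  have := mul_mem_polyDegree k n (X_pow_mem_polyDegree k n ℓ j) (hc F)
  rw [← koszulShift_erase ℓ hj] at this
  convert this using 2
  abel

theorem isGradedModule_koszulDegree (i : ℕ) : IsGradedModule k (koszulDegree k n ℓ i) where
  isInternal := by
    refine isInternal_of_functionals (J := Finset (Fin n) × (Fin n →₀ ℕ)) _
      (fun j => ((MvPolynomial.coeffAddMonoidHom j.2).comp (Pi.evalAddMonoidHom _ j.1)).comp
        (koszulTerm k n i).toAddSubgroup.subtype) (fun j => degOf j.2 + koszulShift ℓ j.1)
      (fun β c => ?_) (fun c h => ?_) fun c => ?_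
    · rw [mem_koszulDegree]
      simp only [mem_polyDegree_iff, eq_sub_iff_add_eq]
      constructor
      · intro h j hj
        by_contra hne
        exact hj (h j.1 j.2 hne)
      · intro h F b hb
        by_contra hne
        exact hb (h (F, b) hne)
    · refine Subtype.ext (funext fun F => MvPolynomial.ext _ _ fun b => ?_)
      exact h (F, b)
    · have key : ∀ F : Finset (Fin n), F.card = i → ∀ a : MvPolynomial (Fin n) k,
          ∀ h : Pi.single F a ∈ koszulTerm k n i,
          (⟨Pi.single F a, h⟩ : koszulTerm k n i) ∈ ⨆ β, koszulDegree k n ℓ i β := by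
        intro F hF a
        have hs : ∀ p : MvPolynomial (Fin n) k, Pi.single F p ∈ koszulTerm k n i :=
          fun p => hF ▸ single_mem_koszulTerm F p
        induction a using MvPolynomial.induction_on' with
        | monomial b r =>
          intro h
          refine AddSubgroup.mem_iSup_of_mem (degOf b + koszulShift ℓ F) ?_
          refine single_mem_koszulTotalDegree k n ℓ ?_
          rw [add_sub_cancel_right]
          exact monomial_mem_polyDegree k b r
        | add p q hp hq =>
          intro h
          have e : (⟨Pi.single F (p + q), h⟩ : koszulTerm k n i) =
              ⟨Pi.single F p, hs p⟩ + ⟨Pi.single F q, hs q⟩ :=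
            Subtype.ext (by simp [Pi.single_add])
          rw [e]
          exact add_mem (hp (hs p)) (hq (hs q))
      have hmem : ∀ F, Pi.single F (c.1 F) ∈ koszulTerm k n i := by
        intro F
        by_cases h : F.card = i
        · have := single_mem_koszulTerm F (c.1 F)
          rwa [h] at this
        · rw [c.2 F h, Pi.single_zero]; exact Submodule.zero_mem _
      have hsum : c = ∑ F, (⟨Pi.single F (c.1 F), hmem F⟩ : koszulTerm k n i) := by
        refine Subtype.ext ?_
        rw [AddSubmonoidClass.coe_finsetSum]
        exact (Finset.univ_sum_single c.1).symm
      rw [hsum]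
      refine AddSubgroup.sum_mem _ fun F _ => ?_
      by_cases h : F.card = i
      · exact key F h _ _
      · have e : (⟨Pi.single F (c.1 F), hmem F⟩ : koszulTerm k n i) = 0 :=
          Subtype.ext (by simp [c.2 F h])
        rw [e]
        exact zero_mem _
  smul_mem β γ a c ha hc F := by
    have := mul_mem_polyDegree k n ha (hc F)
    rwa [← add_sub_assoc] at this

/-- The Koszul resolution as a graded resolution. -/
def koszulGradedResolution : GradedResolution k (powQuotientDegree k n ℓ) where
  res := koszulResolution k n ℓ
  degree := koszulDegree k n ℓ
  isGraded := isGradedModule_koszulDegree k n ℓ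
  d_mem j β m hm := by
    change ((koszulComplex k n ℓ).d (j + 1) j).hom m ∈ _
    rw [koszulComplex_d]
    exact koszulD_mem_degree k n ℓ hm
  π_mem β m hm := by
    change ((koszulπ k n ℓ).f 0).hom m ∈ _
    rw [koszulπ_f_zero]
    refine ⟨m.1 ∅, ?_, rfl⟩
    have h : koszulShift ℓ (∅ : Finset (Fin n)) = 0 := by ext; simp [koszulShift]
    have := hm ∅
    rwa [h, sub_zero] at this

end KoszulResolution

/-! ### Comparison of graded resolutions with the Koszul resolution -/

section Comparison

/-- Homogeneous elements in the image of a homogeneous map have homogeneous preimages. -/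
theorem exists_homogeneous_preimage {M N ι : Type*} [DecidableEq ι] [AddCommGroup M]
    [AddCommGroup N] {𝓜 : ι → AddSubgroup M} {𝓝 : ι → AddSubgroup N}
    (hM : DirectSum.IsInternal 𝓜) (hN : DirectSum.IsInternal 𝓝) (f : M →+ N)
    (hf : ∀ β m, m ∈ 𝓜 β → f m ∈ 𝓝 β) {β : ι} {m : M} (hm : f m ∈ 𝓝 β) :
    ∃ m' ∈ 𝓜 β, f m' = f m := by
  obtain ⟨c, hc1, hc2, hc3, hc4⟩ := exists_components hM
  obtain ⟨c', -, hc'2, hc'3, -⟩ := exists_components hN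
  -- A homogeneous map commutes with taking components, so the component of degree `β` of any
  -- preimage is a preimage.
  have key : ∀ m, f (c β m) = c' β (f m) := by
    intro m
    have := hc4 m
    induction this using AddSubgroup.iSup_induction' with
    | hp γ m hm =>
      by_cases h : β = γ
      · subst h
        rw [hc2 _ _ hm, hc'2 _ _ (hf _ _ hm)]
      · rw [hc3 _ _ _ h hm, hc'3 _ _ _ h (hf _ _ hm), map_zero]
    | h1 => simp
    | hadd a b _ _ ha hb => simp [ha, hb]
  exact ⟨c β m, hc1 β m, by rw [key, hc'2 _ _ hm]⟩

variable {k : Type u} [Field k] {n ℓ : ℕ}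

/-- The basis element `e_F` of the Koszul complex. -/
def koszulBasis (k : Type u) [Field k] {i : ℕ} {F : Finset (Fin n)} (hF : F.card = i) :
    koszulTerm k n i :=
  ⟨Pi.single F 1, hF ▸ single_mem_koszulTerm F 1⟩

theorem koszulBasis_mem_degree {i : ℕ} {F : Finset (Fin n)} (hF : F.card = i) :
    koszulBasis k hF ∈ koszulDegree k n ℓ i (koszulShift ℓ F) := by
  refine single_mem_koszulTotalDegree k n ℓ ?_
  rw [sub_self]
  exact MvPolynomial.isWeightedHomogeneous_one _ _

/-! ### Linear maps out of the terms of the Koszul complex -/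

section Hom

variable {N : Type*} [AddCommGroup N] [Module (MvPolynomial (Fin n) k) N]

/-- The linear map on a term of the Koszul complex with prescribed values on the basis. -/
def koszulHom (i : ℕ) (g : Finset (Fin n) → N) :
    koszulTerm k n i →ₗ[MvPolynomial (Fin n) k] N :=
  (Fintype.linearCombination (MvPolynomial (Fin n) k) g).comp (koszulTerm k n i).subtype

theorem koszulHom_apply (i : ℕ) (g : Finset (Fin n) → N) (c : koszulTerm k n i) :
    koszulHom i g c = ∑ F, c.1 F • g F :=
  Fintype.linearCombination_apply (MvPolynomial (Fin n) k) g c.1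

theorem koszulHom_basis {i : ℕ} (g : Finset (Fin n) → N) {F : Finset (Fin n)} (hF : F.card = i) :
    koszulHom i g (koszulBasis k hF) = g F := by
  exact (Fintype.linearCombination_apply_single (MvPolynomial (Fin n) k) g F 1).trans
    (one_smul (MvPolynomial (Fin n) k) (g F))

theorem koszulTerm_hom_ext {i : ℕ} {f g : koszulTerm k n i →ₗ[MvPolynomial (Fin n) k] N}
    (h : ∀ (F : Finset (Fin n)) (hF : F.card = i), f (koszulBasis k hF) = g (koszulBasis k hF)) :
    f = g := by
  classical
  have key : ∀ f : koszulTerm k n i →ₗ[MvPolynomial (Fin n) k] N,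
      f = koszulHom i fun F => if hF : F.card = i then f (koszulBasis k hF) else 0 := by
    intro f
    ext c
    have hsum : c = ∑ F, c.1 F • (if hF : F.card = i then koszulBasis k hF else 0) := by
      refine Subtype.ext ?_
      rw [AddSubmonoidClass.coe_finsetSum]
      refine (Finset.univ_sum_single c.1).symm.trans (Finset.sum_congr rfl fun F _ => ?_)
      by_cases hF : F.card = i
      · rw [dif_pos hF, Submodule.coe_smul, koszulBasis, ← Pi.single_smul, smul_eq_mul, mul_one]
      · rw [dif_neg hF, c.2 F hF]
        simp
    conv_lhs => rw [hsum]
    rw [map_sum, koszulHom_apply]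
    refine Finset.sum_congr rfl fun F _ => ?_
    rw [map_smul]
    split_ifs <;> simp
  rw [key f, key g]
  congr 1
  funext F
  split_ifs with hF
  · exact h F hF
  · rfl

theorem koszulHom_koszulDiff (i : ℕ) (g : Finset (Fin n) → N) (c : koszulTerm k n (i + 1)) :
    koszulHom i g (koszulDiff k n ℓ i c) = koszulHom (i + 1) (koszulCoboundary (k := k) ℓ g) c :=
  linearCombination_koszulD ℓ g c.1

theorem koszulHom_mem {𝓝 : (Fin n → ℤ) → AddSubgroup N}
    (hN : ∀ (β γ : Fin n → ℤ) (a : MvPolynomial (Fin n) k) (m : N),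
      a ∈ polyDegree k β → m ∈ 𝓝 γ → a • m ∈ 𝓝 (β + γ))
    {i : ℕ} {g : Finset (Fin n) → N} {α : Fin n → ℤ}
    (hg : ∀ F, F.card = i → g F ∈ 𝓝 (koszulShift ℓ F + α)) {β : Fin n → ℤ} {c : koszulTerm k n i}
    (hc : c ∈ koszulDegree k n ℓ i β) : koszulHom i g c ∈ 𝓝 (β + α) := by
  rw [koszulHom_apply]
  refine AddSubgroup.sum_mem _ fun F _ => ?_
  by_cases hF : F.card = i
  · have := hN _ _ _ _ (hc F) (hg F hF)
    rwa [← add_assoc, sub_add_cancel] at this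
  · rw [c.2 F hF, zero_smul]
    exact zero_mem _

end Hom

variable (R : GradedResolution k (powQuotientDegree k n ℓ))

/-- The augmentation of a resolution. -/
def GradedResolution.aug : R.res.complex.X 0 →ₗ[MvPolynomial (Fin n) k]
    (MvPolynomial (Fin n) k ⧸ powIdeal k n ℓ) :=
  (R.res.π.f 0 ≫ (HomologicalComplex.singleObjXSelf (ComplexShape.down ℕ) 0
      (ModuleCat.of (MvPolynomial (Fin n) k) (MvPolynomial (Fin n) k ⧸ powIdeal k n ℓ))).hom).hom

theorem GradedResolution.aug_surjective : Function.Surjective R.aug :=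
  (ModuleCat.epi_iff_surjective (R.res.π.f 0)).1 inferInstance

theorem GradedResolution.aug_exact {m : R.res.complex.X 0} (h : R.aug m = 0) :
    ∃ w, (R.res.complex.d 1 0).hom w = m :=
  (ShortComplex.moduleCat_exact_iff _).1 R.res.exact₀ m h

theorem GradedResolution.exact {i : ℕ} {m : R.res.complex.X (i + 1)}
    (h : (R.res.complex.d (i + 1) i).hom m = 0) :
    ∃ w, (R.res.complex.d (i + 2) (i + 1)).hom w = m :=
  (ShortComplex.moduleCat_exact_iff _).1 (R.res.exact_succ i) m h

theorem weightedHomogeneousComponent_mem_powIdeal {p : MvPolynomial (Fin n) k}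
    (hp : p ∈ powIdeal k n ℓ) (β : Fin n → ℤ) :
    MvPolynomial.weightedHomogeneousComponent
      (fun i : Fin n => (Pi.single i 1 : Fin n → ℤ)) β p ∈ powIdeal k n ℓ := by
  classical
  let _ := MvPolynomial.weightedGradedAlgebra k (fun i : Fin n => (Pi.single i 1 : Fin n → ℤ))
  refine MvPolynomial.weightedHomogeneousComponent_mem_of_mem _ _ ?_ hp β
  refine Ideal.homogeneous_span _ _ ?_
  rintro _ ⟨j, rfl⟩
  exact ⟨_, X_pow_mem_polyDegree k n ℓ j⟩

/-- The component of degree `0` of any lift of `1` is again a lift. The comparison is made on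
polynomial representatives, and it is well defined because the ideal `(x₁^ℓ, …, xₙ^ℓ)` is
homogeneous. -/
theorem GradedResolution.exists_lift_one :
    ∃ w ∈ R.degree 0 0, R.aug w = Ideal.Quotient.mk (powIdeal k n ℓ) 1 := by
  obtain ⟨c, hc1, hc2, hc3, hc4⟩ := exists_components (R.isGraded 0).isInternal
  have key : ∀ m : R.res.complex.X 0, ∃ p : MvPolynomial (Fin n) k,
      Ideal.Quotient.mk (powIdeal k n ℓ) p = R.aug m ∧
      Ideal.Quotient.mk (powIdeal k n ℓ) (MvPolynomial.weightedHomogeneousComponent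
        (fun i : Fin n => (Pi.single i 1 : Fin n → ℤ)) 0 p) = R.aug (c 0 m) := by
    intro m
    have := hc4 m
    induction this using AddSubgroup.iSup_induction' with
    | hp γ m hm =>
      obtain ⟨p, hp, hpm⟩ := R.π_mem γ m hm
      refine ⟨p, hpm, ?_⟩
      by_cases h : 0 = γ
      · subst h
        rw [hc2 _ _ hm, MvPolynomial.IsWeightedHomogeneous.weightedHomogeneousComponent_same hp]
        exact hpm
      · rw [hc3 _ _ _ h hm,
          MvPolynomial.IsWeightedHomogeneous.weightedHomogeneousComponent_ne _ hp h, map_zero,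
          map_zero]
    | h1 => exact ⟨0, by simp, by simp⟩
    | hadd a b _ _ ha hb =>
      obtain ⟨p, hp, hp'⟩ := ha
      obtain ⟨q, hq, hq'⟩ := hb
      exact ⟨p + q, by simp [hp, hq], by simp [hp', hq']⟩
  obtain ⟨w, hw⟩ := R.aug_surjective (Ideal.Quotient.mk (powIdeal k n ℓ) 1)
  refine ⟨c 0 w, hc1 0 w, ?_⟩
  obtain ⟨p, hp, hp'⟩ := key w
  rw [← hp', Ideal.Quotient.eq]
  rw [hw, Ideal.Quotient.eq] at hp
  have := weightedHomogeneousComponent_mem_powIdeal hp 0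
  rwa [map_sub, MvPolynomial.IsWeightedHomogeneous.weightedHomogeneousComponent_same
    (MvPolynomial.isWeightedHomogeneous_one k _)] at this

/-- A homogeneous map from a term of the Koszul complex that can be extended to the next term. -/
def IsExtendable (i : ℕ)
    (p : koszulTerm k n i →ₗ[MvPolynomial (Fin n) k] R.res.complex.X i) : Prop :=
  (∀ β c, c ∈ koszulDegree k n ℓ i β → p c ∈ R.degree i β) ∧
    ∀ v, ∃ w, (R.res.complex.d (i + 1) i).hom w = p (koszulDiff k n ℓ i v)

theorem exists_isExtendable_zero : ∃ p, IsExtendable R 0 p ∧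
    ∀ c, R.aug (p c) = koszulAug k n ℓ c := by
  obtain ⟨w, hw, hw1⟩ := R.exists_lift_one
  have haug : ∀ c, R.aug (koszulHom 0 (fun _ => w) c) = koszulAug k n ℓ c := by
    suffices h : R.aug.comp (koszulHom 0 fun _ => w) = koszulAug k n ℓ from
      fun c => LinearMap.congr_fun h c
    refine koszulTerm_hom_ext fun F hF => ?_
    rw [LinearMap.comp_apply, koszulHom_basis, hw1, koszulAug_apply]
    rw [Finset.card_eq_zero] at hF
    subst hF
    rfl
  refine ⟨koszulHom 0 fun _ => w, ⟨fun β c hc => ?_, fun v => R.aug_exact ?_⟩, haug⟩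
  · have := koszulHom_mem (𝓝 := R.degree 0) (α := 0) (g := fun _ => w)
      (R.isGraded 0).smul_mem (fun F hF => ?_) hc
    · rwa [add_zero] at this
    · rw [Finset.card_eq_zero] at hF
      subst hF
      convert hw
      ext
      simp [koszulShift]
  · rw [haug, koszulAug_koszulDiff]

/-- This is the usual lifting through an exact complex, with the images of the `e_F` chosen
homogeneous of the degree of `e_F`. -/
theorem IsExtendable.exists_succ {i : ℕ}
    {p : koszulTerm k n i →ₗ[MvPolynomial (Fin n) k] R.res.complex.X i}
    (hp : IsExtendable R i p) : ∃ p', IsExtendable R (i + 1) p' ∧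
      ∀ c, (R.res.complex.d (i + 1) i).hom (p' c) = p (koszulDiff k n ℓ i c) := by
  classical
  have h1 : ∀ (F : Finset (Fin n)) (hF : F.card = i + 1), ∃ w ∈ R.degree (i + 1) (koszulShift ℓ F),
      (R.res.complex.d (i + 1) i).hom w = p (koszulDiff k n ℓ i (koszulBasis k hF)) := by
    intro F hF
    obtain ⟨w, hw⟩ := hp.2 (koszulBasis k hF)
    have hmem : (R.res.complex.d (i + 1) i).hom w ∈ R.degree i (koszulShift ℓ F) := by
      rw [hw]
      exact hp.1 _ _ (koszulD_mem_degree k n ℓ (koszulBasis_mem_degree hF))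
    obtain ⟨w', hw', e⟩ := exists_homogeneous_preimage (R.isGraded (i + 1)).isInternal
      (R.isGraded i).isInternal (R.res.complex.d (i + 1) i).hom.toAddMonoidHom (R.d_mem i) hmem
    exact ⟨w', hw', e.trans hw⟩
  choose w hw hdw using h1
  let p' : koszulTerm k n (i + 1) →ₗ[MvPolynomial (Fin n) k] R.res.complex.X (i + 1) :=
    koszulHom (i + 1) fun F => if hF : F.card = i + 1 then w F hF else 0
  have hd : ∀ c, (R.res.complex.d (i + 1) i).hom (p' c) = p (koszulDiff k n ℓ i c) := by
    suffices h : (R.res.complex.d (i + 1) i).hom.comp p' = p.comp (koszulDiff k n ℓ i) from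
      fun c => LinearMap.congr_fun h c
    refine koszulTerm_hom_ext fun F hF => ?_
    rw [LinearMap.comp_apply, LinearMap.comp_apply, koszulHom_basis, dif_pos hF, hdw]
  refine ⟨p', ⟨fun β c hc => ?_, fun v => R.exact ?_⟩, hd⟩
  · have := koszulHom_mem (𝓝 := R.degree (i + 1)) (α := 0)
      (g := fun F => if hF : F.card = i + 1 then w F hF else 0)
      (R.isGraded (i + 1)).smul_mem (fun F hF => ?_) hc
    · rwa [add_zero] at this
    · rw [dif_pos hF, add_zero]
      exact hw F hF
  · rw [hd, koszulDiff_koszulDiff, map_zero]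

/-- A homogeneous morphism from the Koszul resolution to a given graded resolution. -/
theorem exists_comparison :
    ∃ φ : ProjectiveResolution.Hom (koszulResolution k n ℓ) R.res (𝟙 _),
      ∀ (i : ℕ) (β : Fin n → ℤ) (c : koszulTerm k n i), c ∈ koszulDegree k n ℓ i β →
        (φ.hom.f i).hom c ∈ R.degree i β := by
  obtain ⟨p₀, hp₀, haug⟩ := exists_isExtendable_zero R
  choose step hstep hcomm using fun (i : ℕ) (p : {p // IsExtendable R i p}) =>
    IsExtendable.exists_succ R p.2
  let seq : ∀ i, {p // IsExtendable R i p} := fun i =>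
    Nat.rec ⟨p₀, hp₀⟩ (fun i p => ⟨step i p, hstep i p⟩) i
  have hseq : ∀ i c, (R.res.complex.d (i + 1) i).hom ((seq (i + 1)).1 c) =
      (seq i).1 (koszulDiff k n ℓ i c) := fun i c => hcomm i (seq i) c
  let hom : (koszulResolution k n ℓ).complex ⟶ R.res.complex :=
    { f := fun i => ModuleCat.ofHom (seq i).1
      comm' := by
        rintro _ i rfl
        change _ = (koszulComplex k n ℓ).d (i + 1) i ≫ _
        rw [koszulComplex_d]
        refine ModuleCat.hom_ext (LinearMap.ext fun c => hseq i c) }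
  refine ⟨⟨hom, ?_⟩, fun i β c hc => (seq i).2.1 β c hc⟩
  rw [CategoryTheory.Functor.map_id]
  change _ = (koszulπ k n ℓ).f 0 ≫ 𝟙 _
  rw [Category.comp_id, koszulπ_f_zero]
  exact ModuleCat.hom_ext (LinearMap.ext fun c => haug c)

/-- A comparison map over the identity does not change the class represented by a cocycle, so every
class can be read on the Koszul resolution. -/
theorem extMk_eq_koszul {N : ModuleCat.{u} (MvPolynomial (Fin n) k)} {i : ℕ}
    (φ : ProjectiveResolution.Hom (koszulResolution k n ℓ) R.res (𝟙 _))
    (f : R.res.complex.X i ⟶ N) (hf : R.res.complex.d (i + 1) i ≫ f = 0) :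
    ∃ h, R.res.extMk f (i + 1) rfl hf =
      (koszulResolution k n ℓ).extMk (φ.hom.f i ≫ f) (i + 1) rfl h := by
  have := ProjectiveResolution.mk₀_comp_extMk f (i + 1) rfl hf φ
  rw [Abelian.Ext.mk₀_id_comp] at this
  exact ⟨_, this⟩

end Comparison

/-! ### Homogeneous Koszul cochains compute the graded pieces of `Ext` -/

/-- The cohomology of `d` at the subspace `V`, with respect to the preceding subspace `V'`. -/
abbrev SubCohomology {k E : Type*} [Field k] [AddCommGroup E] [Module k E] (d : E →ₗ[k] E)
    (V' V : Submodule k E) : Type _ :=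
  ↥(V ⊓ LinearMap.ker d) ⧸ (V'.map d).comap (V ⊓ LinearMap.ker d).subtype

section ExtMk

open Abelian

variable {C : Type*} [Category C] [Abelian C] [HasExt C] {X Y : C} (R : ProjectiveResolution X)

theorem extMk_congr {i : ℕ} {f g : R.complex.X i ⟶ Y} (e : f = g)
    (hf : R.complex.d (i + 1) i ≫ f = 0) (hg : R.complex.d (i + 1) i ≫ g = 0) :
    R.extMk f (i + 1) rfl hf = R.extMk g (i + 1) rfl hg := by
  subst e; rfl

/-- A coboundary in degree `0` would factor through the term of the resolution before the augmented
end, which is zero. -/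
theorem extMk_zero_eq_zero_iff {f : R.complex.X 0 ⟶ Y} (hf : R.complex.d (0 + 1) 0 ≫ f = 0) :
    R.extMk f (0 + 1) rfl hf = 0 ↔ f = 0 := by
  constructor
  · intro h
    rw [← R.extEquivCohomologyClass.apply_eq_iff_eq,
      ProjectiveResolution.extEquivCohomologyClass_extMk,
      ProjectiveResolution.extEquivCohomologyClass_zero,
      CochainComplex.HomComplex.CohomologyClass.mk_eq_zero_iff,
      CochainComplex.HomComplex.Cocycle.toSingleMk_mem_coboundaries_iff _ _ _ _ _ 1
        (by simp)] at h
    obtain ⟨g, hg⟩ := h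
    have h0 : g = 0 := (CochainComplex.isZero_of_isStrictlyLE R.cochainComplex 0 1).eq_of_src _ _
    rw [h0, Limits.comp_zero] at hg
    rw [← cancel_epi (R.cochainComplexXIso (-(0 : ℕ)) 0 rfl).hom, ← hg, Limits.comp_zero]
  · rintro rfl
    simp

end ExtMk

section KoszulCochains

variable {k : Type u} [Field k] {n : ℕ} {N : Type u} [AddCommGroup N]
  [Module (MvPolynomial (Fin n) k) N] [Module k N] [IsScalarTower k (MvPolynomial (Fin n) k) N]
  {𝓝 : (Fin n → ℤ) → AddSubgroup N} (hN : IsGradedModule k 𝓝) (ℓ : ℕ) (α : Fin n → ℤ)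

include hN in
theorem IsGradedModule.scalar_smul_mem (r : k) {β : Fin n → ℤ} {m : N} (hm : m ∈ 𝓝 β) :
    r • m ∈ 𝓝 β := by
  have := hN.smul_mem _ _ _ _ (monomial_mem_polyDegree k 0 r) hm
  have h0 : degOf (0 : Fin n →₀ ℕ) = 0 := by ext; simp [degOf]
  rw [h0, zero_add] at this
  rwa [← algebraMap_smul (MvPolynomial (Fin n) k) r m]

/-- The homogeneous Koszul cochains of degree `α` and cohomological degree `j`. -/
def koszulCochains (j : ℤ) : Submodule k (Finset (Fin n) → N) where
  carrier := {g | (∀ F, g F ∈ 𝓝 (koszulShift ℓ F + α)) ∧ ∀ F, (F.card : ℤ) ≠ j → g F = 0}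
  add_mem' ha hb := ⟨fun F => add_mem (ha.1 F) (hb.1 F),
    fun F hF => by simp [ha.2 F hF, hb.2 F hF]⟩
  zero_mem' := ⟨fun _ => zero_mem _, fun _ _ => rfl⟩
  smul_mem' r g hg := ⟨fun F => hN.scalar_smul_mem r (hg.1 F), fun F hF => by simp [hg.2 F hF]⟩

variable (k N) in
/-- The Koszul coboundary as a map of vector spaces. -/
def koszulδ : (Finset (Fin n) → N) →ₗ[k] (Finset (Fin n) → N) :=
  (koszulCoboundary (k := k) ℓ).restrictScalars k

theorem koszulδ_apply (g : Finset (Fin n) → N) :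
    koszulδ k N ℓ g = koszulCoboundary (k := k) ℓ g := rfl

omit [Module k N] [IsScalarTower k (MvPolynomial (Fin n) k) N] in
theorem koszulCoboundary_eq_zero_of_card {g : Finset (Fin n) → N} {i : ℕ}
    (hg : ∀ F, F.card ≠ i → g F = 0) {F : Finset (Fin n)} (hF : F.card ≠ i + 1) :
    koszulCoboundary (k := k) ℓ g F = 0 := by
  rw [koszulCoboundary_apply]
  refine Finset.sum_eq_zero fun j hj => ?_
  rw [hg, smul_zero, smul_zero]
  rw [Finset.card_erase_of_mem hj]
  have := Finset.card_pos.2 ⟨j, hj⟩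
  omega

theorem koszulHom_scalar_smul (i : ℕ) (r : k) (g : Finset (Fin n) → N) (c : koszulTerm k n i) :
    koszulHom i (r • g) c = algebraMap k (MvPolynomial (Fin n) k) r • koszulHom i g c := by
  rw [koszulHom_apply, koszulHom_apply, Finset.smul_sum]
  refine Finset.sum_congr rfl fun F _ => ?_
  rw [smul_comm, algebraMap_smul]
  rfl

/-- `koszulHom` as a morphism from a term of the Koszul resolution. -/
def koszulMor (i : ℕ) (g : Finset (Fin n) → N) : (koszulResolution k n ℓ).complex.X i ⟶
    ModuleCat.of (MvPolynomial (Fin n) k) N :=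
  ModuleCat.ofHom (koszulHom i g)

omit [Module k N] [IsScalarTower k (MvPolynomial (Fin n) k) N] in
variable {ℓ} in
theorem d_comp_koszulMor (i : ℕ) (g : Finset (Fin n) → N) :
    (koszulResolution k n ℓ).complex.d (i + 1) i ≫
      koszulMor (k := k) ℓ i g = koszulMor (k := k) ℓ (i + 1) (koszulCoboundary (k := k) ℓ g) := by
  change (koszulComplex k n ℓ).d (i + 1) i ≫ _ = _
  rw [koszulComplex_d]
  exact ModuleCat.hom_ext (LinearMap.ext fun c => koszulHom_koszulDiff i g c)

variable {ℓ} in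
theorem d_comp_koszulMor_eq_zero {i : ℕ} {g : Finset (Fin n) → N}
    (hg : g ∈ LinearMap.ker (koszulδ k N ℓ)) :
    (koszulResolution k n ℓ).complex.d (i + 1) i ≫
      koszulMor (k := k) ℓ i g = 0 := by
  rw [d_comp_koszulMor]
  rw [LinearMap.mem_ker, koszulδ_apply] at hg
  rw [hg]
  refine ModuleCat.hom_ext (LinearMap.ext fun c => ?_)
  refine (koszulHom_apply _ _ c).trans ?_
  simp only [Pi.zero_apply, smul_zero, Finset.sum_const_zero]
  rfl

/-- The class in `Ext` of a homogeneous Koszul cocycle. -/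
def koszulClass (i : ℕ) :
    ↥(koszulCochains hN ℓ α i ⊓ LinearMap.ker (koszulδ k N ℓ)) →ₗ[k]
      Abelian.Ext (ModuleCat.of (MvPolynomial (Fin n) k) (MvPolynomial (Fin n) k ⧸ powIdeal k n ℓ))
        (ModuleCat.of (MvPolynomial (Fin n) k) N) i where
  toFun g := (koszulResolution k n ℓ).extMk (koszulMor ℓ i g.1) (i + 1) rfl
    (d_comp_koszulMor_eq_zero g.2.2)
  map_add' g h := by
    rw [ProjectiveResolution.add_extMk]
    refine extMk_congr _ (ModuleCat.hom_ext (LinearMap.ext fun c => ?_)) _ _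
    refine (koszulHom_apply _ _ c).trans ?_
    refine Eq.trans ?_ (congrArg₂ (· + ·) (koszulHom_apply i g.1 c) (koszulHom_apply i h.1 c)).symm
    simp [Finset.sum_add_distrib]
  map_smul' r g := by
    rw [RingHom.id_apply, Abelian.Ext.smul_eq_comp_mk₀, ProjectiveResolution.extMk_comp_mk₀]
    refine extMk_congr _ (ModuleCat.hom_ext (LinearMap.ext fun c => ?_)) _ _
    exact koszulHom_scalar_smul i r g.1 c

theorem koszulClass_apply (i : ℕ)
    (g : ↥(koszulCochains hN ℓ α i ⊓ LinearMap.ker (koszulδ k N ℓ))) :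
    koszulClass hN ℓ α i g = (koszulResolution k n ℓ).extMk (koszulMor ℓ i g.1) (i + 1)
      rfl (d_comp_koszulMor_eq_zero g.2.2) := rfl

theorem exists_koszulClass_eq {i : ℕ} (f : (koszulResolution k n ℓ).complex.X i ⟶
      ModuleCat.of (MvPolynomial (Fin n) k) N)
    (hf : (koszulResolution k n ℓ).complex.d (i + 1) i ≫ f = 0)
    (hdeg : ∀ (β : Fin n → ℤ) (c : koszulTerm k n i), c ∈ koszulDegree k n ℓ i β →
      f.hom c ∈ 𝓝 (β + α)) :
    ∃ g, koszulClass hN ℓ α i g = (koszulResolution k n ℓ).extMk f (i + 1) rfl hf := by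
  classical
  let f' : koszulTerm k n i →ₗ[MvPolynomial (Fin n) k] N := f.hom
  let g : Finset (Fin n) → N := fun F => if hF : F.card = i then f' (koszulBasis k hF) else 0
  have hg0 : ∀ F, F.card ≠ i → g F = 0 := fun F hF => dif_neg hF
  have hfg : koszulHom i g = f' := koszulTerm_hom_ext fun F hF => by
    rw [koszulHom_basis]
    exact dif_pos hF
  have hd : ∀ c, f' (koszulDiff k n ℓ i c) = 0 := by
    intro c
    change (koszulComplex k n ℓ).d (i + 1) i ≫ f = 0 at hf
    rw [koszulComplex_d] at hf
    exact LinearMap.congr_fun (congrArg ModuleCat.Hom.hom hf) c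
  refine ⟨⟨g, ⟨fun F => ?_, fun F hF => hg0 F fun h => hF (by rw [h])⟩, ?_⟩, ?_⟩
  · by_cases hF : F.card = i
    · have : g F = f' (koszulBasis k hF) := dif_pos hF
      rw [this]
      exact hdeg _ _ (koszulBasis_mem_degree hF)
    · rw [hg0 F hF]; exact zero_mem _
  · change koszulCoboundary (k := k) ℓ g = 0
    funext F
    by_cases hF : F.card = i + 1
    · have := hd (koszulBasis k hF)
      rwa [← hfg, koszulHom_koszulDiff, koszulHom_basis] at this
    · exact koszulCoboundary_eq_zero_of_card ℓ hg0 hF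
  · rw [koszulClass_apply]
    exact extMk_congr _ (ModuleCat.hom_ext hfg) _ _

/-- The Koszul resolution is one of the graded resolutions allowed in `extDegree`; a homogeneous
cocycle on any other one pulls back along a homogeneous comparison map to a homogeneous Koszul
cocycle. -/
theorem range_koszulClass (i : ℕ) : LinearMap.range (koszulClass hN ℓ α i) =
    extDegree k (powQuotientDegree k n ℓ) 𝓝 i α := by
  apply le_antisymm
  · rintro _ ⟨g, rfl⟩
    refine Submodule.subset_span ⟨koszulGradedResolution k n ℓ, koszulMor ℓ i g.1,
      d_comp_koszulMor_eq_zero g.2.2, fun β c hc => ?_, rfl⟩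
    exact koszulHom_mem hN.smul_mem (fun F _ => g.2.1.1 F) hc
  · refine Submodule.span_le.2 ?_
    rintro _ ⟨R, f, hf, hdeg, rfl⟩
    obtain ⟨φ, hφ⟩ := exists_comparison R
    obtain ⟨h, e⟩ := extMk_eq_koszul R φ f hf
    obtain ⟨g, hg⟩ := exists_koszulClass_eq hN ℓ α (φ.hom.f i ≫ f) h
      fun β c hc => hdeg β _ (hφ i β c hc)
    exact ⟨g, hg.trans e.symm⟩

/-- A cochain bounding `g` need not be homogeneous, but its components of degree `ℓ·1_F + α` still
bound `g`, since multiplication by `x_j^ℓ` shifts components. -/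
theorem exists_homogeneous_coboundary {i : ℕ} {g : Finset (Fin n) → N}
    (hg : g ∈ koszulCochains hN ℓ α ((i + 1 : ℕ) : ℤ))
    {f : koszulTerm k n i →ₗ[MvPolynomial (Fin n) k] N}
    (hf : ∀ c, f (koszulDiff k n ℓ i c) = koszulHom (i + 1) g c) :
    ∃ h ∈ koszulCochains hN ℓ α i, koszulCoboundary (k := k) ℓ h = g := by
  classical
  obtain ⟨c, hc1, hc2, hc3, hc4⟩ := exists_components hN.isInternal
  have hsmul : ∀ (β γ : Fin n → ℤ) (a : MvPolynomial (Fin n) k) (m : N), a ∈ polyDegree k γ →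
      c (β + γ) (a • m) = a • c β m := by
    intro β γ a m ha
    have := hc4 m
    induction this using AddSubgroup.iSup_induction' with
    | hp β' m hm =>
      have hm' := hN.smul_mem _ _ _ _ ha hm
      rw [add_comm] at hm'
      by_cases h : β = β'
      · subst h
        rw [hc2 _ _ hm, hc2 _ _ hm']
      · rw [hc3 _ _ _ h hm, hc3 _ _ _ (fun e => h (add_right_cancel e)) hm', smul_zero]
    | h1 => simp
    | hadd a b _ _ ha hb => simp [ha, hb]
  let f' : Finset (Fin n) → N := fun F => if hF : F.card = i then f (koszulBasis k hF) else 0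
  have hff' : f = koszulHom i f' := koszulTerm_hom_ext fun F hF => by
    rw [koszulHom_basis]
    have : f' F = f (koszulBasis k hF) := dif_pos hF
    exact this.symm
  have hf0 : ∀ F, F.card ≠ i → f' F = 0 := fun F hF => dif_neg hF
  have hh0 : ∀ F, F.card ≠ i → c (koszulShift ℓ F + α) (f' F) = 0 := fun F hF => by
    rw [hf0 F hF, map_zero]
  refine ⟨fun F => c (koszulShift ℓ F + α) (f' F), ⟨fun F => hc1 _ _, fun F hF => ?_⟩, ?_⟩
  · exact hh0 F fun h => hF (by rw [h])
  · funext F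
    by_cases hF : F.card = i + 1
    · have h1 := hf (koszulBasis k hF)
      rw [koszulHom_basis, hff', koszulHom_koszulDiff, koszulHom_basis] at h1
      rw [← hc2 _ _ (hg.1 F), ← h1, koszulCoboundary_apply, koszulCoboundary_apply, map_sum]
      refine Finset.sum_congr rfl fun j hj => ?_
      rw [map_zsmul, ← koszulShift_erase ℓ hj, add_right_comm,
        hsmul _ _ _ _ (X_pow_mem_polyDegree k n ℓ j)]
    · rw [koszulCoboundary_eq_zero_of_card ℓ hh0 hF]
      exact (hg.2 F fun h => hF (by exact_mod_cast h)).symm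

theorem ker_koszulClass (i : ℕ) : LinearMap.ker (koszulClass hN ℓ α i) =
    ((koszulCochains hN ℓ α ((i : ℤ) - 1)).map (koszulδ k N ℓ)).comap
      (koszulCochains hN ℓ α i ⊓ LinearMap.ker (koszulδ k N ℓ)).subtype := by
  ext g
  rw [LinearMap.mem_ker, koszulClass_apply, Submodule.mem_comap, Submodule.mem_map]
  cases i with
  | zero =>
    rw [extMk_zero_eq_zero_iff]
    constructor
    · intro h
      refine ⟨0, Submodule.zero_mem _, ?_⟩
      rw [map_zero]
      refine (funext fun F => ?_ : g.1 = 0).symm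
      by_cases hF : F.card = 0
      · rw [← koszulHom_basis (k := k) g.1 hF]
        exact LinearMap.congr_fun (congrArg ModuleCat.Hom.hom h) _
      · exact g.2.1.2 F (by exact_mod_cast hF)
    · rintro ⟨h, hh, e⟩
      -- Cochains of degree `-1` vanish, as no set has cardinality `-1`.
      have h0 : h = 0 := funext fun F => hh.2 F (by push_cast; omega)
      rw [h0, map_zero] at e
      have e' : g.1 = 0 := e.symm
      refine ModuleCat.hom_ext (LinearMap.ext fun c => ?_)
      refine (koszulHom_apply _ _ c).trans ?_
      simp [e']
  | succ i =>
    rw [ProjectiveResolution.extMk_eq_zero_iff _ _ _ _ _ i rfl]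
    have hi : (((i + 1 : ℕ) : ℤ) - 1) = (i : ℤ) := by push_cast; ring
    rw [hi]
    constructor
    · rintro ⟨f, hf⟩
      change (koszulComplex k n ℓ).d (i + 1) i ≫ f = _ at hf
      rw [koszulComplex_d] at hf
      obtain ⟨h, hh, e⟩ := exists_homogeneous_coboundary hN ℓ α g.2.1 (f := f.hom)
        fun c => LinearMap.congr_fun (congrArg ModuleCat.Hom.hom hf) c
      exact ⟨h, hh, e⟩
    · rintro ⟨h, hh, e⟩
      refine ⟨koszulMor ℓ i h, ?_⟩
      rw [d_comp_koszulMor]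
      exact congrArg (koszulMor ℓ (i + 1)) e

/-- The homogeneous part of degree `α` of `Ext` is the cohomology of the complex of homogeneous
Koszul cochains. -/
def extDegreeEquiv (i : ℕ) : extDegree k (powQuotientDegree k n ℓ) 𝓝 i α ≃ₗ[k]
    SubCohomology (koszulδ k N ℓ) (koszulCochains hN ℓ α ((i : ℤ) - 1))
      (koszulCochains hN ℓ α i) :=
  (LinearEquiv.ofEq _ _ (range_koszulClass hN ℓ α i).symm).trans
    ((koszulClass hN ℓ α i).quotKerEquivRange.symm.trans
      (Submodule.quotEquivOfEq _ _ (ker_koszulClass hN ℓ α i)))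

include hN in
theorem extDegree_eq_bot_of_exact (i : ℕ)
    (h : ∀ g ∈ koszulCochains hN ℓ α i, koszulCoboundary (k := k) ℓ g = 0 →
      ∃ h ∈ koszulCochains hN ℓ α ((i : ℤ) - 1), koszulCoboundary (k := k) ℓ h = g) :
    extDegree k (powQuotientDegree k n ℓ) 𝓝 i α = ⊥ := by
  rw [← range_koszulClass hN, LinearMap.range_eq_bot, ← LinearMap.ker_eq_top, ker_koszulClass,
    eq_top_iff]
  rintro g -
  exact h g.1 g.2.1 g.2.2

end KoszulCochains

/-! ### Vanishing -/

section Vanishing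

variable {k : Type u} [Field k] {P : Type u} [PartialOrder P] [OrderBot P] [Finite P] {n : ℕ}
  {x : Fin n ≃ Atoms P} (hx : IsLabelling (supp x)) (ℓ : ℕ) {α : Fin n → ℤ}

include hx in
theorem extDegree_eq_bot_of_lt {j : Fin n} (hj : α j < -(ℓ : ℤ)) (i : ℕ) :
    extDegree k (powQuotientDegree k n ℓ) (faceModuleDegree k x) i α = ⊥ := by
  refine extDegree_eq_bot_of_exact (isGradedModule_faceModuleDegree hx) ℓ α i fun g hg _ => ?_
  refine ⟨0, Submodule.zero_mem _, ?_⟩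
  rw [map_zero]
  refine (funext fun F => eq_zero_of_coord hx (hg.1 F) fun h => ?_ : g = 0).symm
  have h1 := h j
  simp only [koszulShift, Pi.add_apply] at h1
  split_ifs at h1 <;> omega

section Shift

variable {ℓ} {β : Fin n → ℤ} {j : Fin n}

theorem degSupport_add_single (hj : 0 < β j) :
    degSupport (β + Pi.single j (ℓ : ℤ)) = degSupport β := by
  ext i
  rw [mem_degSupport, mem_degSupport]
  by_cases hij : i = j
  · subst hij
    simp only [Pi.add_apply, Pi.single_eq_same]
    omega
  · simp [hij]

include hx in
theorem X_pow_smul_eq_zero (hj : 0 < β j) {a : FaceModule k x} (ha : a ∈ faceModuleDegree k x β)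
    (h : (MvPolynomial.X j ^ ℓ : MvPolynomial (Fin n) k) • a = 0) : a = 0 := by
  refine eq_zero_of_coord hx ha fun _ t ht => ?_
  have hjt : j ∈ supp x t := by rw [ht, mem_degSupport]; omega
  rw [← coord_X_pow_smul hx hjt ℓ, h, map_zero]

include hx in
-- Adding `ℓ` to a positive coordinate does not change the support, so both degrees have the same
-- indexing faces and multiplication by `x_j^ℓ` preserves the coordinates there.
theorem exists_X_pow_smul_eq (hj : 0 < β j) {b : FaceModule k x}
    (hb : b ∈ faceModuleDegree k x (β + Pi.single j (ℓ : ℤ))) :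
    ∃ a ∈ faceModuleDegree k x β, (MvPolynomial.X j ^ ℓ : MvPolynomial (Fin n) k) • a = b := by
  by_cases hβ : ∀ i, 0 ≤ β i
  · obtain ⟨a, ha, hac⟩ := exists_mem_faceModuleDegree hx hβ
      fun t => coord hx t (β + Pi.single j (ℓ : ℤ)) b
    refine ⟨a, ha, ?_⟩
    have hXa := smul_mem_faceModuleDegree hx (X_pow_mem_polyDegree k n ℓ j) ha
    rw [add_comm] at hXa
    rw [← sub_eq_zero]
    refine eq_zero_of_coord hx (sub_mem hXa hb) fun _ t ht => ?_
    rw [degSupport_add_single hj] at ht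
    have hjt : j ∈ supp x t := by rw [ht, mem_degSupport]; omega
    rw [map_sub, coord_X_pow_smul hx hjt, hac t ht, sub_self]
  -- A negative coordinate of `β` is not the one at `j`, so it persists in the shifted degree and `b
  -- = 0`.
  · refine ⟨0, zero_mem _, ?_⟩
    rw [smul_zero]
    refine (eq_zero_of_coord hx hb fun h => absurd (fun i => ?_) hβ).symm
    have h1 := h i
    by_cases hij : i = j
    · subst hij; exact hj.le
    · simpa [hij] using h1

end Shift

include hx in
-- Contraction in the direction `j`: a cocycle `g` is bounded by `h` with `h F = ± x_j^{-ℓ} g (F ∪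
-- {j})` for `j ∉ F` and `h F = 0` for `j ∈ F`. Division is possible as the coordinate at `j` of
-- every degree involved is positive.
theorem extDegree_eq_bot_of_pos {j : Fin n} (hj : 0 < α j) (i : ℕ) :
    extDegree k (powQuotientDegree k n ℓ) (faceModuleDegree k x) i α = ⊥ := by
  classical
  refine extDegree_eq_bot_of_exact (isGradedModule_faceModuleDegree hx) ℓ α i fun g hg hδ => ?_
  have hpos : ∀ F : Finset (Fin n), 0 < (koszulShift ℓ F + α) j := fun F => by
    simp only [koszulShift, Pi.add_apply]
    split_ifs <;> omega
  have key : ∀ F : Finset (Fin n), j ∉ F → ∃ a ∈ faceModuleDegree k x (koszulShift ℓ F + α),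
      (MvPolynomial.X j ^ ℓ : MvPolynomial (Fin n) k) • a = koszulSign j F • g (insert j F) := by
    intro F hF
    refine exists_X_pow_smul_eq hx (hpos F) (zsmul_mem ?_ _)
    have := hg.1 (insert j F)
    rwa [← koszulShift_erase ℓ (Finset.mem_insert_self j F), Finset.erase_insert hF,
      add_right_comm] at this
  choose a ha hXa using key
  let h : Finset (Fin n) → FaceModule k x := fun F => if hF : j ∈ F then 0 else a F hF
  have h_neg : ∀ {F} (hF : j ∉ F), h F = a F hF := fun hF => dif_neg hF
  have h_pos : ∀ {F}, j ∈ F → h F = 0 := fun hF => dif_pos hF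
  have h_mem : ∀ F, h F ∈ faceModuleDegree k x (koszulShift ℓ F + α) := fun F => by
    by_cases hF : j ∈ F
    · rw [h_pos hF]; exact zero_mem _
    · rw [h_neg hF]; exact ha F hF
  have hX : ∀ {F}, j ∉ F → (MvPolynomial.X j ^ ℓ : MvPolynomial (Fin n) k) • h F =
      koszulSign j F • g (insert j F) := fun hF => by rw [h_neg hF]; exact hXa _ hF
  refine ⟨h, ⟨h_mem, fun F hF => ?_⟩, funext fun F => ?_⟩
  · by_cases hjF : j ∈ F
    · exact h_pos hjF
    · refine X_pow_smul_eq_zero hx (hpos F) (h_mem F) ((hX hjF).trans ?_)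
      rw [hg.2, smul_zero]
      rw [Finset.card_insert_of_notMem hjF]
      push_cast
      omega
  · rw [koszulCoboundary_apply]
    by_cases hjF : j ∈ F
    · rw [Finset.sum_eq_single_of_mem j hjF]
      · rw [hX (Finset.notMem_erase j F), Finset.insert_erase hjF, smul_smul, koszulSign_mul_self,
          one_smul]
      · intro b hb hne
        rw [h_pos (Finset.mem_erase.2 ⟨hne.symm, hjF⟩), smul_zero, smul_zero]
    · rw [← sub_eq_zero]
      -- For `j ∉ F` the equation is tested after multiplication by the injective `x_j^ℓ`, where it
      -- becomes the cocycle condition for `g` at `F ∪ {j}`.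
      refine X_pow_smul_eq_zero (ℓ := ℓ) hx (hpos F)
        (sub_mem (AddSubgroup.sum_mem _ fun b hb => zsmul_mem ?_ _) (hg.1 F)) ?_
      · have := smul_mem_faceModuleDegree hx (X_pow_mem_polyDegree k n ℓ b) (h_mem (F.erase b))
        rwa [← koszulShift_erase ℓ hb, add_right_comm, add_comm]
      · have hc := congrFun hδ (insert j F)
        rw [koszulCoboundary_apply, Finset.sum_insert hjF, Finset.erase_insert hjF,
          Pi.zero_apply] at hc
        rw [smul_sub, Finset.smul_sum, sub_eq_zero]
        have hc' := congrArg (fun v => koszulSign j F • v) hc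
        rw [smul_add, smul_smul, koszulSign_mul_self, one_smul, smul_zero, Finset.smul_sum,
          add_eq_zero_iff_eq_neg] at hc'
        rw [hc', ← Finset.sum_neg_distrib]
        refine Finset.sum_congr rfl fun b hb => ?_
        have hbj : b ≠ j := fun e => hjF (e ▸ hb)
        have hjb : j ∉ F.erase b := fun hm => hjF (Finset.mem_of_mem_erase hm)
        have hsw := koszulSign_swap hbj (Finset.notMem_erase b F) hjb
        rw [Finset.erase_insert_of_ne hbj.symm, smul_comm _ (koszulSign b _),
          smul_comm (MvPolynomial.X j ^ ℓ : MvPolynomial (Fin n) k), hX hjb,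
          smul_comm _ (koszulSign j _), smul_smul, smul_smul, ← neg_smul]
        congr 1
        rw [Finset.insert_erase hb] at hsw
        have e1 := koszulSign_mul_self j (F.erase b)
        have e2 := koszulSign_mul_self j F
        linear_combination (koszulSign j F * koszulSign j (F.erase b)) * hsw -
          (koszulSign j F * koszulSign b (insert j (F.erase b))) * e1 -
          (koszulSign b (F.erase b) * koszulSign j (F.erase b)) * e2

end Vanishing

/-! ### Comparison of cohomologies -/

section Assembly

/-- The maps `Ψ z` jointly identify `V'` and `V` with products of subspaces. The ambient `H` also
contains `d V`, so joint injectivity on `H` detects cocycles without a description of the next term.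
-/
theorem nonempty_subCohomology_equiv {k E ι : Type*} {W : ι → Type*} [Field k] [AddCommGroup E]
    [Module k E] [∀ z, AddCommGroup (W z)] [∀ z, Module k (W z)] (d : E →ₗ[k] E)
    (D : ∀ z, W z →ₗ[k] W z) (Ψ : ∀ z, E →ₗ[k] W z) {H V' V : Submodule k E}
    {U' U : ∀ z, Submodule k (W z)} (hd : ∀ g ∈ H, d g ∈ H) (hV' : V' ≤ H) (hV : V ≤ H)
    (inj : ∀ g ∈ H, (∀ z, Ψ z g = 0) → g = 0) (comm : ∀ g ∈ H, ∀ z, D z (Ψ z g) = Ψ z (d g))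
    (mem : ∀ g ∈ V, ∀ z, Ψ z g ∈ U z) (mem' : ∀ g ∈ V', ∀ z, Ψ z g ∈ U' z)
    (surj : ∀ c : ∀ z, W z, (∀ z, c z ∈ U z) → ∃ g ∈ V, ∀ z, Ψ z g = c z)
    (surj' : ∀ c : ∀ z, W z, (∀ z, c z ∈ U' z) → ∃ g ∈ V', ∀ z, Ψ z g = c z) :
    Nonempty (SubCohomology d V' V ≃ₗ[k] ∀ z, SubCohomology (D z) (U' z) (U z)) := by
  let φ : ∀ z, ↥(V ⊓ LinearMap.ker d) →ₗ[k] ↥(U z ⊓ LinearMap.ker (D z)) := fun z =>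
    ((Ψ z).comp (V ⊓ LinearMap.ker d).subtype).codRestrict _ fun g => ⟨mem g.1 g.2.1 z, by
      have h : d g.1 = 0 := g.2.2
      change D z (Ψ z g.1) = 0
      rw [comm g.1 (hV g.2.1), h, map_zero]⟩
  let Φ : ↥(V ⊓ LinearMap.ker d) →ₗ[k] ∀ z, SubCohomology (D z) (U' z) (U z) :=
    LinearMap.pi fun z => (Submodule.mkQ _).comp (φ z)
  have hker : LinearMap.ker Φ = (V'.map d).comap (V ⊓ LinearMap.ker d).subtype := by
    ext g
    have h0 : g ∈ LinearMap.ker Φ ↔ ∀ z, ∃ h ∈ U' z, D z h = Ψ z g.1 := by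
      rw [LinearMap.mem_ker, funext_iff]
      refine forall_congr' fun z => ?_
      exact (Submodule.Quotient.mk_eq_zero _).trans Iff.rfl
    rw [h0, Submodule.mem_comap, Submodule.mem_map]
    constructor
    · intro h
      choose h hU hD using h
      obtain ⟨e, he, hΨ⟩ := surj' h hU
      refine ⟨e, he, sub_eq_zero.1 (inj _ (sub_mem (hd e (hV' he)) (hV g.2.1)) fun z => ?_)⟩
      rw [map_sub, ← comm e (hV' he), hΨ, hD]
      exact sub_self _
    · rintro ⟨e, he, hg⟩ z
      exact ⟨Ψ z e, mem' e he z, (comm e (hV' he) z).trans (congrArg (Ψ z) hg)⟩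
  have hsurj : Function.Surjective Φ := by
    intro v
    choose c hc using fun z => Submodule.Quotient.mk_surjective _ (v z)
    obtain ⟨g, hg, hΨ⟩ := surj (fun z => (c z).1) fun z => (c z).2.1
    refine ⟨⟨g, hg, inj _ (hd g (hV hg)) fun z => ?_⟩, funext fun z => ?_⟩
    · rw [← comm g (hV hg), hΨ]
      exact (c z).2.2
    · rw [← hc z]
      exact congrArg (Submodule.Quotient.mk) (Subtype.ext (hΨ z))
  exact ⟨(Submodule.quotEquivOfEq _ _ hker.symm).trans (Φ.quotKerEquivOfSurjective hsurj)⟩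

end Assembly

/-! ### Faces of the products `[0̂, z_D] × lk(z)_{V∖C}` as pairs `(t, F)` -/

section Comparison

variable {k : Type u} [Field k] {P : Type u} [PartialOrder P] [OrderBot P] [Finite P] {n : ℕ}
  {x : Fin n ≃ Atoms P} (hx : IsLabelling (supp x)) {ℓ : ℕ} (hℓ : 0 < ℓ) {α : Fin n → ℤ}
  {B C D : Finset (Fin n)} (hα : ∀ j, -(ℓ : ℤ) ≤ α j)
  (hB : ∀ j, j ∈ B ↔ -(ℓ : ℤ) < α j ∧ α j < 0) (hC : ∀ j, j ∈ C ↔ α j = -(ℓ : ℤ))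
  (hD : ∀ j, j ∈ D ↔ 0 < α j)

section Degrees

include hℓ hα hB hC

/-- The negative coordinates of `α` are those in `B ∪ C`, and as `α ≥ -ℓ`, adding `ℓ` repairs each
of them. -/
theorem koszulShift_nonneg_iff {F : Finset (Fin n)} :
    (∀ i, 0 ≤ (koszulShift ℓ F + α) i) ↔ B ∪ C ⊆ F := by
  constructor
  · intro h j hj
    by_contra hF
    have h1 := h j
    have h2 := hα j
    simp only [koszulShift, Pi.add_apply, if_neg hF, zero_add] at h1
    rw [Finset.mem_union, hB, hC] at hj
    omega
  · intro h j
    have h2 := hα j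
    simp only [koszulShift, Pi.add_apply]
    split_ifs with hF
    · omega
    · have : j ∉ B ∪ C := fun hj => hF (h hj)
      rw [Finset.mem_union, hB, hC] at this
      omega

include hD

/-- On `F` the shift makes every coordinate positive except those in `C`, where it cancels exactly;
outside `F` only `D` remains. -/
theorem degSupport_koszulShift {F : Finset (Fin n)} (hF : B ∪ C ⊆ F) :
    degSupport (koszulShift ℓ F + α) = (F \ C) ∪ D := by
  ext j
  have h2 := hα j
  have h3 : j ∈ B ∪ C → j ∈ F := fun h => hF h
  rw [mem_degSupport, Finset.mem_union, Finset.mem_sdiff, hC, hD]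
  rw [Finset.mem_union, hB, hC] at h3
  simp only [koszulShift, Pi.add_apply]
  split_ifs with h <;> simp only [h, true_and, false_and, false_or, imp_false] at h3 ⊢ <;> omega

end Degrees

variable (x B C D) in
/-- The product `[0̂, z_D] × lk(z)_{V ∖ C}`. -/
abbrev LinkProduct (z : P) : Type u :=
  Set.Iic (restrictFace x z D) × ↥(link z ∩ inducedOn x Cᶜ)

variable (x B C D) in
/-- The set of Koszul indices corresponding to a face of a product `[0̂, z_D] × lk(z)_{V ∖ C}`. -/
def koszulIndex (z : P) (q : LinkProduct x C D z) : Finset (Fin n) :=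
  productLabel x z (restrictFace x z D) Cᶜ q ∪ (B ∪ C)

section Index

omit [OrderBot P] [Finite P]

variable {z : P} (hz : supp x z = B ∪ D)

include hx hz in
theorem restrictFace_le_and_supp : restrictFace x z D ≤ z ∧ supp x (restrictFace x z D) = D := by
  have h : D ⊆ supp x z := hz ▸ Finset.subset_union_right
  -- `restrictFace x z D` and `subface (supp x) z D` unfold to the same choice.
  exact ⟨hx.subface_le h, hx.map_subface h⟩

include hx hz in
theorem isLabelling_linkProduct : IsLabelling (productLabel x z (restrictFace x z D) Cᶜ) :=
  isLabelling_productLabel hx (restrictFace_le_and_supp hx hz).1 _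

variable (hdis : Disjoint D (B ∪ C)) (hBC : Disjoint B C)

include hx hz in
theorem supp_fst_subset (q : LinkProduct x C D z) : supp x q.1.1 ⊆ D :=
  (hx.mono q.1.2).trans (restrictFace_le_and_supp hx hz).2.le

include hx hz in
theorem subset_supp_snd (q : LinkProduct x C D z) : B ∪ D ⊆ supp x q.2.1 :=
  hz ▸ hx.mono q.2.2.1

theorem notMem_supp_snd (q : LinkProduct x C D z) {j : Fin n} (hj : j ∈ supp x q.2.1) : j ∉ C :=
  Finset.mem_compl.1 (q.2.2.2 hj)

include hx hz hdis in
theorem disjoint_productLabel (q : LinkProduct x C D z) :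
    Disjoint (productLabel x z (restrictFace x z D) Cᶜ q) (B ∪ C) := by
  refine Finset.disjoint_union_left.2 ⟨hdis.mono_left (supp_fst_subset hx hz q), ?_⟩
  rw [hz, Finset.disjoint_left]
  intro j hj hj'
  obtain ⟨h1, h2⟩ := Finset.mem_sdiff.1 hj
  have := notMem_supp_snd q h1
  simp only [Finset.mem_union] at hj' h2
  tauto

theorem subset_koszulIndex (q : LinkProduct x C D z) : B ∪ C ⊆ koszulIndex x B C D z q :=
  Finset.subset_union_right

include hx hz hdis hBC in
theorem koszulIndex_sdiff_union (q : LinkProduct x C D z) :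
    (koszulIndex x B C D z q \ C) ∪ D = supp x q.2.1 := by
  ext j
  have h1 := fun h : j ∈ supp x q.1.1 => supp_fst_subset hx hz q h
  have h2 := fun h : j ∈ B ∪ D => subset_supp_snd hx hz q h
  have h3 := notMem_supp_snd q (j := j)
  have h4 := fun h : j ∈ D => Finset.disjoint_left.1 hdis h
  have h5 := fun h : j ∈ B => Finset.disjoint_left.1 hBC h
  simp only [koszulIndex, productLabel, hz, Finset.mem_union, Finset.mem_sdiff] at *
  tauto

include hx hz hdis hBC in
theorem card_koszulIndex (q : LinkProduct x C D z) :
    (koszulIndex x B C D z q).card = rank q + B.card + C.card := by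
  rw [koszulIndex, Finset.card_union_of_disjoint (disjoint_productLabel hx hz hdis q),
    Finset.card_union_of_disjoint hBC, (isLabelling_linkProduct hx hz).rank_eq, add_assoc]

include hx hz in
theorem koszulIndex_subface (q : LinkProduct x C D z) {S : Finset (Fin n)}
    (hS : S ⊆ productLabel x z (restrictFace x z D) Cᶜ q) :
    koszulIndex x B C D z (subface (productLabel x z (restrictFace x z D) Cᶜ) q S) =
      S ∪ (B ∪ C) := by
  rw [koszulIndex, (isLabelling_linkProduct hx hz).map_subface hS]

include hx hdis in
-- The face `t` determines `z` as its face with support `B ∪ D`; removing `B ∪ C` from `F` leaves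
-- the labels of `q`.
theorem koszulIndex_injective : Function.Injective
    fun s : (Σ z : {z : P // supp x z = B ∪ D}, LinkProduct x C D z.1) =>
      (s.2.2.1, koszulIndex x B C D s.1.1 s.2) := by
  rintro ⟨⟨z, hz⟩, q⟩ ⟨⟨z', hz'⟩, q'⟩ e
  obtain ⟨e1, e2⟩ := Prod.mk.inj e
  dsimp only at e1 e2
  have hzz : z = z' := hx.eq_of_le q.2.2.1 (e1 ▸ q'.2.2.1) (hz.trans hz'.symm)
  subst hzz
  have hl : productLabel x z (restrictFace x z D) Cᶜ q =
      productLabel x z (restrictFace x z D) Cᶜ q' := by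
    have h1 := disjoint_productLabel hx hz hdis q
    have h2 := disjoint_productLabel hx hz hdis q'
    rw [← Finset.union_sdiff_cancel_right h1, ← Finset.union_sdiff_cancel_right h2]
    exact congrArg (· \ (B ∪ C)) e2
  have hq : q = q' := by
    -- Both faces lie below `(z_D, t)`, where equal labels force equality.
    refine (isLabelling_linkProduct hx hz).eq_of_le (q := (⟨restrictFace x z D, le_rfl⟩, q.2))
      ⟨q.1.2, le_rfl⟩ ⟨q'.1.2, ?_⟩ hl
    exact e1.ge
  rw [hq]

include hx hdis hBC in
theorem exists_koszulIndex_eq {F : Finset (Fin n)} (hF : B ∪ C ⊆ F) {t : P}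
    (ht : supp x t = (F \ C) ∪ D) : ∃ s : (Σ z : {z : P // supp x z = B ∪ D},
      LinkProduct x C D z.1), (s.2.2.1, koszulIndex x B C D s.1.1 s.2) = (t, F) := by
  have hBF : B ⊆ F \ C := fun j hj => Finset.mem_sdiff.2
    ⟨hF (Finset.mem_union_left _ hj), Finset.disjoint_left.1 hBC hj⟩
  have hsub : B ∪ D ⊆ supp x t := by
    rw [ht]
    exact Finset.union_subset_union hBF le_rfl
  have hz := hx.map_subface hsub
  obtain ⟨h1, h2⟩ := restrictFace_le_and_supp hx hz
  have h3 : F ∩ D ⊆ supp x (restrictFace x (subface (supp x) t (B ∪ D)) D) := by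
    rw [h2]; exact Finset.inter_subset_right
  -- `z` is the face of `t` with support `B ∪ D`, and the first component is the face of `z_D` with
  -- support `F ∩ D`.
  refine ⟨⟨⟨subface (supp x) t (B ∪ D), hz⟩, ⟨⟨_, hx.subface_le h3⟩,
    ⟨t, hx.subface_le hsub, fun j hj => ?_⟩⟩⟩, Prod.ext rfl ?_⟩
  · have h4 := fun h : j ∈ D => Finset.disjoint_left.1 hdis h
    simp only [ht, Finset.mem_union, Finset.mem_sdiff, Finset.mem_compl] at *
    tauto
  · dsimp only
    ext j
    have h4 := fun h : j ∈ D => Finset.disjoint_left.1 hdis h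
    have h5 := @hF j
    simp only [koszulIndex, productLabel, hx.map_subface h3, hz, ht, Finset.mem_union,
      Finset.mem_sdiff, Finset.mem_inter] at *
    tauto

end Index

end Comparison

/-! ### The graded pieces of `Ext` in terms of reduced cohomology -/

section LinkCohomology

variable {k : Type u} [Field k] {P : Type u} [PartialOrder P] [OrderBot P] [Finite P] {n : ℕ}
  {x : Fin n ≃ Atoms P} (hx : IsLabelling (supp x)) {ℓ : ℕ} (hℓ : 0 < ℓ) {α : Fin n → ℤ}
  {B C D : Finset (Fin n)} (hα : ∀ j, -(ℓ : ℤ) ≤ α j)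
  (hB : ∀ j, j ∈ B ↔ -(ℓ : ℤ) < α j ∧ α j < 0) (hC : ∀ j, j ∈ C ↔ α j = -(ℓ : ℤ))
  (hD : ∀ j, j ∈ D ↔ 0 < α j)

variable (k ℓ α) in
/-- The Koszul cochains with values homogeneous of degree `α`. -/
def homogeneousCochains : Submodule k (Finset (Fin n) → FaceModule k x) where
  carrier := {g | ∀ F, g F ∈ faceModuleDegree k x (koszulShift ℓ F + α)}
  add_mem' ha hb F := add_mem (ha F) (hb F)
  zero_mem' _ := zero_mem _
  smul_mem' r _ hg F := scalar_smul_mem_faceModuleDegree hx r (hg F)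

omit [Finite P] in
theorem koszulCoboundary_mem_homogeneousCochains {g : Finset (Fin n) → FaceModule k x}
    (hg : g ∈ homogeneousCochains k hx ℓ α) :
    koszulCoboundary (k := k) ℓ g ∈ homogeneousCochains k hx ℓ α := by
  intro F
  rw [koszulCoboundary_apply]
  refine AddSubgroup.sum_mem _ fun b hb => zsmul_mem ?_ _
  have := smul_mem_faceModuleDegree hx (X_pow_mem_polyDegree k n ℓ b) (hg (F.erase b))
  rwa [← koszulShift_erase ℓ hb, add_right_comm, add_comm]

include hℓ hB hC hD in
theorem disjoint_of_degrees : Disjoint D (B ∪ C) ∧ Disjoint B C := by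
  refine ⟨Finset.disjoint_left.2 fun j h1 h2 => ?_, Finset.disjoint_left.2 fun j h1 h2 => ?_⟩
  · rw [Finset.mem_union, hB, hC] at h2
    rw [hD] at h1
    omega
  · rw [hB] at h1
    rw [hC] at h2
    omega

variable (k ℓ α B C D) in
/-- The coordinates of a Koszul cochain indexed by the faces of `[0̂, z_D] × lk(z)_{V ∖ C}`. -/
def linkCoord (z : P) :
    (Finset (Fin n) → FaceModule k x) →ₗ[k] (LinkProduct x C D z → k) where
  toFun g q := coord hx q.2.1 (koszulShift ℓ (koszulIndex x B C D z q) + α)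
    (g (koszulIndex x B C D z q))
  map_add' g h := by ext q; simp
  map_smul' r g := by ext q; simp

theorem linkCoord_apply (z : P) (g : Finset (Fin n) → FaceModule k x) (q : LinkProduct x C D z) :
    linkCoord k hx ℓ α B C D z g q = coord hx q.2.1
      (koszulShift ℓ (koszulIndex x B C D z q) + α) (g (koszulIndex x B C D z q)) := rfl

include hℓ hα hB hC hD

/-- The Koszul index of `q` is its label set together with `B ∪ C`. Removing an element of `B ∪ C`
leads to a degree with a negative coordinate, so only labels of `q` contribute. For such `j`,
multiplication by `x_j^ℓ` keeps the coordinate at `t`, which equals the coordinate at the face of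
`t` belonging to the facet of `q`. -/
theorem linkCoord_koszulCoboundary {z : P} (hz : supp x z = B ∪ D)
    {g : Finset (Fin n) → FaceModule k x} (hg : g ∈ homogeneousCochains k hx ℓ α)
    (q : LinkProduct x C D z) :
    linkCoord k hx ℓ α B C D z (koszulCoboundary (k := k) ℓ g) q =
      ∑ j ∈ productLabel x z (restrictFace x z D) Cᶜ q,
        (koszulSign j ((productLabel x z (restrictFace x z D) Cᶜ q).erase j ∪ (B ∪ C)) : k) *
          linkCoord k hx ℓ α B C D z g (subface (productLabel x z (restrictFace x z D) Cᶜ) q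
            ((productLabel x z (restrictFace x z D) Cᶜ q).erase j)) := by
  obtain ⟨hdis, hBC⟩ := disjoint_of_degrees hℓ hB hC hD
  have hL := isLabelling_linkProduct (C := C) hx hz
  have hdq := disjoint_productLabel hx hz hdis q
  have hq := koszulIndex_sdiff_union hx hz hdis hBC q
  rw [linkCoord_apply, koszulCoboundary_apply, map_sum]
  symm
  refine Finset.sum_subset_zero_on_sdiff Finset.subset_union_left (fun j hj => ?_) fun j hj => ?_
  · obtain ⟨hj1, hj2⟩ := Finset.mem_sdiff.1 hj
    have hjT : j ∈ B ∪ C := (Finset.mem_union.1 hj1).resolve_left hj2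
    have : g ((koszulIndex x B C D z q).erase j) = 0 :=
      eq_zero_of_coord hx (hg _) fun h => absurd
        ((koszulShift_nonneg_iff hℓ hα hB hC).1 h hjT) (Finset.notMem_erase j _)
    rw [this, smul_zero, smul_zero, map_zero]
  · set S := (productLabel x z (restrictFace x z D) Cᶜ q).erase j with hSdef
    have hjT : j ∉ B ∪ C := Finset.disjoint_left.1 hdq hj
    have hS : S ⊆ productLabel x z (restrictFace x z D) Cᶜ q := Finset.erase_subset _ _
    have hSe : (koszulIndex x B C D z q).erase j = S ∪ (B ∪ C) := by
      rw [koszulIndex, Finset.erase_union_distrib, Finset.erase_eq_of_notMem hjT]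
    have hjF : j ∈ koszulIndex x B C D z q := Finset.mem_union_left _ hj
    have hjq : j ∈ supp x q.2.1 := by
      rw [← hq]
      exact Finset.mem_union_left _ (Finset.mem_sdiff.2
        ⟨hjF, fun h => hjT (Finset.mem_union_right _ h)⟩)
    have hsub := koszulIndex_subface (B := B) hx hz q hS
    have hq' := koszulIndex_sdiff_union hx hz hdis hBC
      (subface (productLabel x z (restrictFace x z D) Cᶜ) q S)
    have hle := (hL.subface_le hS).2
    rw [linkCoord_apply, map_zsmul, zsmul_eq_mul, ← koszulShift_erase ℓ hjF, add_right_comm,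
      coord_X_pow_smul hx hjq, hSe, hsub]
    congr 1
    rw [hsub, ← degSupport_koszulShift hℓ hα hB hC hD Finset.subset_union_right] at hq'
    rw [hx.eq_subface hle hq'.symm, coord_subface]
    rw [hq']
    exact hx.mono hle

theorem eq_zero_of_linkCoord {g : Finset (Fin n) → FaceModule k x}
    (hg : g ∈ homogeneousCochains k hx ℓ α)
    (h : ∀ z : {z : P // supp x z = B ∪ D}, linkCoord k hx ℓ α B C D z.1 g = 0) : g = 0 := by
  obtain ⟨hdis, hBC⟩ := disjoint_of_degrees hℓ hB hC hD
  refine funext fun F => eq_zero_of_coord hx (hg F) fun hpos t ht => ?_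
  have hF := (koszulShift_nonneg_iff hℓ hα hB hC).1 hpos
  rw [degSupport_koszulShift hℓ hα hB hC hD hF] at ht
  obtain ⟨⟨z, q⟩, e⟩ := exists_koszulIndex_eq hx hdis hBC hF ht
  obtain ⟨rfl, rfl⟩ := Prod.mk.inj e
  exact congrFun (h z) q

theorem exists_linkCoord_eq (j : ℤ)
    (c : ∀ z : {z : P // supp x z = B ∪ D}, LinkProduct x C D z.1 → k)
    (hc : ∀ z, c z ∈ cochains k (LinkProduct x C D z.1) (j - B.card - C.card - 1)) :
    ∃ g ∈ koszulCochains (isGradedModule_faceModuleDegree (k := k) hx) ℓ α j,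
      ∀ z : {z : P // supp x z = B ∪ D}, linkCoord k hx ℓ α B C D z.1 g = c z := by
  classical
  obtain ⟨hdis, hBC⟩ := disjoint_of_degrees hℓ hB hC hD
  -- The values prescribed on all the products are gathered into one function of pairs `(t, F)`;
  -- injectivity of the indexing makes this consistent.
  let c' : P × Finset (Fin n) → k := Function.extend
    (fun s : (Σ z : {z : P // supp x z = B ∪ D}, LinkProduct x C D z.1) =>
      (s.2.2.1, koszulIndex x B C D s.1.1 s.2)) (fun s => c s.1 s.2) 0
  have hc' : ∀ (z : {z : P // supp x z = B ∪ D}) (q : LinkProduct x C D z.1),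
      c' (q.2.1, koszulIndex x B C D z.1 q) = c z q := fun z q =>
    (koszulIndex_injective hx hdis).extend_apply (fun s => c s.1 s.2) 0 ⟨z, q⟩
  have key : ∀ F : Finset (Fin n), ∃ a ∈ faceModuleDegree k x (koszulShift ℓ F + α),
      ((F.card : ℤ) ≠ j → a = 0) ∧ ((F.card : ℤ) = j → B ∪ C ⊆ F → ∀ t,
        supp x t = (F \ C) ∪ D → coord hx t (koszulShift ℓ F + α) a = c' (t, F)) := by
    intro F
    by_cases h : (F.card : ℤ) = j ∧ B ∪ C ⊆ F
    · obtain ⟨a, ha, hac⟩ := exists_mem_faceModuleDegree hx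
        ((koszulShift_nonneg_iff hℓ hα hB hC).2 h.2) fun t => c' (t, F)
      rw [degSupport_koszulShift hℓ hα hB hC hD h.2] at hac
      exact ⟨a, ha, fun h' => absurd h.1 h', fun _ _ => hac⟩
    · exact ⟨0, zero_mem _, fun _ => rfl, fun h1 h2 => absurd ⟨h1, h2⟩ h⟩
  choose g hg hg0 hgc using key
  refine ⟨g, ⟨hg, hg0⟩, fun z => funext fun q => ?_⟩
  rw [linkCoord_apply]
  have hcard := card_koszulIndex hx z.2 hdis hBC q
  by_cases h : ((koszulIndex x B C D z.1 q).card : ℤ) = j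
  · rw [hgc _ h (subset_koszulIndex q) _ (koszulIndex_sdiff_union hx z.2 hdis hBC q).symm, hc']
  · rw [hg0 _ h, map_zero, hc z q]
    rw [hcard] at h
    push_cast at h
    omega

omit hα in
theorem linkCoord_mem_cochains {j : ℤ} {g : Finset (Fin n) → FaceModule k x}
    (hg : g ∈ koszulCochains (isGradedModule_faceModuleDegree (k := k) hx) ℓ α j)
    {z : P} (hz : supp x z = B ∪ D) : linkCoord k hx ℓ α B C D z g ∈
      cochains k (LinkProduct x C D z) (j - B.card - C.card - 1) := by
  obtain ⟨hdis, hBC⟩ := disjoint_of_degrees hℓ hB hC hD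
  intro q hq
  rw [linkCoord_apply, hg.2, map_zero]
  rw [card_koszulIndex hx hz hdis hBC]
  push_cast
  omega

include hx in
-- Multiplying the link coordinates by the signs `ε z` turns the Koszul coboundary into the
-- coboundary of the given orientations, for all `z` simultaneously.
theorem nonempty_extDegree_equiv (O : ∀ z : {z : P // supp x z = B ∪ D},
      Orientation (LinkProduct x C D z.1)) (i : ℕ) :
    Nonempty (extDegree k (powQuotientDegree k n ℓ) (faceModuleDegree k x) i α ≃ₗ[k]
      DirectSum {z : P // supp x z = B ∪ D} fun z =>
        ReducedCohomology k (O z) ((i : ℤ) - B.card - C.card - 1)) := by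
  classical
  obtain ⟨hdis, hBC⟩ := disjoint_of_degrees hℓ hB hC hD
  choose ε hε hcob using fun z : {z : P // supp x z = B ∪ D} =>
    (isLabelling_linkProduct (C := C) hx z.2).exists_sign_coboundary k (O z) (B ∪ C)
      (disjoint_productLabel hx z.2 hdis)
  have hε' : ∀ z q, (ε z q : k) * (ε z q : k) = 1 := fun z q => by
    rw [← Int.cast_mul, hε, Int.cast_one]
  let Ψ : ∀ z : {z : P // supp x z = B ∪ D},
      (Finset (Fin n) → FaceModule k x) →ₗ[k] (LinkProduct x C D z.1 → k) := fun z =>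
    (LinearMap.mulLeft k fun q => (ε z q : k)).comp (linkCoord k hx ℓ α B C D z.1)
  have hΨ : ∀ z g q, Ψ z g q = (ε z q : k) * linkCoord k hx ℓ α B C D z.1 g q :=
    fun _ _ _ => rfl
  have mem : ∀ j : ℤ, ∀ g ∈ koszulCochains (isGradedModule_faceModuleDegree (k := k) hx) ℓ α j,
      ∀ z, Ψ z g ∈ cochains k (LinkProduct x C D z.1) (j - B.card - C.card - 1) := by
    intro j g hg z q hq
    rw [hΨ, linkCoord_mem_cochains hx hℓ hB hC hD hg z.2 q hq, mul_zero]
  have surj : ∀ (j : ℤ) (c : ∀ z : {z : P // supp x z = B ∪ D}, LinkProduct x C D z.1 → k),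
      (∀ z, c z ∈ cochains k (LinkProduct x C D z.1) (j - B.card - C.card - 1)) →
      ∃ g ∈ koszulCochains (isGradedModule_faceModuleDegree (k := k) hx) ℓ α j,
        ∀ z, Ψ z g = c z := by
    intro j c hc
    obtain ⟨g, hg, hgc⟩ := exists_linkCoord_eq hx hℓ hα hB hC hD j
      (fun z q => (ε z q : k) * c z q) fun z q hq => mul_eq_zero_of_right _ (hc z q hq)
    refine ⟨g, hg, fun z => funext fun q => ?_⟩
    rw [hΨ, hgc, ← mul_assoc, hε', one_mul]
  have hm : (i : ℤ) - B.card - C.card - 1 - 1 = ((i : ℤ) - 1) - B.card - C.card - 1 := by ring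
  obtain ⟨e⟩ := nonempty_subCohomology_equiv (koszulδ k (FaceModule k x) ℓ)
    (fun z => coboundary k (O z)) Ψ (H := homogeneousCochains k hx ℓ α)
    (V' := koszulCochains (isGradedModule_faceModuleDegree (k := k) hx) ℓ α ((i : ℤ) - 1))
    (V := koszulCochains (isGradedModule_faceModuleDegree (k := k) hx) ℓ α i)
    (U' := fun z => cochains k (LinkProduct x C D z.1) ((i : ℤ) - B.card - C.card - 1 - 1))
    (U := fun z => cochains k (LinkProduct x C D z.1) ((i : ℤ) - B.card - C.card - 1))
    (fun g hg => koszulCoboundary_mem_homogeneousCochains hx hg) (fun g hg => hg.1)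
    (fun g hg => hg.1)
    (fun g hg h => eq_zero_of_linkCoord hx hℓ hα hB hC hD hg fun z => funext fun q => by
      have := congrFun (h z) q
      rw [hΨ, Pi.zero_apply] at this
      rw [← one_mul (linkCoord k hx ℓ α B C D z.1 g q), ← hε' z q, mul_assoc, this, mul_zero]
      rfl)
    (fun g hg z => funext fun q => by
      rw [hΨ, koszulδ_apply, linkCoord_koszulCoboundary hx hℓ hα hB hC hD z.2 hg]
      exact hcob z (linkCoord k hx ℓ α B C D z.1 g) q)
    (mem i) (hm ▸ mem (i - 1)) (surj i) (hm ▸ surj (i - 1))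
  have : Fintype {z : P // supp x z = B ∪ D} := Fintype.ofFinite _
  exact ⟨((extDegreeEquiv (isGradedModule_faceModuleDegree (k := k) hx) ℓ α i).trans e).trans
    (DirectSum.linearEquivFunOnFintype k {z : P // supp x z = B ∪ D} fun z =>
      ReducedCohomology k (O z) ((i : ℤ) - B.card - C.card - 1)).symm⟩

end LinkCohomology

end SimplicialPosets

end

open SimplicialPosets in
theorem theorem3p1 {k P : Type u} [Field k] [Finite P] [PartialOrder P] [OrderBot P]
    (hP : IsSimplicialPoset P) {n : ℕ} (x : Fin n ≃ Atoms P)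
    (ℓ : ℕ) (hℓ : 0 < ℓ) (α : Fin n → ℤ) (B C D : Finset (Fin n))
    (hB : ∀ j, j ∈ B ↔ -(ℓ : ℤ) < α j ∧ α j < 0)
    (hC : ∀ j, j ∈ C ↔ α j = -(ℓ : ℤ))
    (hD : ∀ j, j ∈ D ↔ 0 < α j) (i : ℕ) :
    ((∀ j, -(ℓ : ℤ) ≤ α j) →
      ∀ O : ∀ z : {z : P // supp x z = B ∪ D},
        Orientation (Set.Iic (restrictFace x z.1 D) × ↥(link z.1 ∩ inducedOn x Cᶜ)),
      Nonempty
        (extDegree k (powQuotientDegree k n ℓ) (faceModuleDegree k x) i α ≃ₗ[k]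
          DirectSum {z : P // supp x z = B ∪ D} fun z =>
            ReducedCohomology k (O z) ((i : ℤ) - B.card - C.card - 1))) ∧
    ((¬ ∀ j, -(ℓ : ℤ) ≤ α j) →
      extDegree k (powQuotientDegree k n ℓ) (faceModuleDegree k x) i α = ⊥) ∧
    (D.Nonempty →
      extDegree k (powQuotientDegree k n ℓ) (faceModuleDegree k x) i α = ⊥) := by
  have hx := hP.isLabelling_supp x
  refine ⟨fun hα O => nonempty_extDegree_equiv hx hℓ hα hB hC hD O i, fun h => ?_, ?_⟩
  · obtain ⟨j, hj⟩ := not_forall.1 h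
    exact extDegree_eq_bot_of_lt hx ℓ (not_le.1 hj) i
  · rintro ⟨j, hj⟩
    exact extDegree_eq_bot_of_pos hx ℓ ((hD j).1 hj) i
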